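/- **Setting.** A Bernstein function is a $C^\infty$ function $\phi\ge 0$ on $(0,\infty)$, $\phi\not\equiv0$, whose derivative is completely monotone. It can be written $\phi(z)=m+\sigma^2z+\int_0^\infty(1-e^{-zy})\,\mu(dy)$ with $m,\sigma^2\ge0$ and $\int_0^\infty(1\wedge y)\mu(dy)<\infty$; by this formula $\phi$ is extended to all $z\in\mathbb C$ for which the integral converges absolutely, and we put $\phi(u)=-\infty$ for real $u<0$ with $\int_0^\infty(e^{-uy}-1)\mu(dy)=\infty$. Let $d_\phi=\sup\{u\le0:\phi(u)=-\infty\text{ or }\phi(u)=0\}\in[-\infty,0]$, $\sup\emptyset=-\infty$, and $$W_\phi(z)=\frac{e^{-\gamma_\phi z}}{\phi(z)}\prod_{k=1}^\infty\frac{\phi(k)}{\phi(k+z)}e^{\frac{\phi'(k)}{\phi(k)}z},\qquad \gamma_\phi=\lim_{n\to\infty}\Big(\sum_{k=1}^n\frac{\phi'(k)}{\phi(k)}-\ln\phi(n)\Big).$$ Say that $\phi\in\mathcal B_{\mathcal N}$ with triplet $(\sigma,m,\Pi)$, where $\sigma,m\ge 0$ and $\Pi$ is a measure on $(0,\infty)$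 with $\int_0^\infty(y^2\wedge y)\Pi(dy)<\infty$, if $\phi(u)=m+\sigma^2u+\int_0^\infty(1-e^{-uy})\Pi(y,\infty)\,dy$ for $u>0$. Put $\psi(z)=\sigma^2z^2+mz+\int_0^\infty(e^{-zy}-1+zy)\Pi(dy)$. The generalized Laguerre semigroup associated with $\psi$ is the generalized Laguerre semigroup $P=(P_t)_{t\ge0}$ on $C_0([0,\infty))$ whose generator is $$Gf(x)=\sigma^2xf''(x)+(m+\sigma^2-x)f'(x)+\int_0^\infty\big(f(e^{-y}x)-f(x)+yxf'(x)\big)\frac{\Pi(dy)}x,\quad x>0,$$ for all $f\in C_0([0,\infty))$ such that $u\mapsto f(e^u)$ is $C^2$ and has, with its first two derivatives, finite limits at $\pm\infty$, and such that $Gf$ extends to an element of $C_0([0,\infty))$. Here a generalized Laguerre semigroup is a Feller semigroup $P$ on $C_0([0,\infty))$ such that $K_tf=P_{\ln(t+1)}\big(f((t+1)\,\cdot)\big)$ is a Feller semigroup with $K_tf(cx)=K_{t/c}\big(f(c\,\cdot)\big)(x)$ for $t,x,c>0$, such that $P$ has an invariant probability measure on $(0,\infty)$ (possibly a point mass), and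 such that for every $x>0$ there is a measure $J_x$ with $J_x(x,\infty)=0$ and $\lim_{t\downarrow0}t^{-1}P_tf(x)=\int f\,dJ_x$ for $f\in C_c^\infty((0,\infty)\setminus\{x\})$. $V_\psi$ denotes a positive random variable whose law is invariant for $P$. **Theorem.** Let $\phi$ be a Bernstein function. 1. There is a positive random variable $V_\phi$, whose law is determined by its moments $\mathbb E[V_\phi^n]=\prod_{k=1}^n\phi(k)$, $n\ge0$. If moreover $\phi\in\mathcal B_{\mathcal N}$ with triplet $(\sigma,m,\Pi)$, then $\psi(z)=z\phi(z)$ for $\Re z\ge0$ and $V_\phi$ has the same law as $V_\psi$; that is, the law of $V_\phi$ is the one and only invariant probability measure on $(0,\infty)$ of the generalized Laguerre semigroup associated with $\psi$. 2. The limit $\gamma_\phi$ exists and $0\le\gamma_\phi+\ln\phi(1)\le\phi'(1)/\phi(1)<\infty$. The product $W_\phi$ is absolutely convergent (with no vanishing denominator) on $\{\Re z>d_\phi\}$, where $W_\phi$ is analytic. If in addition $\phi(0)=m>0$ and $d_\phi=0$, it is absolutely convergent on $\{\Re z\ge0\}$ and $W_\phi$ is continuous there. 3. Let $S=\{\Re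 z>d_\phi\}$ or, if $\phi(0)>0$ and $d_\phi=0$, also $S=\{\Re z\ge0\}$. On $S$ the Mellin transform $\mathcal M_{V_\phi}(z)=\mathbb E[V_\phi^{z-1}]$ is well defined and equals $W_\phi(z)$. The function $W_\phi$ satisfies $$\mathcal M(z+1)=\phi(z)\mathcal M(z)\ (z\in S),\qquad \mathcal M(1)=1,$$ and it is the only such function on $S$ that is the (absolutely convergent) Mellin transform $\int x^{z-1}\nu(dx)$ of a probability measure $\nu$ on $(0,\infty)$. -/

import Mathlib

open MeasureTheory Filter Set
open scoped NNReal Topology ContDiff ZeroAtInfty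

noncomputable section

namespace GenLaguerre

/-! ### Bernstein functions -/

/-- Complete monotonicity on the open half-line `(0, ∞)`. -/
def IsCompletelyMonotone (f : ℝ → ℝ) : Prop :=
  ContDiffOn ℝ ∞ f (Ioi 0) ∧
    ∀ n : ℕ, ∀ u : ℝ, 0 < u → 0 ≤ (-1 : ℝ) ^ n * iteratedDeriv n f u

/-- The class `𝓑` of Bernstein functions: smooth, non-negative and not identically zero on `(0, ∞)`,
with completely monotone derivative. The values of `φ` on `(-∞, 0]` play no role. -/
def IsBernstein (φ : ℝ → ℝ) : Prop :=
  ContDiffOn ℝ ∞ φ (Ioi 0) ∧ (∃ u : ℝ, 0 < u ∧ φ u ≠ 0) ∧ (∀ u : ℝ, 0 < u → 0 ≤ φ u) ∧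
    IsCompletelyMonotone (deriv φ)

/-- Lévy triplet of a (possibly killed) subordinator: killing rate `m`, drift `s` (the coefficient
written `σ²`), and a Lévy measure `μ` on `(0, ∞)` with `∫ (1 ∧ y) μ(dy) < ∞`. -/
structure BernsteinTriplet where
  m : ℝ
  s : ℝ
  μ : Measure ℝ
  m_nonneg : 0 ≤ m
  s_nonneg : 0 ≤ s
  μ_Iic : μ (Iic 0) = 0
  μ_fin : ∫⁻ y, ENNReal.ofReal (min 1 y) ∂μ < ⊤

namespace BernsteinTriplet

/-- `φ(z) = m + σ² z + ∫ (1 - e^{-zy}) μ(dy)`; this is the extension of the Bernstein function to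
all complex `z` for which the integral converges absolutely. In particular `φ(0) = m`. -/
def phi (T : BernsteinTriplet) (z : ℂ) : ℂ :=
  (T.m : ℂ) + (T.s : ℂ) * z + ∫ y in Ioi (0 : ℝ), (1 - Complex.exp (-z * (y : ℂ))) ∂T.μ

def Represents (T : BernsteinTriplet) (φ : ℝ → ℝ) : Prop :=
  ∀ u : ℝ, 0 < u → (φ u : ℂ) = T.phi u

/-- `φ(u) = -∞` for `u ≤ 0`: the (then non-negative) function `e^{-uy} - 1` has infinite
`μ`-integral. -/
def IsNegInfinite (T : BernsteinTriplet) (u : ℝ) : Prop :=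
  ∫⁻ y in Ioi (0 : ℝ), ENNReal.ofReal (Real.exp (-u * y) - 1) ∂T.μ = ⊤

/-- `d_φ = sup {u ≤ 0 : φ(u) = -∞ or φ(u) = 0}`, with `sup ∅ = -∞` (the latter occurs precisely
for constant `φ`). -/
def dPhi (T : BernsteinTriplet) : EReal :=
  sSup {e : EReal | ∃ u : ℝ, u ≤ 0 ∧ (T.IsNegInfinite u ∨ T.phi u = 0) ∧ e = (u : EReal)}

/-- The open half-plane `Re z > d_φ`. -/
def openDomain (T : BernsteinTriplet) : Set ℂ := {z : ℂ | T.dPhi < (z.re : EReal)}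

/-- The closed half-plane `Re z ≥ 0`. -/
def closedHalfPlane : Set ℂ := {z : ℂ | 0 ≤ z.re}

/-- The half-planes in question: `Re z > d_φ` in all cases, and also `Re z ≥ 0` when
`φ(0) > 0` and `d_φ = 0`. -/
def IsDomain (T : BernsteinTriplet) (S : Set ℂ) : Prop :=
  S = T.openDomain ∨ (0 < T.m ∧ T.dPhi = 0 ∧ S = closedHalfPlane)

end BernsteinTriplet

/-! ### The generalized Weierstrass product -/

/-- `∑_{k=1}^n φ'(k)/φ(k) - ln φ(n)`. -/
def eulerSeq (φ : ℝ → ℝ) (n : ℕ) : ℝ :=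
  (∑ k ∈ Finset.Icc 1 n, deriv φ k / φ k) - Real.log (φ n)

/-- The generalized Euler constant `γ_φ`, meaningful when `eulerSeq φ` converges. -/
def eulerGamma (φ : ℝ → ℝ) : ℝ := limUnder atTop (eulerSeq φ)

/-- The factor of index `k` (for `k ≥ 1`), where `Φ` is the complex extension of `φ`:
`φ(k)/φ(k+z) · exp(φ'(k)/φ(k) z)`. -/
def weierstrassFactor (φ : ℝ → ℝ) (Φ : ℂ → ℂ) (z : ℂ) (k : ℕ) : ℂ :=
  (φ k : ℂ) / Φ (k + z) * Complex.exp (((deriv φ k / φ k : ℝ) : ℂ) * z)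

/-- `W_φ(z) = e^{-γ_φ z}/φ(z) · ∏_{k ≥ 1} φ(k)/φ(k+z) · exp(φ'(k)/φ(k) z)`. -/
def weierstrassProduct (φ : ℝ → ℝ) (Φ : ℂ → ℂ) (z : ℂ) : ℂ :=
  Complex.exp (-(eulerGamma φ : ℂ) * z) / Φ z * ∏' k : ℕ, weierstrassFactor φ Φ z (k + 1)

/-- Absolute convergence at `z`: nothing is divided by zero and `∑_k |factor_k - 1| < ∞`. -/
def WeierstrassConverges (φ : ℝ → ℝ) (Φ : ℂ → ℂ) (z : ℂ) : Prop :=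
  Φ z ≠ 0 ∧ (∀ k : ℕ, 1 ≤ k → φ k ≠ 0 ∧ Φ (k + z) ≠ 0) ∧
    Summable fun k : ℕ => ‖weierstrassFactor φ Φ z (k + 1) - 1‖

/-! ### Mellin transforms of probability measures on `(0, ∞)` -/

def IsPositiveLaw (ν : Measure ℝ) : Prop := IsProbabilityMeasure ν ∧ ν (Iic 0) = 0

/-- `M_ν(z) = ∫ x^{z-1} ν(dx)`. -/
def mellinLaw (ν : Measure ℝ) (z : ℂ) : ℂ := ∫ x : ℝ, (x : ℂ) ^ (z - 1) ∂ν

/-- The Mellin transform is well defined (absolutely convergent) on `S`. -/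
def MellinDefinedOn (ν : Measure ℝ) (S : Set ℂ) : Prop :=
  ∀ z ∈ S, Integrable (fun x : ℝ => (x : ℂ) ^ (z - 1)) ν

/-- `M(z + 1) = φ(z) M(z)` on `S`, with `M(1) = 1`. -/
def SolvesFunctionalEq (Φ M : ℂ → ℂ) (S : Set ℂ) : Prop :=
  M 1 = 1 ∧ ∀ z ∈ S, M (z + 1) = Φ z * M z

/-! ### The class `𝓝` and generalized Laguerre semigroups -/

/-- Characteristic triplet `(σ, m, Π)` of an element of `𝓝`. -/
structure LaguerreTriplet where
  σ : ℝ
  m : ℝ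
  Pi : Measure ℝ
  σ_nonneg : 0 ≤ σ
  m_nonneg : 0 ≤ m
  Pi_Iic : Pi (Iic 0) = 0
  Pi_fin : ∫⁻ y, ENNReal.ofReal (min (y ^ 2) y) ∂Pi < ⊤

namespace LaguerreTriplet

/-- `ψ(z) = σ² z² + m z + ∫ (e^{-zy} - 1 + zy) Π(dy)`. -/
def psi (N : LaguerreTriplet) (z : ℂ) : ℂ :=
  ((N.σ ^ 2 : ℝ) : ℂ) * z ^ 2 + (N.m : ℂ) * z +
    ∫ y in Ioi (0 : ℝ), (Complex.exp (-z * (y : ℂ)) - 1 + z * (y : ℂ)) ∂N.Pi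

/-- `m + σ² u + ∫₀^∞ (1 - e^{-uy}) Π(y, ∞) dy`. -/
def ladder (N : LaguerreTriplet) (u : ℝ) : ℝ :=
  N.m + N.σ ^ 2 * u + ∫ y in Ioi (0 : ℝ), (1 - Real.exp (-u * y)) * (N.Pi (Ioi y)).toReal

/-- `φ ∈ 𝓑_𝓝` with triplet `N`. -/
def Represents (N : LaguerreTriplet) (φ : ℝ → ℝ) : Prop := ∀ u : ℝ, 0 < u → φ u = N.ladder u

/-- The integro-differential operator, for `x > 0`,
`G f(x) = σ² x f''(x) + (m + σ² - x) f'(x) + ∫ (f(e^{-y}x) - f(x) + y x f'(x)) Π(dy)/x`. -/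
def gen (N : LaguerreTriplet) (f : ℝ → ℝ) (x : ℝ) : ℝ :=
  N.σ ^ 2 * x * iteratedDeriv 2 f x + (N.m + N.σ ^ 2 - x) * deriv f x +
    (∫ y in Ioi (0 : ℝ), (f (Real.exp (-y) * x) - f x + y * x * deriv f x) ∂N.Pi) / x

end LaguerreTriplet

/-- A Feller semigroup on `C₀([0, ∞))`. -/
structure IsFellerSemigroup (P : ℝ≥0 → C₀(ℝ≥0, ℝ) → C₀(ℝ≥0, ℝ)) : Prop where
  map_add : ∀ t f g, P t (f + g) = P t f + P t g
  map_smul : ∀ t (c : ℝ) f, P t (c • f) = c • P t f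
  zero : ∀ f, P 0 f = f
  semigroup : ∀ s t f, P (s + t) f = P s (P t f)
  nonneg : ∀ t f, (∀ x, 0 ≤ f x) → ∀ x, 0 ≤ P t f x
  contraction : ∀ t f, (∀ x, f x ≤ 1) → ∀ x, P t f x ≤ 1
  continuity : ∀ f x, Tendsto (fun t => P t f x) (𝓝[>] 0) (𝓝 (f x))

/-- The dilation `d_c f(x) = f(c x)`. -/
def dilate (c : ℝ≥0) (hc : c ≠ 0) (f : C₀(ℝ≥0, ℝ)) : C₀(ℝ≥0, ℝ) :=
  f.comp (Homeomorph.mulLeft₀ c hc).toCocompactMap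

/-- `K_t f = P_{ln (t+1)} d_{t+1} f`. -/
def lamperti (P : ℝ≥0 → C₀(ℝ≥0, ℝ) → C₀(ℝ≥0, ℝ)) (t : ℝ≥0) (f : C₀(ℝ≥0, ℝ)) : C₀(ℝ≥0, ℝ) :=
  P (Real.toNNReal (Real.log ((t : ℝ) + 1))) (dilate (t + 1) (by positivity) f)

/-- `ν` is a probability measure on `(0, ∞)` with `ν P_t = ν` for all `t`. -/
def IsInvariantLaw (P : ℝ≥0 → C₀(ℝ≥0, ℝ) → C₀(ℝ≥0, ℝ)) (ν : Measure ℝ) : Prop :=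
  IsPositiveLaw ν ∧
    ∀ t f, ∫ x, P t f (Real.toNNReal x) ∂ν = ∫ x, f (Real.toNNReal x) ∂ν

/-- `f` is the restriction to `[0, ∞)` of a smooth function whose compact support is contained in
`(0, ∞) \ {x}`. -/
def IsTestAwayFrom (x : ℝ≥0) (f : C₀(ℝ≥0, ℝ)) : Prop :=
  ∃ g : ℝ → ℝ, ContDiff ℝ ∞ g ∧ HasCompactSupport g ∧ tsupport g ⊆ Ioi 0 \ {(x : ℝ)} ∧
    ∀ y : ℝ≥0, f y = g y

/-- Generalized Laguerre semigroups (of order 1). The invariant law is allowed to be a point mass,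
so that the case `ψ(u) = m u`, in which `X_t` moves deterministically, is included. -/
structure IsGLSemigroup (P : ℝ≥0 → C₀(ℝ≥0, ℝ) → C₀(ℝ≥0, ℝ)) : Prop where
  feller : IsFellerSemigroup P
  lamperti_feller : IsFellerSemigroup (lamperti P)
  self_similar : ∀ (t x c : ℝ≥0) (hc : c ≠ 0) (f : C₀(ℝ≥0, ℝ)), 0 < t → 0 < x →
    lamperti P t f (c * x) = lamperti P (c⁻¹ * t) (dilate c hc f) x
  invariant : ∃ ν : Measure ℝ, IsInvariantLaw P ν
  jump_kernel : ∀ x : ℝ≥0, 0 < x → ∃ J : Measure ℝ, J (Ioi (x : ℝ)) = 0 ∧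
    ∀ f : C₀(ℝ≥0, ℝ), IsTestAwayFrom x f →
      IntegrableOn (fun y : ℝ => f (Real.toNNReal y)) (Ioi 0 \ {(x : ℝ)}) J ∧
      Tendsto (fun t : ℝ≥0 => (t : ℝ)⁻¹ * P t f x) (𝓝[>] 0)
        (𝓝 (∫ y in Ioi 0 \ {(x : ℝ)}, f (Real.toNNReal y) ∂J))

/-- `g ∈ C²([-∞, ∞])`: `g` is `C²` and `g, g', g''` have finite limits at `±∞`. -/
def IsC2Extended (g : ℝ → ℝ) : Prop :=
  ContDiff ℝ 2 g ∧ ∀ i : ℕ, i ≤ 2 →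
    (∃ l : ℝ, Tendsto (iteratedDeriv i g) atTop (𝓝 l)) ∧
    (∃ l : ℝ, Tendsto (iteratedDeriv i g) atBot (𝓝 l))

/-- `P` is the semigroup associated with `(σ, m, Π)`: if `f ∈ C₀([0, ∞))` is such that
`u ↦ f(e^u)` is in `C²([-∞, ∞])` and `G f` extends from `(0, ∞)` to an element `h` of `C₀([0, ∞))`,
then `f` lies in the domain of the infinitesimal generator of `P`, which maps it to `h`. -/
def HasGenerator (P : ℝ≥0 → C₀(ℝ≥0, ℝ) → C₀(ℝ≥0, ℝ)) (N : LaguerreTriplet) : Prop :=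
  ∀ f h : C₀(ℝ≥0, ℝ), IsC2Extended (fun u : ℝ => f (Real.toNNReal (Real.exp u))) →
    (∀ x : ℝ≥0, 0 < x → h x = N.gen (fun y : ℝ => f (Real.toNNReal y)) x) →
    Tendsto (fun t : ℝ≥0 => ‖(t : ℝ)⁻¹ • (P t f - f) - h‖) (𝓝[>] 0) (𝓝 0)

end GenLaguerre

end

open GenLaguerre

/-!
The law of `V_φ` is built through that of `log V_φ`, so that the Mellin transform
`E[V_φ^{z-1}]` is the complex moment generating function of a law on the line, at `z - 1`.

*Representation.* A completely monotone function is the sum of its Taylor series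
(`CMOn.hasSum_taylor`), and the Taylor coefficients at a far away point are, after rescaling, the
weights of discrete laws that converge to the representing measure (`CMOn.exists_measure`,
Bernstein's theorem). Applied to `φ'`, this gives the Lévy–Khintchine formula for `φ`
(`IsBernstein.exists_triplet`).

*Convergence.* Since `φ` is concave, `u φ'(u) ≤ φ(u)`, and the second order Taylor bound gives
`φ(k+z)/φ(k) = 1 + z φ'(k)/φ(k) + O(k⁻²)`. The factors of the Weierstrass product are therefore
`1 + O(k⁻²)`, which gives its absolute convergence (`weierstrassConverges_of_ne_zero`) and shows
that it is the limit of `φ(n)^z/φ(z) ∏_{k≤n} φ(k)/φ(k+z)` (`tendsto_partialW`). Comparing these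
products at `z` and at `z + 1` yields `W_φ(z+1) = φ(z) W_φ(z)` and `W_φ(1) = 1`.

*Construction.* The function `1/φ` is completely monotone, hence the Laplace transform of a
potential measure `U`. Tilting `U` exponentially gives, for each `k`, a law with moment generating
function `φ(k)/φ(k+z)`; translated convolutions of these laws have moment generating functions
converging to `W_φ(z+1)`, and a compactness argument (`exists_law_of_tendsto_mgf`) provides the
limit law (`exists_law_weierstrassProduct`). Its moments `∏ φ(k) ≤ φ(1)^n n!` determine it
(`measure_eq_of_moments_eq`), so the half-plane in the construction can be enlarged up to
`Re z > d_φ`; the boundary `Re z = 0` is reached by Fatou's lemma and continuity (`exists_law`).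
Determinacy by moments is also behind the uniqueness of `W_φ`: a Mellin transform that solves the
functional equation has the values `∏ φ(k)` at the positive integers.

*Invariant laws.* For real `u`, `ψ(u) = u φ(u)` is the layer cake formula; the identity extends to
complex arguments by holomorphy and continuity (`Represents.psi_eq_mul_phi`). An invariant law `ν`
annihilates the range of the generator. The generator acts on `x^n` by
`G x^n = ψ(n) x^{n-1} - n x^n`, which would give `n E X^n = ψ(n) E X^{n-1}`, that is
`E X^n = φ(n) E X^{n-1}`; as powers are not in `C₀`, the argument is run with the bounded functions
`(x/(1+εx))^n`, for which all estimates are uniform in `ε` (`integral_pow_succ`). Thus every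
invariant law has the moments of `V_φ` and equals its law; since an invariant law exists, the law of
`V_φ` is invariant.
-/

open GenLaguerre

namespace GenLaguerre

open ProbabilityTheory

/-! ### Completely monotone functions and their Taylor series -/

/-- Complete monotonicity on a half-line `(c, ∞)`. -/
def CMOn (c : ℝ) (f : ℝ → ℝ) : Prop :=
  ContDiffOn ℝ ∞ f (Ioi c) ∧ ∀ n : ℕ, ∀ u : ℝ, c < u → 0 ≤ (-1 : ℝ) ^ n * iteratedDeriv n f u

namespace CMOn

variable {c : ℝ} {f : ℝ → ℝ}

lemma contDiffAt (hf : CMOn c f) {u : ℝ} (hu : c < u) : ContDiffAt ℝ ∞ f u :=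
  hf.1.contDiffAt (Ioi_mem_nhds hu)

lemma nonneg (hf : CMOn c f) {u : ℝ} (hu : c < u) : 0 ≤ f u := by
  simpa using hf.2 0 u hu

lemma coeff_nonneg (hf : CMOn c f) (k : ℕ) {b : ℝ} (hb : c < b) :
    0 ≤ (-1) ^ k * iteratedDeriv k f b / (k.factorial : ℝ) :=
  div_nonneg (hf.2 k b hb) (by positivity)

lemma iteratedDerivWithin_uIcc (hf : CMOn c f) {u b t : ℝ} (hu : c < u) (hub : u < b)
    (ht : t ∈ uIcc b u) (n : ℕ) :
    iteratedDerivWithin n f (uIcc b u) t = iteratedDeriv n f t := by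
  refine iteratedDerivWithin_eq_iteratedDeriv (uniqueDiffOn_uIcc hub.ne') ?_ ht
  rw [uIcc_of_ge hub.le] at ht
  exact (hf.contDiffAt (hu.trans_le ht.1)).of_le (by exact_mod_cast le_top)

lemma taylorWithinEval_eq (hf : CMOn c f) {u b : ℝ} (hu : c < u) (hub : u < b) (n : ℕ) :
    taylorWithinEval f n (uIcc b u) b u = ∑ k ∈ Finset.range (n + 1),
      (-1) ^ k * iteratedDeriv k f b / (k.factorial : ℝ) * (b - u) ^ k := by
  rw [taylor_within_apply]
  refine Finset.sum_congr rfl fun k _ => ?_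
  rw [hf.iteratedDerivWithin_uIcc hu hub left_mem_uIcc, show u - b = -1 * (b - u) by ring, mul_pow]
  simp only [smul_eq_mul]
  ring

lemma contDiffOn_uIcc (hf : CMOn c f) {u b : ℝ} (hu : c < u) (hub : u < b) (n : ℕ) :
    ContDiffOn ℝ n f (uIcc b u) := by
  refine (hf.1.mono ?_).of_le (by exact_mod_cast le_top)
  rw [uIcc_of_ge hub.le]
  exact fun x hx => hu.trans_le hx.1

/-- The Lagrange remainder at a point to the left of the base point is non-negative. -/
lemma sum_taylor_le (hf : CMOn c f) {u b : ℝ} (hu : c < u) (hub : u < b) (n : ℕ) :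
    ∑ k ∈ Finset.range (n + 1),
      (-1) ^ k * iteratedDeriv k f b / (k.factorial : ℝ) * (b - u) ^ k ≤ f u := by
  obtain ⟨x, hx, h⟩ := taylor_mean_remainder_lagrange_iteratedDeriv hub.ne'
    (by exact_mod_cast hf.contDiffOn_uIcc hu hub (n + 1))
  rw [hf.taylorWithinEval_eq hu hub] at h
  rw [uIoo_of_gt hub] at hx
  have h1 := hf.2 (n + 1) x (hu.trans hx.1)
  have h2 : 0 ≤ iteratedDeriv (n + 1) f x * (u - b) ^ (n + 1) / ((n + 1).factorial : ℝ) := by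
    rw [show u - b = -1 * (b - u) by ring, mul_pow]
    have h3 : 0 ≤ (b - u) ^ (n + 1) := pow_nonneg (by linarith) _
    have := mul_nonneg h1 h3
    exact div_nonneg (by nlinarith) (by positivity)
  linarith

lemma coeff_mul_pow_le (hf : CMOn c f) {u b : ℝ} (hu : c < u) (hub : u < b) (n : ℕ) :
    (-1) ^ n * iteratedDeriv n f b / (n.factorial : ℝ) * (b - u) ^ n ≤ f u := by
  refine le_trans ?_ (hf.sum_taylor_le hu hub n)
  refine Finset.single_le_sum (f := fun k => (-1) ^ k * iteratedDeriv k f b / (k.factorial : ℝ) *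
    (b - u) ^ k) (fun k _ => ?_) (Finset.self_mem_range_succ n)
  exact mul_nonneg (hf.coeff_nonneg k (hu.trans hub)) (pow_nonneg (by linarith) _)

/-- A completely monotone function on `(c, ∞)` is on `(c, b]` the sum of its Taylor series
at `b`. The Cauchy remainder at `u` is compared with the Taylor coefficients of the same
order, which are bounded through the value of `f` at a point `v` further to the left. -/
theorem hasSum_taylor (hf : CMOn c f) {u b : ℝ} (hu : c < u) (hub : u ≤ b) :
    HasSum (fun k : ℕ => (-1) ^ k * iteratedDeriv k f b / (k.factorial : ℝ) * (b - u) ^ k)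
      (f u) := by
  rcases hub.eq_or_lt with rfl | hub
  · have := hasSum_single (f := fun k : ℕ =>
      (-1) ^ k * iteratedDeriv k f u / (k.factorial : ℝ) * (u - u) ^ k) 0
      (fun k hk => by simp [hk])
    simpa using this
  obtain ⟨v, hcv, hvu⟩ := exists_between hu
  have hterm : ∀ k : ℕ, 0 ≤ (-1) ^ k * iteratedDeriv k f b / (k.factorial : ℝ) * (b - u) ^ k :=
    fun k => mul_nonneg (hf.coeff_nonneg k (hu.trans hub)) (pow_nonneg (by linarith) _)
  rw [hasSum_iff_tendsto_nat_of_nonneg hterm, ← tendsto_add_atTop_iff_nat 1]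
  set r : ℝ := (b - u) / (b - v) with hr
  have hbv : 0 < b - v := by linarith
  have hr0 : 0 ≤ r := div_nonneg (by linarith) hbv.le
  have hr1 : r < 1 := by rw [hr, div_lt_one hbv]; linarith
  have hbound : ∀ n : ℕ, f u - ∑ k ∈ Finset.range (n + 1),
      (-1) ^ k * iteratedDeriv k f b / (k.factorial : ℝ) * (b - u) ^ k ≤
      (n + 1) * r ^ n * (f v * (b - u) / (u - v)) := by
    intro n
    obtain ⟨x, hx, h⟩ := taylor_mean_remainder_cauchy (f := f) (n := n) hub.ne'
      (hf.contDiffOn_uIcc hu hub n)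
      (((hf.contDiffOn_uIcc hu hub (n + 1)).differentiableOn_iteratedDerivWithin
        (by exact_mod_cast Nat.lt_succ_self n) (uniqueDiffOn_uIcc hub.ne')).mono
        Ioo_subset_Icc_self)
    rw [hf.taylorWithinEval_eq hu hub, hf.iteratedDerivWithin_uIcc hu hub
      (Ioo_subset_Icc_self hx)] at h
    rw [uIoo_of_gt hub] at hx
    rw [h]
    have hxv : 0 < x - v := by linarith [hx.1]
    have hxu : 0 < x - u := by linarith [hx.1]
    have h1 := hf.coeff_mul_pow_le hcv (hvu.trans hx.1) (n + 1)
    -- `(x - u)/(x - v)` increases with `x ≤ b`, which gives a geometric rate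
    have hratio : (x - u) / (x - v) ≤ r := by
      rw [hr, div_le_div_iff₀ hxv hbv]
      nlinarith [hx.2]
    have hpow : (x - u) ^ n ≤ r ^ n * (x - v) ^ n := by
      rw [← mul_pow]
      exact pow_le_pow_left₀ hxu.le (by rwa [div_le_iff₀ hxv] at hratio) n
    set A := (-1) ^ (n + 1) * iteratedDeriv (n + 1) f x with hA
    have hA0 : 0 ≤ A := hf.2 (n + 1) x (hu.trans hx.1)
    have hfac : (0 : ℝ) < n.factorial := by positivity
    have hlhs : iteratedDeriv (n + 1) f x * (u - x) ^ n / (n.factorial : ℝ) * (u - b) =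
        A * (x - u) ^ n / n.factorial * (b - u) := by
      rw [show u - x = -1 * (x - u) by ring, mul_pow, hA, pow_succ]
      ring
    rw [hlhs]
    have hkey : A / n.factorial * (x - v) ^ n ≤ (n + 1) * (f v / (u - v)) := by
      rw [Nat.factorial_succ] at h1
      push_cast at h1
      have h2 : A / n.factorial * (x - v) ^ n * (x - v) ≤ (n + 1) * f v := by
        have hn : (0 : ℝ) < n + 1 := by positivity
        have e : A / ((n + 1) * n.factorial) * (x - v) ^ (n + 1) * (n + 1) =
            A / n.factorial * (x - v) ^ n * (x - v) := by
          field_simp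
          ring
        rw [← e, mul_comm _ (n + 1 : ℝ)]
        exact mul_le_mul_of_nonneg_left h1 hn.le
      rw [← mul_div_assoc, le_div_iff₀ (by linarith)]
      refine le_trans (mul_le_mul_of_nonneg_left (by linarith [hx.1] : u - v ≤ x - v) ?_) h2
      positivity
    calc A * (x - u) ^ n / n.factorial * (b - u)
        = A / n.factorial * (x - u) ^ n * (b - u) := by ring
      _ ≤ A / n.factorial * (r ^ n * (x - v) ^ n) * (b - u) := by
          have : 0 ≤ b - u := by linarith
          gcongr
      _ = r ^ n * (b - u) * (A / n.factorial * (x - v) ^ n) := by ring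
      _ ≤ r ^ n * (b - u) * ((n + 1) * (f v / (u - v))) := by
          have : 0 ≤ b - u := by linarith
          gcongr
      _ = _ := by ring
  have hlim : Tendsto (fun n : ℕ => (n + 1 : ℝ) * r ^ n * (f v * (b - u) / (u - v))) atTop
      (𝓝 0) := by
    have h1 := tendsto_self_mul_const_pow_of_lt_one hr0 hr1
    have h2 := tendsto_pow_atTop_nhds_zero_of_lt_one hr0 hr1
    have := (h1.add h2).mul_const (f v * (b - u) / (u - v))
    simpa [add_mul] using this
  have hz : Tendsto (fun n : ℕ => f u - ∑ k ∈ Finset.range (n + 1),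
      (-1) ^ k * iteratedDeriv k f b / (k.factorial : ℝ) * (b - u) ^ k) atTop (𝓝 0) :=
    squeeze_zero (fun n => sub_nonneg.2 (hf.sum_taylor_le hu hub n)) hbound hlim
  simpa using (tendsto_const_nhds (x := f u)).sub hz

end CMOn

/-! ### Limits of laws from limits of moment generating functions -/

/-- Exponential moments of exponents `±δ` bounded over a family of measures give tightness, by
Markov's inequality. -/
lemma isTightMeasureSet_of_mgf_le {S : Set (Measure ℝ)} {δ C : ℝ} (hδ : 0 < δ)
    (hS : ∀ μ ∈ S, IsFiniteMeasure μ ∧ Integrable (fun x => Real.exp (δ * x)) μ ∧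
      Integrable (fun x => Real.exp (-δ * x)) μ ∧
      mgf id μ δ + mgf id μ (-δ) ≤ C) : IsTightMeasureSet S := by
  refine isTightMeasureSet_of_tendsto_measure_norm_gt ?_
  have hlim : Tendsto (fun r : ℝ => ENNReal.ofReal (C * Real.exp (-δ * r))) atTop (𝓝 0) := by
    rw [← ENNReal.ofReal_zero]
    refine ENNReal.tendsto_ofReal ?_
    have h1 : Tendsto (fun r : ℝ => -δ * r) atTop atBot :=
      tendsto_id.const_mul_atTop_of_neg (by linarith)
    simpa using (Real.tendsto_exp_atBot.comp h1).const_mul C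
  refine tendsto_of_tendsto_of_tendsto_of_le_of_le tendsto_const_nhds hlim
    (fun _ => zero_le) fun r => iSup₂_le fun μ hμ => ?_
  obtain ⟨_, h1, h2, h3⟩ := hS μ hμ
  have hsub : {x : ℝ | r < ‖x‖} ⊆
      {x : ℝ | Real.exp (δ * r) ≤ Real.exp (δ * x) + Real.exp (-δ * x)} := by
    intro x hx
    have hx : r < |x| := hx
    rcases lt_abs.1 hx with h | h
    · exact (Real.exp_le_exp.2 (by nlinarith)).trans (le_add_of_nonneg_right (Real.exp_pos _).le)
    · exact (Real.exp_le_exp.2 (by nlinarith)).trans (le_add_of_nonneg_left (Real.exp_pos _).le)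
  have hmk := mul_meas_ge_le_integral_of_nonneg (μ := μ)
    (f := fun x => Real.exp (δ * x) + Real.exp (-δ * x))
    (ae_of_all _ fun x => by positivity) (h1.add h2) (Real.exp (δ * r))
  rw [integral_add h1 h2] at hmk
  have h4 : μ.real {x : ℝ | r < ‖x‖} ≤ C * Real.exp (-δ * r) := by
    have h5 : Real.exp (δ * r) * μ.real {x : ℝ | r < ‖x‖} ≤ C :=
      (mul_le_mul_of_nonneg_left (measureReal_mono hsub) (Real.exp_pos _).le).trans
        (hmk.trans (by simpa [mgf] using h3))
    rw [neg_mul, Real.exp_neg, ← div_eq_mul_inv, le_div_iff₀ (Real.exp_pos _)]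
    linarith
  rw [← ofReal_measureReal]
  exact ENNReal.ofReal_le_ofReal h4

/-- Continuous cutoff, equal to `1` on `[-R, R]` and to `0` outside `[-R-1, R+1]`. -/
def cutoff (R x : ℝ) : ℝ := max 0 (min 1 (R + 1 - |x|))

lemma continuous_cutoff (R : ℝ) : Continuous (cutoff R) := by unfold cutoff; fun_prop

lemma cutoff_nonneg (R x : ℝ) : 0 ≤ cutoff R x := le_max_left _ _

lemma cutoff_le_one (R x : ℝ) : cutoff R x ≤ 1 := max_le zero_le_one (min_le_left _ _)

lemma cutoff_mul_exp_le (R a x : ℝ) :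
    cutoff R x * Real.exp (a * x) ≤ Real.exp (|a| * (|R| + 1)) := by
  by_cases hx : |x| ≤ |R| + 1
  · calc cutoff R x * Real.exp (a * x) ≤ 1 * Real.exp (a * x) := by
          gcongr; exact cutoff_le_one R x
      _ ≤ _ := by
          rw [one_mul, Real.exp_le_exp]
          calc a * x ≤ |a * x| := le_abs_self _
            _ = |a| * |x| := abs_mul _ _
            _ ≤ _ := by gcongr
  · have : cutoff R x = 0 := by
      push Not at hx
      rw [cutoff, max_eq_left]
      exact (min_le_right _ _).trans (by linarith [le_abs_self R])
    rw [this, zero_mul]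
    positivity

lemma one_sub_cutoff_mul_exp_le {δ : ℝ} (hδ : 0 < δ) (R a x : ℝ) :
    (1 - cutoff R x) * Real.exp (a * x) ≤
      Real.exp (-δ * R) * (Real.exp ((a + δ) * x) + Real.exp ((a - δ) * x)) := by
  by_cases hx : |x| ≤ R
  · have : cutoff R x = 1 := by
      rw [cutoff, min_eq_left (by linarith), max_eq_right zero_le_one]
    rw [this, sub_self, zero_mul]
    positivity
  · push Not at hx
    have h1 : (1 - cutoff R x) * Real.exp (a * x) ≤ 1 * Real.exp (a * x) := by
      gcongr
      linarith [cutoff_nonneg R x]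
    refine h1.trans ?_
    rw [one_mul, mul_add, ← Real.exp_add, ← Real.exp_add]
    rcases lt_abs.1 hx with h | h
    · exact (Real.exp_le_exp.2 (by nlinarith)).trans (le_add_of_nonneg_right (Real.exp_pos _).le)
    · exact (Real.exp_le_exp.2 (by nlinarith)).trans (le_add_of_nonneg_left (Real.exp_pos _).le)

lemma norm_cexp_mul_ofReal (z : ℂ) (x : ℝ) : ‖Complex.exp (z * x)‖ = Real.exp (z.re * x) := by
  rw [Complex.norm_exp]; simp

lemma integrable_cexp_iff {μ : Measure ℝ} {z : ℂ} :
    Integrable (fun x : ℝ => Complex.exp (z * x)) μ ↔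
      Integrable (fun x : ℝ => Real.exp (z.re * x)) μ := by
  rw [← integrable_norm_iff (by fun_prop)]
  simp [norm_cexp_mul_ofReal]

/-- The tails contribute little to the complex moment generating function, uniformly over measures
with bounded moment generating function at `Re z ± δ`. -/
lemma norm_complexMGF_sub_integral_cutoff_le {μ : Measure ℝ} [IsFiniteMeasure μ] {δ : ℝ}
    (hδ : 0 < δ) (R : ℝ) (z : ℂ)
    (h0 : Integrable (fun x => Real.exp (z.re * x)) μ)
    (h1 : Integrable (fun x => Real.exp ((z.re + δ) * x)) μ)
    (h2 : Integrable (fun x => Real.exp ((z.re - δ) * x)) μ) :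
    ‖complexMGF id μ z - ∫ x, (cutoff R x : ℂ) * Complex.exp (z * x) ∂μ‖ ≤
      Real.exp (-δ * R) * (mgf id μ (z.re + δ) + mgf id μ (z.re - δ)) := by
  have hc : Integrable (fun x : ℝ => (cutoff R x : ℂ) * Complex.exp (z * x)) μ := by
    refine (integrable_cexp_iff.2 h0).bdd_mul (c := 1)
      (Complex.continuous_ofReal.comp (continuous_cutoff R)).aestronglyMeasurable
      (ae_of_all _ fun x => ?_)
    simp only [Complex.norm_real, Real.norm_eq_abs]
    rw [abs_of_nonneg (cutoff_nonneg R x)]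
    exact cutoff_le_one R x
  have e : complexMGF id μ z - ∫ x, (cutoff R x : ℂ) * Complex.exp (z * x) ∂μ =
      ∫ x : ℝ, ((1 - cutoff R x : ℝ) : ℂ) * Complex.exp (z * x) ∂μ := by
    simp only [complexMGF, id]
    rw [← integral_sub (integrable_cexp_iff.2 h0) hc]
    refine integral_congr_ae (ae_of_all _ fun x => ?_)
    simp only
    push_cast
    ring
  rw [e]
  have e2 : Real.exp (-δ * R) * (mgf id μ (z.re + δ) + mgf id μ (z.re - δ)) =
      ∫ x, Real.exp (-δ * R) * (Real.exp ((z.re + δ) * x) + Real.exp ((z.re - δ) * x)) ∂μ := by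
    rw [integral_const_mul, integral_add h1 h2]
    simp [mgf]
  rw [e2]
  refine norm_integral_le_of_norm_le ((h1.add h2).const_mul _) (ae_of_all _ fun x => ?_)
  rw [norm_mul, norm_cexp_mul_ofReal, Complex.norm_real, Real.norm_eq_abs,
    abs_of_nonneg (by linarith [cutoff_le_one R x])]
  exact one_sub_cutoff_mul_exp_le hδ R z.re x

/-- If the moment generating functions of a sequence of laws on `ℝ` converge pointwise on an open
set `I ∋ 0`, then a weak limit point `ν` of the sequence has exponential moments of all
exponents in `I`, and the complex moment generating functions converge to that of `ν` wherever
they converge. -/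
theorem exists_law_of_tendsto_mgf {μ : ℕ → Measure ℝ} [∀ n, IsProbabilityMeasure (μ n)]
    {I : Set ℝ} (hI : IsOpen I) (h0 : 0 ∈ I) {F : ℝ → ℝ}
    (hint : ∀ t ∈ I, ∀ᶠ n in atTop, Integrable (fun x => Real.exp (t * x)) (μ n))
    (hF : ∀ t ∈ I, Tendsto (fun n => mgf id (μ n) t) atTop (𝓝 (F t))) :
    ∃ ν : Measure ℝ, IsProbabilityMeasure ν ∧
      (∀ t ∈ I, Integrable (fun x => Real.exp (t * x)) ν) ∧
      ∀ z : ℂ, z.re ∈ I → ∀ G : ℂ,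
        Tendsto (fun n => complexMGF id (μ n) z) atTop (𝓝 G) → complexMGF id ν z = G := by
  have hdelta : ∀ t ∈ I, ∃ δ > 0, t + δ ∈ I ∧ t - δ ∈ I := by
    intro t ht
    obtain ⟨ε, hε, hb⟩ := Metric.isOpen_iff.1 hI t ht
    refine ⟨ε / 2, by linarith, hb ?_, hb ?_⟩ <;>
    · rw [Metric.mem_ball, Real.dist_eq]
      simp only [add_sub_cancel_left, sub_sub_cancel_left, abs_neg]
      rw [abs_of_pos] <;> linarith
  obtain ⟨δ₀, hδ₀, hp, hm⟩ := hdelta 0 h0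
  rw [zero_add] at hp
  rw [zero_sub] at hm
  set C : ℝ := F δ₀ + F (-δ₀) + 1 with hC
  have hev : ∀ᶠ n in atTop, Integrable (fun x => Real.exp (δ₀ * x)) (μ n) ∧
      Integrable (fun x => Real.exp (-δ₀ * x)) (μ n) ∧
      mgf id (μ n) δ₀ + mgf id (μ n) (-δ₀) ≤ C :=
    (hint _ hp).and ((hint _ hm).and
      (((hF _ hp).add (hF _ hm)).eventually (eventually_le_nhds (by linarith))))
  let S : Set (ProbabilityMeasure ℝ) := {p | Integrable (fun x => Real.exp (δ₀ * x)) p ∧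
      Integrable (fun x => Real.exp (-δ₀ * x)) p ∧
      mgf id (p : Measure ℝ) δ₀ + mgf id (p : Measure ℝ) (-δ₀) ≤ C}
  have htight : IsTightMeasureSet {((p : ProbabilityMeasure ℝ) : Measure ℝ) | p ∈ S} := by
    refine isTightMeasureSet_of_mgf_le hδ₀ (C := C) ?_
    rintro _ ⟨p, hp, rfl⟩
    exact ⟨inferInstance, hp⟩
  let P : ℕ → ProbabilityMeasure ℝ := fun n => ⟨μ n, inferInstance⟩
  -- limits along a non-principal ultrafilter replace the extraction of a subsequence
  let U : Ultrafilter ℕ := hyperfilter ℕ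
  have hU : (U : Filter ℕ) ≤ atTop := Nat.hyperfilter_le_atTop
  obtain ⟨p, -, hpl⟩ := (isCompact_closure_of_isTightMeasureSet htight).ultrafilter_le_nhds
    (U.map P) (by
      rw [le_principal_iff]
      exact mem_map.2 (hU (hev.mono fun n hn => subset_closure hn)))
  have hlim : Tendsto P U (𝓝 p) := hpl
  have hlimR := ProbabilityMeasure.tendsto_iff_forall_integral_tendsto.1 hlim
  have hlimC := (ProbabilityMeasure.tendsto_iff_forall_integral_rclike_tendsto ℂ).1 hlim
  -- exponential moments of the limit: weak convergence for the truncated exponentials, then Fatou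
  have hFat : ∀ t ∈ I, Integrable (fun x => Real.exp (t * x)) (p : Measure ℝ) ∧
      mgf id (p : Measure ℝ) t ≤ F t := by
    intro t ht
    have hF0 : 0 ≤ F t := ge_of_tendsto' (hF t ht) fun n => mgf_nonneg
    have hR : ∀ R : ℕ, ∫⁻ x, ENNReal.ofReal (min (Real.exp (t * x)) R) ∂(p : Measure ℝ) ≤
        ENNReal.ofReal (F t) := by
      intro R
      have hb : ∀ x : ℝ, ‖min (Real.exp (t * x)) (R : ℝ)‖ ≤ R := fun x => by
        rw [Real.norm_eq_abs, abs_of_nonneg (by positivity)]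
        exact min_le_right _ _
      let f : BoundedContinuousFunction ℝ ℝ := BoundedContinuousFunction.ofNormedAddCommGroup
        (fun x => min (Real.exp (t * x)) (R : ℝ)) (by fun_prop) R hb
      have hl : ∫ x, f x ∂(p : Measure ℝ) ≤ F t := by
        refine le_of_tendsto_of_tendsto (hlimR f) ((hF t ht).mono_left hU) ?_
        refine hU ((hint t ht).mono fun n hn => ?_)
        exact integral_mono (f.integrable _) hn fun x => min_le_left _ _
      have he := ofReal_integral_eq_lintegral_ofReal (f.integrable (p : Measure ℝ))
        (ae_of_all _ fun x => show 0 ≤ min (Real.exp (t * x)) (R : ℝ) by positivity)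
      exact he.symm.trans_le (ENNReal.ofReal_le_ofReal hl)
    have hle : ∫⁻ x, ENNReal.ofReal (Real.exp (t * x)) ∂(p : Measure ℝ) ≤
        ENNReal.ofReal (F t) := by
      calc ∫⁻ x, ENNReal.ofReal (Real.exp (t * x)) ∂(p : Measure ℝ)
          ≤ ∫⁻ x, liminf (fun R : ℕ => ENNReal.ofReal (min (Real.exp (t * x)) R)) atTop
              ∂(p : Measure ℝ) := by
            refine lintegral_mono fun x => le_of_eq ?_
            refine (Tendsto.liminf_eq ?_).symm
            refine tendsto_const_nhds.congr' ?_
            filter_upwards [eventually_ge_atTop ⌈Real.exp (t * x)⌉₊] with R hR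
            rw [min_eq_left ((Nat.le_ceil _).trans (by exact_mod_cast hR))]
        _ ≤ liminf (fun R : ℕ => ∫⁻ x, ENNReal.ofReal (min (Real.exp (t * x)) R)
              ∂(p : Measure ℝ)) atTop := lintegral_liminf_le fun R => by fun_prop
        _ ≤ ENNReal.ofReal (F t) :=
            (liminf_le_liminf (Eventually.of_forall hR)).trans (by simp)
    have hi : Integrable (fun x => Real.exp (t * x)) (p : Measure ℝ) := by
      refine ⟨by fun_prop, ?_⟩
      rw [hasFiniteIntegral_iff_ofReal (ae_of_all _ fun x => (Real.exp_pos _).le)]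
      exact hle.trans_lt ENNReal.ofReal_lt_top
    refine ⟨hi, ?_⟩
    rw [← ofReal_integral_eq_lintegral_ofReal hi (ae_of_all _ fun x => (Real.exp_pos _).le),
      ENNReal.ofReal_le_ofReal_iff hF0] at hle
    simpa [mgf] using hle
  refine ⟨p, inferInstance, fun t ht => (hFat t ht).1, fun z hz G hG => ?_⟩
  obtain ⟨δ, hδ, hzp, hzm⟩ := hdelta z.re hz
  set D : ℝ := F (z.re + δ) + F (z.re - δ) with hD
  -- the cut off integrals converge by weak convergence, and the tails are uniformly small
  have hbound : ∀ R : ℝ, ‖complexMGF id (p : Measure ℝ) z - G‖ ≤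
      Real.exp (-δ * R) * D + Real.exp (-δ * R) * D := by
    intro R
    have hb : ∀ x : ℝ, ‖(cutoff R x : ℂ) * Complex.exp (z * x)‖ ≤
        Real.exp (|z.re| * (|R| + 1)) := fun x => by
      rw [norm_mul, norm_cexp_mul_ofReal, Complex.norm_real, Real.norm_eq_abs,
        abs_of_nonneg (cutoff_nonneg R x)]
      exact cutoff_mul_exp_le R z.re x
    let f : BoundedContinuousFunction ℝ ℂ := BoundedContinuousFunction.ofNormedAddCommGroup
      (fun x => (cutoff R x : ℂ) * Complex.exp (z * x))
      (by have := continuous_cutoff R; fun_prop) _ hb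
    have h1 : ‖complexMGF id (p : Measure ℝ) z - ∫ x, f x ∂(p : Measure ℝ)‖ ≤
        Real.exp (-δ * R) * D :=
      (norm_complexMGF_sub_integral_cutoff_le hδ R z (hFat _ hz).1 (hFat _ hzp).1
        (hFat _ hzm).1).trans (mul_le_mul_of_nonneg_left
          (add_le_add (hFat _ hzp).2 (hFat _ hzm).2) (Real.exp_pos _).le)
    have h2 : ‖G - ∫ x, f x ∂(p : Measure ℝ)‖ ≤ Real.exp (-δ * R) * D := by
      refine le_of_tendsto_of_tendsto ((hG.mono_left hU).sub (hlimC f)).norm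
        ((((hF _ hzp).add (hF _ hzm)).const_mul _).mono_left hU) ?_
      refine hU ?_
      filter_upwards [hint _ hz, hint _ hzp, hint _ hzm] with n a1 a2 a3
      exact norm_complexMGF_sub_integral_cutoff_le hδ R z a1 a2 a3
    calc ‖complexMGF id (p : Measure ℝ) z - G‖ =
        ‖(complexMGF id (p : Measure ℝ) z - ∫ x, f x ∂(p : Measure ℝ)) -
          (G - ∫ x, f x ∂(p : Measure ℝ))‖ := by congr 1; ring
      _ ≤ _ := (norm_sub_le _ _).trans (add_le_add h1 h2)
  have hzero : Tendsto (fun R : ℝ => Real.exp (-δ * R) * D + Real.exp (-δ * R) * D) atTop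
      (𝓝 0) := by
    have h1 : Tendsto (fun r : ℝ => -δ * r) atTop atBot :=
      tendsto_id.const_mul_atTop_of_neg (by linarith)
    have h2 := (Real.tendsto_exp_atBot.comp h1).mul_const D
    simpa using h2.add h2
  have := ge_of_tendsto' hzero hbound
  exact sub_eq_zero.1 (norm_le_zero_iff.1 this)

/-! ### Bernstein's theorem on completely monotone functions -/

lemma integrable_and_mgf_of_lintegral {ρ : Measure ℝ} {u C : ℝ} (hC : 0 ≤ C)
    (h : ∫⁻ x, ENNReal.ofReal (Real.exp (u * x)) ∂ρ = ENNReal.ofReal C) :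
    Integrable (fun x => Real.exp (u * x)) ρ ∧ mgf id ρ u = C := by
  have h0 : 0 ≤ᵐ[ρ] fun x => Real.exp (u * x) := ae_of_all _ fun x => (Real.exp_pos _).le
  have hi : Integrable (fun x => Real.exp (u * x)) ρ := by
    refine ⟨by fun_prop, ?_⟩
    rw [hasFiniteIntegral_iff_ofReal h0, h]
    exact ENNReal.ofReal_lt_top
  refine ⟨hi, ?_⟩
  rw [← ofReal_integral_eq_lintegral_ofReal hi h0, ENNReal.ofReal_eq_ofReal_iff
    (integral_nonneg_of_ae h0) hC] at h
  simpa [mgf] using h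

lemma lintegral_exp_of_integrable {ρ : Measure ℝ} {u : ℝ}
    (hi : Integrable (fun x => Real.exp (u * x)) ρ) :
    ∫⁻ x, ENNReal.ofReal (Real.exp (u * x)) ∂ρ = ENNReal.ofReal (mgf id ρ u) := by
  rw [← ofReal_integral_eq_lintegral_ofReal hi (ae_of_all _ fun x => (Real.exp_pos _).le)]
  simp [mgf]

/-- A law whose moment generating function is bounded on `[0, ∞)` lives on `(-∞, 0]`. -/
lemma measure_Ioi_zero_of_mgf_le {ν : Measure ℝ} [IsFiniteMeasure ν] {C : ℝ}
    (h : ∀ t : ℝ, 0 ≤ t → Integrable (fun x => Real.exp (t * x)) ν ∧ mgf id ν t ≤ C) :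
    ν (Ioi 0) = 0 := by
  have hU : Ioi (0 : ℝ) = ⋃ n : ℕ, Ici (1 / ((n : ℝ) + 1)) := by
    ext x
    simp only [mem_Ioi, mem_iUnion, mem_Ici]
    refine ⟨fun hx => ?_, fun ⟨n, hn⟩ => lt_of_lt_of_le (by positivity) hn⟩
    obtain ⟨n, hn⟩ := exists_nat_one_div_lt hx
    exact ⟨n, hn.le⟩
  rw [hU, measure_iUnion_null_iff]
  intro n
  set ε : ℝ := 1 / ((n : ℝ) + 1)
  have hε : 0 < ε := by positivity
  have hb : ∀ t : ℝ, 0 ≤ t → ν.real (Ici ε) ≤ C * Real.exp (-ε * t) := by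
    intro t ht
    have hmk := mul_meas_ge_le_integral_of_nonneg (μ := ν) (f := fun x => Real.exp (t * x))
      (ae_of_all _ fun x => (Real.exp_pos _).le) (h t ht).1 (Real.exp (t * ε))
    have hsub : Ici ε ⊆ {x : ℝ | Real.exp (t * ε) ≤ Real.exp (t * x)} := fun x hx =>
      Real.exp_le_exp.2 (mul_le_mul_of_nonneg_left hx ht)
    have h2 : Real.exp (t * ε) * ν.real (Ici ε) ≤ C :=
      (mul_le_mul_of_nonneg_left (measureReal_mono hsub) (Real.exp_pos _).le).trans
        (hmk.trans (by simpa [mgf] using (h t ht).2))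
    rw [neg_mul, Real.exp_neg, ← div_eq_mul_inv, le_div_iff₀ (Real.exp_pos _), mul_comm ε]
    linarith
  have hlim : Tendsto (fun t : ℝ => C * Real.exp (-ε * t)) atTop (𝓝 0) := by
    have h1 : Tendsto (fun t : ℝ => -ε * t) atTop atBot :=
      tendsto_id.const_mul_atTop_of_neg (by linarith)
    simpa using (Real.tendsto_exp_atBot.comp h1).const_mul C
  have h3 : ν.real (Ici ε) ≤ 0 :=
    ge_of_tendsto hlim ((eventually_ge_atTop 0).mono fun t ht => hb t ht)
  exact (measureReal_eq_zero_iff).1 (le_antisymm h3 measureReal_nonneg)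

lemma tendsto_mul_one_sub_exp (t : ℝ) :
    Tendsto (fun n : ℕ => ((n : ℝ) + 1) * (1 - Real.exp (-t / ((n : ℝ) + 1)))) atTop (𝓝 t) := by
  have hd : HasDerivAt (fun x : ℝ => 1 - Real.exp (-t * x)) t 0 := by
    have h1 : HasDerivAt (fun x : ℝ => -t * x) (-t) 0 := by
      simpa using (hasDerivAt_id (0 : ℝ)).const_mul (-t)
    simpa using h1.exp.const_sub 1
  have h2 : Tendsto (fun n : ℕ => 1 / ((n : ℝ) + 1)) atTop (𝓝[>] 0) :=
    tendsto_nhdsWithin_iff.2 ⟨tendsto_one_div_add_atTop_nhds_zero_nat,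
      Eventually.of_forall fun n => by simp only [mem_Ioi]; positivity⟩
  refine (hd.tendsto_slope_zero_right.comp h2).congr fun n => ?_
  simp [div_eq_mul_inv]

namespace CMOn

variable {c : ℝ} {f : ℝ → ℝ}

lemma antitoneOn (hf : CMOn c f) : AntitoneOn f (Ioi c) := by
  intro u hu b hb hub
  rcases hub.eq_or_lt with rfl | h
  · exact le_rfl
  · simpa using hf.coeff_mul_pow_le hu h 0

/-- A completely monotone function with a zero vanishes identically. -/
lemma eq_zero_of_eq_zero (hf : CMOn c f) {e : ℝ} (he : c < e) (h0 : f e = 0) {u : ℝ}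
    (hu : c < u) : f u = 0 := by
  set b := max u e + 1
  have hbe : e < b := (le_max_right u e).trans_lt (lt_add_one _)
  have hbu : u < b := (le_max_left u e).trans_lt (lt_add_one _)
  have h1 := hf.hasSum_taylor he hbe.le
  rw [h0, hasSum_zero_iff_of_nonneg fun k =>
    mul_nonneg (hf.coeff_nonneg k (he.trans hbe)) (pow_nonneg (by linarith) _)] at h1
  have h2 := hf.hasSum_taylor hu hbu.le
  refine h2.unique ?_
  convert hasSum_zero (α := ℝ) (β := ℕ) using 2 with k
  have h3 := congrFun h1 k
  have h4 : (b - e) ^ k ≠ 0 := pow_ne_zero _ (by linarith)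
  simp only [Pi.zero_apply, mul_eq_zero, h4, or_false] at h3
  rw [h3, zero_mul]

/-- The discrete law with weights `(-1)^k f^(k)(e+β) β^k / (k! f(e))` at the points `-k/β`. -/
noncomputable def taylorLaw (f : ℝ → ℝ) (e β : ℝ) : Measure ℝ :=
  Measure.sum fun k : ℕ => ENNReal.ofReal
    ((-1) ^ k * iteratedDeriv k f (e + β) / (k.factorial : ℝ) * β ^ k / f e) •
      Measure.dirac (-k / β)

/-- The Taylor series of `f` at `e + β`, evaluated at `e + β (1 - e^{-t/β})`, is the moment
generating function of `taylorLaw f e β`. -/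
lemma lintegral_taylorLaw (hf : CMOn c f) {e β t : ℝ} (he : c < e) (hβ : 0 < β) (h0 : 0 < f e)
    (ht : c < e + β * (1 - Real.exp (-t / β))) :
    ∫⁻ x, ENNReal.ofReal (Real.exp (t * x)) ∂(taylorLaw f e β) =
      ENNReal.ofReal (f (e + β * (1 - Real.exp (-t / β))) / f e) := by
  have hle : e + β * (1 - Real.exp (-t / β)) ≤ e + β := by
    have := Real.exp_pos (-t / β)
    nlinarith
  have hs := (hf.hasSum_taylor ht hle).div_const (f e)
  have hcoef : ∀ k, 0 ≤ (-1) ^ k * iteratedDeriv k f (e + β) / (k.factorial : ℝ) := fun k =>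
    hf.coeff_nonneg k (by linarith)
  have hterm : ∀ k : ℕ, (-1) ^ k * iteratedDeriv k f (e + β) / (k.factorial : ℝ) *
      (e + β - (e + β * (1 - Real.exp (-t / β)))) ^ k / f e =
      (-1) ^ k * iteratedDeriv k f (e + β) / (k.factorial : ℝ) * β ^ k / f e *
        Real.exp (t * (-k / β)) := by
    intro k
    have : Real.exp (t * (-k / β)) = Real.exp (-t / β) ^ k := by
      rw [← Real.exp_nat_mul]
      congr 1
      ring
    rw [this, show e + β - (e + β * (1 - Real.exp (-t / β))) = β * Real.exp (-t / β) by ring,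
      mul_pow]
    ring
  simp_rw [hterm] at hs
  rw [taylorLaw, lintegral_sum_measure]
  simp_rw [lintegral_smul_measure, smul_eq_mul]
  have : ∀ k : ℕ, ∫⁻ x, ENNReal.ofReal (Real.exp (t * x)) ∂(Measure.dirac (-(k : ℝ) / β)) =
      ENNReal.ofReal (Real.exp (t * (-k / β))) := fun k =>
    lintegral_dirac' _ (by fun_prop)
  simp_rw [this]
  rw [← hs.tsum_eq, ENNReal.ofReal_tsum_of_nonneg _ hs.summable]
  · refine tsum_congr fun k => (ENNReal.ofReal_mul ?_).symm
    have := hcoef k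
    positivity
  · intro k
    have := hcoef k
    positivity

/-- **Bernstein's theorem**: a completely monotone function on `(c, ∞)` is the Laplace transform
of a measure. The measure is obtained, after an exponential tilt, as a limit of the laws
`taylorLaw f e n`. It is carried by `(-∞, 0]`, so that the Laplace transform is a moment
generating function. -/
theorem exists_measure (hf : CMOn c f) :
    ∃ ρ : Measure ℝ, SFinite ρ ∧ ρ (Ioi 0) = 0 ∧
      ∀ u, c < u → Integrable (fun x => Real.exp (u * x)) ρ ∧ mgf id ρ u = f u := by
  set e : ℝ := c + 1 with he
  have hce : c < e := by linarith
  rcases (hf.nonneg hce).eq_or_lt with h0 | h0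
  · exact ⟨0, inferInstance, by simp, fun u hu => ⟨by simp, by
      simp [hf.eq_zero_of_eq_zero hce h0.symm hu]⟩⟩
  let μ : ℕ → Measure ℝ := fun n => taylorLaw f e ((n : ℝ) + 1)
  have hpos : ∀ n : ℕ, (0 : ℝ) < (n : ℝ) + 1 := fun n => by positivity
  have hprob : ∀ n, IsProbabilityMeasure (μ n) := by
    intro n
    have := hf.lintegral_taylorLaw hce (hpos n) h0 (t := 0) (by simpa using hce)
    refine ⟨?_⟩
    simpa [h0.ne'] using this
  have hev : ∀ t ∈ Ioi (c - e), ∀ᶠ n : ℕ in atTop,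
      c < e + ((n : ℝ) + 1) * (1 - Real.exp (-t / ((n : ℝ) + 1))) := by
    intro t ht
    have := (tendsto_mul_one_sub_exp t).const_add e
    refine this.eventually (lt_mem_nhds ?_)
    have : c - e < t := ht
    linarith
  have hval : ∀ t ∈ Ioi (c - e), ∀ᶠ n : ℕ in atTop,
      Integrable (fun x => Real.exp (t * x)) (μ n) ∧
      mgf id (μ n) t = f (e + ((n : ℝ) + 1) * (1 - Real.exp (-t / ((n : ℝ) + 1)))) / f e := by
    intro t ht
    filter_upwards [hev t ht] with n hn
    exact integrable_and_mgf_of_lintegral (div_nonneg (hf.nonneg hn) h0.le)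
      (hf.lintegral_taylorLaw hce (hpos n) h0 hn)
  have hlim : ∀ t ∈ Ioi (c - e), Tendsto (fun n => mgf id (μ n) t) atTop (𝓝 (f (e + t) / f e)) := by
    intro t ht
    have ht' : c < e + t := by have : c - e < t := ht; linarith
    have h1 := ((hf.contDiffAt ht').continuousAt.tendsto.comp
      ((tendsto_mul_one_sub_exp t).const_add e)).div_const (f e)
    refine h1.congr' ?_
    filter_upwards [hval t ht] with n hn
    exact hn.2.symm
  obtain ⟨ν, hν, hint, hmgf⟩ := exists_law_of_tendsto_mgf isOpen_Ioi
    (by simp only [mem_Ioi]; linarith) (fun t ht => (hval t ht).mono fun n hn => hn.1) hlim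
  have hm : ∀ t ∈ Ioi (c - e), mgf id ν t = f (e + t) / f e := by
    intro t ht
    have h1 := hmgf t (by simpa using ht) ((f (e + t) / f e : ℝ) : ℂ) (by
      simp_rw [complexMGF_ofReal]
      exact (Complex.continuous_ofReal.tendsto _).comp (hlim t ht))
    rw [complexMGF_ofReal] at h1
    exact_mod_cast h1
  have hsupp : ν (Ioi 0) = 0 := by
    refine measure_Ioi_zero_of_mgf_le (C := 1) fun t ht => ?_
    have htm : t ∈ Ioi (c - e) := by simp only [mem_Ioi]; linarith
    refine ⟨hint t htm, ?_⟩
    rw [hm t htm, div_le_one h0]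
    exact hf.antitoneOn hce (show c < e + t by linarith) (by linarith)
  -- undo the tilt by `e^{ex}` and the normalization by `f e`
  refine ⟨ENNReal.ofReal (f e) • ν.withDensity fun x => ENNReal.ofReal (Real.exp (-e * x)),
    inferInstance, ?_, fun u hu => ?_⟩
  · rw [Measure.smul_apply, withDensity_absolutelyContinuous _ _ hsupp, smul_zero]
  · have hu' : u - e ∈ Ioi (c - e) := by simp only [mem_Ioi]; linarith
    refine integrable_and_mgf_of_lintegral (hf.nonneg hu) ?_
    rw [lintegral_smul_measure, lintegral_withDensity_eq_lintegral_mul _ (by fun_prop)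
      (by fun_prop)]
    have : ∀ x : ℝ, ((fun x => ENNReal.ofReal (Real.exp (-e * x))) *
        fun x => ENNReal.ofReal (Real.exp (u * x))) x =
        ENNReal.ofReal (Real.exp ((u - e) * x)) := by
      intro x
      rw [Pi.mul_apply, ← ENNReal.ofReal_mul (Real.exp_pos _).le, ← Real.exp_add]
      congr 2
      ring
    simp_rw [this]
    rw [lintegral_exp_of_integrable (hint _ hu'), hm _ hu', smul_eq_mul,
      ← ENNReal.ofReal_mul h0.le, mul_div_cancel₀ _ h0.ne']
    congr 2
    ring

end CMOn

/-! ### The Lévy–Khintchine representation of a Bernstein function -/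

/-- The restriction of `φ` to the real line. -/
noncomputable def BernsteinTriplet.phiReal (T : BernsteinTriplet) (u : ℝ) : ℝ :=
  T.m + T.s * u + ∫ y in Ioi (0 : ℝ), (1 - Real.exp (-u * y)) ∂T.μ

lemma BernsteinTriplet.phi_ofReal (T : BernsteinTriplet) (u : ℝ) : T.phi u = T.phiReal u := by
  rw [phi, phiReal]
  push_cast
  rw [← integral_complex_ofReal]
  simp

lemma lintegral_exp_mul_Ioo {u x : ℝ} (hu : 0 < u) (hx : x < 0) :
    ∫⁻ s in Ioo 0 u, ENNReal.ofReal (Real.exp (s * x)) =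
      ENNReal.ofReal ((1 - Real.exp (u * x)) / (-x)) := by
  rw [restrict_Ioo_eq_restrict_Ioc, ← ofReal_integral_eq_lintegral_ofReal
    ((Continuous.integrableOn_Icc (by fun_prop)).mono_set Ioc_subset_Icc_self)
    (ae_of_all _ fun s => (Real.exp_pos _).le), ← intervalIntegral.integral_of_le hu.le,
    intervalIntegral.integral_comp_mul_right (fun y => Real.exp y) hx.ne, integral_exp]
  congr 1
  simp only [zero_mul, Real.exp_zero, smul_eq_mul]
  field_simp
  ring

lemma min_one_le_two_mul_one_sub_exp {y : ℝ} (hy : 0 < y) :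
    min 1 y ≤ 2 * (1 - Real.exp (-1 * y)) := by
  have h1 : Real.exp (-1 * y) ≤ 1 / (1 + y) := by
    rw [neg_one_mul, Real.exp_neg, ← one_div]
    exact one_div_le_one_div_of_le (by linarith) (by linarith [Real.add_one_le_exp y])
  have h2 : min 1 y / 2 ≤ y / (1 + y) := by
    rw [div_le_div_iff₀ (by norm_num) (by linarith)]
    rcases min_cases 1 y with ⟨h, h'⟩ | ⟨h, h'⟩ <;> rw [h] <;> nlinarith
  have h3 : y / (1 + y) = 1 - 1 / (1 + y) := by field_simp; ring
  linarith

/-- A nondecreasing `C¹` function is the integral of its derivative over `(0, u)`, even though it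
may fail to be differentiable at `0`. -/
lemma lintegral_deriv_Ioo {f f' : ℝ → ℝ} {m u : ℝ} (hu : 0 < u)
    (hd : ∀ x, 0 < x → HasDerivAt f (f' x) x) (hpos : ∀ x, 0 < x → 0 ≤ f' x)
    (hm : Tendsto f (𝓝[>] 0) (𝓝 m)) :
    ∫⁻ s in Ioo 0 u, ENNReal.ofReal (f' s) = ENNReal.ofReal (f u - m) := by
  have hcont : ContinuousOn (Function.update f 0 m) (Icc 0 u) := by
    intro x hx
    rcases hx.1.eq_or_lt with rfl | h0
    · rw [continuousWithinAt_update_same]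
      refine hm.mono_left (nhdsWithin_mono _ ?_)
      exact fun y hy => lt_of_le_of_ne hy.1.1 (Ne.symm hy.2)
    · rw [continuousWithinAt_update_of_ne h0.ne']
      exact (hd x h0).continuousAt.continuousWithinAt
  have hi : IntegrableOn f' (Ioc 0 u) := by
    refine intervalIntegral.integrableOn_deriv_of_nonneg hcont (fun x hx => ?_)
      fun x hx => hpos x hx.1
    refine (hd x hx.1).congr_of_eventuallyEq ?_
    filter_upwards [Ioi_mem_nhds hx.1] with y hy
    rw [Function.update_of_ne (ne_of_gt hy)]
  have h := intervalIntegral.integral_eq_sub_of_hasDerivAt_of_tendsto hu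
    (fun x hx => hd x hx.1) ((intervalIntegrable_iff_integrableOn_Ioc_of_le hu.le).2 hi) hm
    (hd u hu).continuousAt.continuousWithinAt.tendsto
  rw [intervalIntegral.integral_of_le hu.le] at h
  rw [← h, restrict_Ioo_eq_restrict_Ioc, ofReal_integral_eq_lintegral_ofReal hi]
  exact (ae_restrict_iff' measurableSet_Ioc).2 (ae_of_all _ fun x hx => hpos x hx.1)

/-- Every Bernstein function has a Lévy–Khintchine representation: Bernstein's theorem applies to
`φ'`, and integration over `(0, u)` gives the representation of `φ`. -/
theorem IsBernstein.exists_triplet {φ : ℝ → ℝ} (hφ : IsBernstein φ) :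
    ∃ T : BernsteinTriplet, T.Represents φ := by
  obtain ⟨hsm, -, hnn, hcm⟩ := hφ
  obtain ⟨ρ, _, hρ, hint⟩ := CMOn.exists_measure (c := 0) (f := deriv φ) hcm
  have hd : ∀ x, 0 < x → HasDerivAt φ (deriv φ x) x := fun x hx =>
    ((hsm.contDiffAt (Ioi_mem_nhds hx)).differentiableAt (by simp)).hasDerivAt
  have hpos : ∀ x, 0 < x → 0 ≤ deriv φ x := fun x hx => CMOn.nonneg (c := 0) hcm hx
  have hmono : MonotoneOn φ (Ioi 0) := by
    refine monotoneOn_of_deriv_nonneg (convex_Ioi 0) hsm.continuousOn ?_ ?_ <;>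
      rw [interior_Ioi]
    · exact fun x hx => (hd x hx).differentiableAt.differentiableWithinAt
    · exact hpos
  have hbdd : BddBelow (φ '' Ioi 0) := ⟨0, by rintro _ ⟨x, hx, rfl⟩; exact hnn x hx⟩
  set m := sInf (φ '' Ioi 0) with hm
  have hm0 : 0 ≤ m := le_csInf ⟨_, mem_image_of_mem φ (mem_Ioi.2 one_pos)⟩
    (by rintro _ ⟨x, hx, rfl⟩; exact hnn x hx)
  have hlim : Tendsto φ (𝓝[>] 0) (𝓝 m) := hmono.tendsto_nhdsGT hbdd
  have hmle : ∀ u, 0 < u → m ≤ φ u := fun u hu => csInf_le hbdd (mem_image_of_mem _ hu)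
  have hρ0 : ρ {0} ≠ ⊤ := by
    have h1 := lintegral_exp_of_integrable (hint 1 one_pos).1
    have h2 : ∫⁻ x in {(0 : ℝ)}, ENNReal.ofReal (Real.exp (1 * x)) ∂ρ = ρ {0} := by simp
    refine ne_top_of_le_ne_top ENNReal.ofReal_ne_top (b := ENNReal.ofReal (mgf id ρ 1)) ?_
    rw [← h1, ← h2]
    exact setLIntegral_le_lintegral _ _
  -- `ρ` is the image under `y ↦ -y` of `s δ₀ + y μ(dy)`: the atom at `0` is the drift
  let μ : Measure ℝ := ((ρ.restrict (Iio 0)).withDensity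
    fun x => ENNReal.ofReal (1 / (-x))).map Neg.neg
  have hμ : ∀ u, ∫⁻ y in Ioi (0 : ℝ), ENNReal.ofReal (1 - Real.exp (-u * y)) ∂μ =
      ∫⁻ x in Iio 0, ENNReal.ofReal ((1 - Real.exp (u * x)) / (-x)) ∂ρ := by
    intro u
    rw [setLIntegral_map measurableSet_Ioi (by fun_prop) measurable_neg]
    have : (Neg.neg ⁻¹' Ioi (0 : ℝ)) = Iio 0 := by ext; simp
    rw [this, restrict_withDensity measurableSet_Iio, Measure.restrict_restrict measurableSet_Iio,
      inter_self, lintegral_withDensity_eq_lintegral_mul _ (by fun_prop) (by fun_prop)]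
    refine setLIntegral_congr_fun measurableSet_Iio fun x hx => ?_
    have hx : x < 0 := hx
    simp only [Pi.mul_apply]
    rw [← ENNReal.ofReal_mul (one_div_nonneg.2 (by linarith))]
    congr 1
    rw [neg_mul_neg]
    ring
  have hmain : ∀ u, 0 < u → ENNReal.ofReal (φ u - m) =
      ∫⁻ y in Ioi (0 : ℝ), ENNReal.ofReal (1 - Real.exp (-u * y)) ∂μ +
        ENNReal.ofReal u * ρ {0} := by
    intro u hu
    have h1 : ∫⁻ s in Ioo 0 u, ENNReal.ofReal (deriv φ s) =
        ∫⁻ s in Ioo 0 u, ∫⁻ x, ENNReal.ofReal (Real.exp (s * x)) ∂ρ := by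
      refine setLIntegral_congr_fun measurableSet_Ioo fun s hs => ?_
      rw [lintegral_exp_of_integrable (hint s hs.1).1, (hint s hs.1).2]
    rw [← lintegral_deriv_Ioo hu hd hpos hlim, h1, lintegral_lintegral_swap (by fun_prop), hμ]
    have hae : ∀ᵐ x ∂ρ, x ∈ Iic (0 : ℝ) := by
      rw [ae_iff]
      refine measure_mono_null (fun x hx => ?_) hρ
      simpa using hx
    rw [← setLIntegral_univ, setLIntegral_congr (t := Iio 0 ∪ {0})
      (by
        filter_upwards [hae] with x hx
        have : x ∈ Iio (0 : ℝ) ∪ {0} := by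
          rcases (mem_Iic.1 hx).lt_or_eq with h | h
          · exact Or.inl h
          · exact Or.inr h
        exact propext ⟨fun _ => this, fun _ => mem_univ x⟩),
      lintegral_union (measurableSet_singleton 0) (by simp)]
    congr 1
    · refine setLIntegral_congr_fun measurableSet_Iio fun x hx => ?_
      exact lintegral_exp_mul_Ioo hu hx
    · simp [mul_comm]
  have hfin : ∀ u, 0 < u → ∫⁻ y in Ioi (0 : ℝ), ENNReal.ofReal (1 - Real.exp (-u * y)) ∂μ ≠ ⊤ :=
    fun u hu => ne_top_of_le_ne_top ENNReal.ofReal_ne_top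
      ((hmain u hu).symm ▸ le_add_of_nonneg_right zero_le)
  have hμ0 : μ (Iic 0) = 0 := by
    rw [Measure.map_apply measurable_neg measurableSet_Iic]
    refine withDensity_absolutelyContinuous _ _ ?_
    rw [Measure.restrict_apply (measurable_neg measurableSet_Iic)]
    convert measure_empty (μ := ρ)
    ext x
    simp only [mem_inter_iff, mem_preimage, mem_Iic, mem_Iio, mem_empty_iff_false]
    constructor
    · rintro ⟨h1, h2⟩; linarith
    · exact False.elim
  refine ⟨⟨m, ρ.real {0}, μ, hm0, measureReal_nonneg, hμ0, ?_⟩, fun u hu => ?_⟩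
  · have h1 : ∫⁻ y, ENNReal.ofReal (min 1 y) ∂μ =
        ∫⁻ y in Ioi (0 : ℝ), ENNReal.ofReal (min 1 y) ∂μ := by
      rw [← lintegral_add_compl (fun y => ENNReal.ofReal (min 1 y)) measurableSet_Ioi, compl_Ioi,
        Measure.restrict_eq_zero.2 hμ0]
      simp
    rw [h1]
    calc ∫⁻ y in Ioi (0 : ℝ), ENNReal.ofReal (min 1 y) ∂μ
        ≤ ∫⁻ y in Ioi (0 : ℝ), 2 * ENNReal.ofReal (1 - Real.exp (-1 * y)) ∂μ := by
          refine setLIntegral_mono (by fun_prop) fun y hy => ?_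
          rw [← ENNReal.ofReal_ofNat 2, ← ENNReal.ofReal_mul (by norm_num)]
          exact ENNReal.ofReal_le_ofReal (min_one_le_two_mul_one_sub_exp hy)
      _ < ⊤ := by
          rw [lintegral_const_mul _ (by fun_prop)]
          exact ENNReal.mul_lt_top (by simp) (hfin 1 one_pos).lt_top
  · rw [BernsteinTriplet.phi_ofReal, BernsteinTriplet.phiReal]
    congr 1
    have hnn' : 0 ≤ᵐ[μ.restrict (Ioi 0)] fun y => 1 - Real.exp (-u * y) := by
      refine (ae_restrict_iff' measurableSet_Ioi).2 (ae_of_all _ fun y hy => ?_)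
      have hy : 0 < y := hy
      have : Real.exp (-u * y) ≤ 1 := Real.exp_le_one_iff.2 (by nlinarith)
      simpa using this
    simp only
    rw [integral_eq_lintegral_of_nonneg_ae hnn' (by fun_prop)]
    have h := congrArg ENNReal.toReal (hmain u hu)
    rw [ENNReal.toReal_ofReal (by linarith [hmle u hu]), ENNReal.toReal_add (hfin u hu)
      (ENNReal.mul_ne_top ENNReal.ofReal_ne_top hρ0), ENNReal.toReal_mul,
      ENNReal.toReal_ofReal hu.le] at h
    simp only [measureReal_def]
    linarith

/-! ### Bernstein functions on complex half-planes -/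

lemma norm_exp_sub_one_le_max (w : ℂ) : ‖Complex.exp w - 1‖ ≤ ‖w‖ * max 1 (Real.exp w.re) := by
  have hconv : Convex ℝ {z : ℂ | z.re ≤ max 0 w.re} := convex_halfSpace_re_le _
  have h := hconv.norm_image_sub_le_of_norm_hasDerivWithin_le (f := Complex.exp)
    (f' := Complex.exp) (C := max 1 (Real.exp w.re)) (x := 0) (y := w)
    (fun z _ => (Complex.hasDerivAt_exp z).hasDerivWithinAt) (fun z hz => ?_)
    (by simp) (by simp)
  · simpa [mul_comm] using h
  · have hz : z.re ≤ max 0 w.re := hz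
    rw [Complex.norm_exp]
    refine (Real.exp_le_exp.2 hz).trans ?_
    rw [Real.exp_monotone.map_max, Real.exp_zero]

lemma norm_exp_sub_one_sub_le_max (w : ℂ) :
    ‖Complex.exp w - 1 - w‖ ≤ ‖w‖ ^ 2 * max 1 (Real.exp w.re) := by
  have hconv : Convex ℝ (segment ℝ 0 w) := convex_segment 0 w
  have h := hconv.norm_image_sub_le_of_norm_hasDerivWithin_le
    (f := fun z => Complex.exp z - 1 - z)
    (f' := fun z => Complex.exp z - 1) (C := ‖w‖ * max 1 (Real.exp w.re)) (x := 0) (y := w)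
    (fun z _ => (((Complex.hasDerivAt_exp z).sub_const 1).sub
      (hasDerivAt_id z)).hasDerivWithinAt) (fun z hz => ?_)
    (left_mem_segment _ _ _) (right_mem_segment _ _ _)
  · simp only [Complex.exp_zero, sub_self, sub_zero] at h
    calc _ ≤ _ := h
      _ = _ := by ring
  · rw [segment_eq_image] at hz
    obtain ⟨t, ht, rfl⟩ := hz
    simp only [smul_zero, zero_add]
    refine (norm_exp_sub_one_le_max _).trans ?_
    have h1 : ‖t • w‖ ≤ ‖w‖ := by
      rw [norm_smul, Real.norm_eq_abs, abs_of_nonneg ht.1]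
      exact mul_le_of_le_one_left (norm_nonneg w) ht.2
    have h2 : (t • w).re ≤ max 0 w.re := by
      rw [Complex.real_smul, Complex.re_ofReal_mul]
      rcases le_total 0 w.re with h | h
      · rw [max_eq_right h]
        exact mul_le_of_le_one_left h ht.2
      · exact (mul_nonpos_of_nonneg_of_nonpos ht.1 h).trans (le_max_left _ _)
    have h3 : max 1 (Real.exp (t • w).re) ≤ max 1 (Real.exp w.re) := by
      refine max_le (le_max_left _ _) ((Real.exp_le_exp.2 h2).trans ?_)
      rw [Real.exp_monotone.map_max, Real.exp_zero]
    gcongr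

lemma norm_one_sub_exp_le {a y : ℝ} {z : ℂ} (ha : a ≤ 0) (hz : a ≤ z.re) (hy : 0 < y) :
    ‖1 - Complex.exp (-z * y)‖ ≤ max 2 ‖z‖ * (min 1 y * Real.exp (-a * y)) := by
  have h0 : (1 : ℝ) ≤ Real.exp (-a * y) := Real.one_le_exp (by nlinarith)
  have hre : (-z * (y : ℂ)).re = -z.re * y := by simp
  have h1 : Real.exp (-z * (y : ℂ)).re ≤ Real.exp (-a * y) := by
    rw [hre]
    exact Real.exp_le_exp.2 (by nlinarith)
  rcases min_cases 1 y with ⟨h, -⟩ | ⟨h, -⟩ <;> rw [h]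
  · calc ‖1 - Complex.exp (-z * y)‖ ≤ 1 + Real.exp (-z * (y : ℂ)).re := by
          refine (norm_sub_le _ _).trans ?_
          rw [norm_one, Complex.norm_exp]
      _ ≤ 2 * (1 * Real.exp (-a * y)) := by linarith
      _ ≤ _ := by gcongr; exact le_max_left _ _
  · rw [norm_sub_rev]
    refine (norm_exp_sub_one_le_max _).trans ?_
    rw [norm_mul, norm_neg, Complex.norm_real, Real.norm_eq_abs, abs_of_pos hy, mul_assoc]
    gcongr
    · exact le_max_right _ _
    · exact max_le h0 h1

lemma mul_exp_le_min {a b y : ℝ} (hab : a < b) (hy : 0 < y) :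
    y * Real.exp (-b * y) ≤ max 1 (1 / (b - a)) * (min 1 y * Real.exp (-a * y)) := by
  have hba : 0 < b - a := by linarith
  have e : Real.exp (-b * y) = Real.exp (-((b - a) * y)) * Real.exp (-a * y) := by
    rw [← Real.exp_add]; congr 1; ring
  rw [e, ← mul_assoc, ← mul_assoc]
  refine mul_le_mul_of_nonneg_right ?_ (Real.exp_pos _).le
  rcases min_cases 1 y with ⟨h, -⟩ | ⟨h, -⟩ <;> rw [h]
  · rw [mul_one]
    refine le_trans ?_ (le_max_right _ _)
    have h2 := Real.add_one_le_exp ((b - a) * y)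
    rw [Real.exp_neg, ← div_eq_mul_inv, div_le_div_iff₀ (Real.exp_pos _) hba]
    nlinarith
  · have h1 : Real.exp (-((b - a) * y)) ≤ 1 := Real.exp_le_one_iff.2 (by nlinarith)
    calc y * Real.exp (-((b - a) * y)) ≤ y * 1 := by gcongr
      _ = 1 * y := by ring
      _ ≤ _ := by gcongr; exact le_max_left _ _

/-- The inequality `(ay)²/2 ≤ e^{ay} - 1`, multiplied by `e^{-ay}`. -/
lemma sq_mul_exp_le {a y : ℝ} (ha : 0 < a) (hy : 0 < y) :
    y ^ 2 * Real.exp (-a * y) ≤ 2 / a ^ 2 * (1 - Real.exp (-a * y)) := by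
  have h := Real.quadratic_le_exp_of_nonneg (mul_pos ha hy).le
  have h1 : Real.exp (a * y) * Real.exp (-a * y) = 1 := by
    rw [← Real.exp_add]; simp
  have h2 := Real.exp_pos (-a * y)
  rw [div_mul_eq_mul_div, le_div_iff₀ (by positivity)]
  have h3 : (a * y) ^ 2 / 2 * Real.exp (-a * y) ≤ (Real.exp (a * y) - 1) * Real.exp (-a * y) :=
    mul_le_mul_of_nonneg_right (by nlinarith [mul_pos ha hy]) h2.le
  nlinarith

namespace BernsteinTriplet

variable (T : BernsteinTriplet)

/-- For `a ≤ 0`, this says that the integral defining `φ` converges absolutely on `Re z ≥ a`. -/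
def ConvergesAt (a : ℝ) : Prop :=
  IntegrableOn (fun y => min 1 y * Real.exp (-a * y)) (Ioi 0) T.μ

/-- The complex derivative of `φ`. -/
noncomputable def dphi (z : ℂ) : ℂ :=
  (T.s : ℂ) + ∫ y in Ioi (0 : ℝ), (y : ℂ) * Complex.exp (-z * (y : ℂ)) ∂T.μ

/-- The derivative of `φ` on the real line. -/
noncomputable def dphiReal (u : ℝ) : ℝ :=
  T.s + ∫ y in Ioi (0 : ℝ), y * Real.exp (-u * y) ∂T.μ

lemma dphi_ofReal (u : ℝ) : T.dphi u = T.dphiReal u := by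
  rw [dphi, dphiReal]
  push_cast
  rw [← integral_complex_ofReal]
  simp

lemma ae_Ioi {p : ℝ → Prop} (h : ∀ y, 0 < y → p y) : ∀ᵐ y ∂(T.μ.restrict (Ioi 0)), p y :=
  (ae_restrict_iff' measurableSet_Ioi).2 (ae_of_all _ h)

lemma convergesAt_zero : T.ConvergesAt 0 := by
  refine ⟨by fun_prop, ?_⟩
  rw [hasFiniteIntegral_iff_ofReal (T.ae_Ioi fun y hy => by positivity)]
  simp only [neg_zero, zero_mul, Real.exp_zero, mul_one]
  exact (setLIntegral_le_lintegral _ _).trans_lt T.μ_fin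

variable {T}

lemma ConvergesAt.mono {a b : ℝ} (h : T.ConvergesAt a) (hab : a ≤ b) : T.ConvergesAt b := by
  refine Integrable.mono' h (by fun_prop) (T.ae_Ioi fun y hy => ?_)
  rw [Real.norm_eq_abs, abs_of_nonneg (by positivity)]
  gcongr

lemma convergesAt_of_not_isNegInfinite {u : ℝ} (hu : u ≤ 0) (h : ¬ T.IsNegInfinite u) :
    T.ConvergesAt u := by
  have h1 : IntegrableOn (fun y => Real.exp (-u * y) - 1) (Ioi 0) T.μ := by
    refine ⟨by fun_prop, ?_⟩
    rw [hasFiniteIntegral_iff_ofReal (T.ae_Ioi fun y hy => by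
      have := Real.one_le_exp (show 0 ≤ -u * y by nlinarith)
      simpa using this)]
    exact lt_top_iff_ne_top.2 h
  have h0 := T.convergesAt_zero
  refine Integrable.mono' (h1.add h0) (by fun_prop) (T.ae_Ioi fun y hy => ?_)
  have h2 := Real.one_le_exp (show 0 ≤ -u * y by nlinarith)
  rw [Real.norm_eq_abs, abs_of_nonneg (by positivity)]
  simp only [Pi.add_apply, neg_zero, zero_mul, Real.exp_zero, mul_one]
  have h3 : min 1 y ≤ 1 := min_le_left _ _
  nlinarith [Real.exp_pos (-u * y)]

lemma integrable_one_sub_exp {a : ℝ} (ha : a ≤ 0) (hT : T.ConvergesAt a) {z : ℂ}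
    (hz : a ≤ z.re) : IntegrableOn (fun y : ℝ => 1 - Complex.exp (-z * y)) (Ioi 0) T.μ :=
  Integrable.mono' (hT.const_mul (max 2 ‖z‖)) (by fun_prop)
    (T.ae_Ioi fun _ hy => norm_one_sub_exp_le ha hz hy)

lemma integrable_one_sub_exp_real {a u : ℝ} (ha : a ≤ 0) (hT : T.ConvergesAt a) (hu : a ≤ u) :
    IntegrableOn (fun y : ℝ => 1 - Real.exp (-u * y)) (Ioi 0) T.μ := by
  have := (integrable_one_sub_exp ha hT (z := (u : ℂ)) (by simpa using hu)).re
  refine this.congr (ae_of_all _ fun y => ?_)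
  simp [← Complex.ofReal_mul, ← Complex.ofReal_neg, Complex.exp_ofReal_re]

lemma norm_mul_exp_le {a b y : ℝ} {z : ℂ} (hab : a < b) (hz : b ≤ z.re) (hy : 0 < y) :
    ‖(y : ℂ) * Complex.exp (-z * y)‖ ≤
      max 1 (1 / (b - a)) * (min 1 y * Real.exp (-a * y)) := by
  refine le_trans ?_ (mul_exp_le_min hab hy)
  rw [norm_mul, Complex.norm_real, Real.norm_eq_abs, abs_of_pos hy, Complex.norm_exp]
  gcongr
  simp only [neg_mul, Complex.neg_re, Complex.re_mul_ofReal]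
  nlinarith

lemma integrable_mul_exp {a : ℝ} (hT : T.ConvergesAt a) {z : ℂ}
    (hz : a < z.re) : IntegrableOn (fun y : ℝ => (y : ℂ) * Complex.exp (-z * y)) (Ioi 0) T.μ :=
  Integrable.mono' (hT.const_mul (max 1 (1 / (z.re - a)))) (by fun_prop)
    (T.ae_Ioi fun _ hy => norm_mul_exp_le hz le_rfl hy)

lemma integrable_mul_exp_real {a u : ℝ} (hT : T.ConvergesAt a) (hu : a < u) :
    IntegrableOn (fun y : ℝ => y * Real.exp (-u * y)) (Ioi 0) T.μ := by
  have := (integrable_mul_exp hT (z := (u : ℂ)) (by simpa using hu)).re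
  refine this.congr (ae_of_all _ fun y => ?_)
  simp [← Complex.ofReal_mul, ← Complex.ofReal_neg, ← Complex.ofReal_exp]

lemma hasDerivAt_phi {a : ℝ} (ha : a ≤ 0) (hT : T.ConvergesAt a) {z : ℂ} (hz : a < z.re) :
    HasDerivAt T.phi (T.dphi z) z := by
  set b : ℝ := (a + z.re) / 2 with hb
  have hab : a < b := by linarith
  have hbz : b < z.re := by linarith
  have hnhds : {w : ℂ | b < w.re} ∈ 𝓝 z :=
    (isOpen_lt continuous_const Complex.continuous_re).mem_nhds hbz
  have hint := (hasDerivAt_integral_of_dominated_loc_of_deriv_le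
    (μ := T.μ.restrict (Ioi 0)) (F := fun (w : ℂ) (y : ℝ) => 1 - Complex.exp (-w * y))
    (F' := fun (w : ℂ) (y : ℝ) => (y : ℂ) * Complex.exp (-w * y)) (x₀ := z)
    (bound := fun y => max 1 (1 / (b - a)) * (min 1 y * Real.exp (-a * y)))
    hnhds (Eventually.of_forall fun w => by fun_prop)
    (integrable_one_sub_exp ha hT hz.le) (by fun_prop)
    (T.ae_Ioi fun y hy w hw => norm_mul_exp_le hab (le_of_lt hw) hy)
    (hT.const_mul _) (ae_of_all _ fun y w _ => ?_)).2
  · have hlin : HasDerivAt (fun w : ℂ => (T.m : ℂ) + (T.s : ℂ) * w) (T.s : ℂ) z := by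
      simpa using ((hasDerivAt_id z).const_mul (T.s : ℂ)).const_add (T.m : ℂ)
    exact hlin.add hint
  · have h1 : HasDerivAt (fun w : ℂ => -w * (y : ℂ)) (-(y : ℂ)) w := by
      simpa using (hasDerivAt_id w).neg.mul_const (y : ℂ)
    have h2 := h1.cexp.const_sub 1
    convert h2 using 1
    ring

lemma hasDerivAt_phiReal {a u : ℝ} (ha : a ≤ 0) (hT : T.ConvergesAt a) (hu : a < u) :
    HasDerivAt T.phiReal (T.dphiReal u) u := by
  have h := (hasDerivAt_phi ha hT (z := (u : ℂ)) (by simpa using hu)).real_of_complex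
  rw [dphi_ofReal, Complex.ofReal_re] at h
  refine h.congr_of_eventuallyEq (Eventually.of_forall fun x => ?_)
  simp [phi_ofReal]

/-- `φ` is continuous on the closed half-plane. -/
lemma continuousOn_phi (T : BernsteinTriplet) : ContinuousOn T.phi closedHalfPlane := by
  refine ContinuousOn.add (by fun_prop) ?_
  intro z hz
  have hnhds : ∀ᶠ w in 𝓝[closedHalfPlane] z, ‖w‖ < ‖z‖ + 1 :=
    nhdsWithin_le_nhds ((isOpen_lt continuous_norm continuous_const).mem_nhds (lt_add_one ‖z‖))
  refine continuousWithinAt_of_dominated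
    (bound := fun y => max 2 (‖z‖ + 1) * (min 1 y * Real.exp (-0 * y)))
    (Eventually.of_forall fun w => by fun_prop) ?_ (T.convergesAt_zero.const_mul _)
    (ae_of_all _ fun y => by fun_prop)
  filter_upwards [hnhds, self_mem_nhdsWithin] with w hw hw0
  refine T.ae_Ioi fun y hy => (norm_one_sub_exp_le le_rfl hw0 hy).trans ?_
  gcongr

lemma phiReal_le_re_phi {a : ℝ} (ha : a ≤ 0) (hT : T.ConvergesAt a) {z : ℂ} (hz : a ≤ z.re) :
    T.phiReal z.re ≤ (T.phi z).re := by
  rw [phiReal, phi]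
  simp only [Complex.add_re, Complex.re_ofReal_mul, Complex.ofReal_re]
  gcongr
  have h1 := integrable_one_sub_exp ha hT hz
  have e : (∫ y in Ioi (0 : ℝ), (1 - Complex.exp (-z * y)) ∂T.μ).re =
      ∫ y in Ioi (0 : ℝ), (1 - Complex.exp (-z * y)).re ∂T.μ := (integral_re h1).symm
  rw [e]
  refine integral_mono (integrable_one_sub_exp_real ha hT hz) h1.re fun y => ?_
  simp only [Complex.sub_re, Complex.one_re]
  gcongr
  refine (Complex.re_le_norm _).trans ?_
  rw [Complex.norm_exp]
  simp

lemma phiReal_mono {a u v : ℝ} (ha : a ≤ 0) (hT : T.ConvergesAt a) (hu : a ≤ u) (huv : u ≤ v) :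
    T.phiReal u ≤ T.phiReal v := by
  rw [phiReal, phiReal]
  have := T.s_nonneg
  have h : ∫ y in Ioi (0 : ℝ), (1 - Real.exp (-u * y)) ∂T.μ ≤
      ∫ y in Ioi (0 : ℝ), (1 - Real.exp (-v * y)) ∂T.μ := by
    refine integral_mono_ae (integrable_one_sub_exp_real ha hT hu)
      (integrable_one_sub_exp_real ha hT (hu.trans huv)) (T.ae_Ioi fun y hy => ?_)
    simp only
    gcongr
  nlinarith [mul_le_mul_of_nonneg_left huv this]

lemma phiReal_zero (T : BernsteinTriplet) : T.phiReal 0 = T.m := by simp [phiReal]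

lemma dphiReal_nonneg (T : BernsteinTriplet) (u : ℝ) : 0 ≤ T.dphiReal u :=
  add_nonneg T.s_nonneg (integral_nonneg_of_ae (T.ae_Ioi fun y hy => by
    simp only [Pi.zero_apply]; positivity))

lemma dphiReal_antitone {u v : ℝ} (hu : 0 < u) (huv : u ≤ v) : T.dphiReal v ≤ T.dphiReal u := by
  rw [dphiReal, dphiReal]
  refine add_le_add_right ?_ _
  refine integral_mono_ae (integrable_mul_exp_real T.convergesAt_zero (hu.trans_le huv))
    (integrable_mul_exp_real T.convergesAt_zero hu) (T.ae_Ioi fun y hy => ?_)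
  simp only
  gcongr

/-- `u φ'(u) ≤ φ(u)`, by concavity. -/
lemma mul_dphiReal_le {u : ℝ} (hu : 0 < u) : u * T.dphiReal u ≤ T.phiReal u := by
  rw [phiReal, dphiReal, mul_add, ← integral_const_mul]
  have := T.m_nonneg
  have h : ∫ y in Ioi (0 : ℝ), u * (y * Real.exp (-u * y)) ∂T.μ ≤
      ∫ y in Ioi (0 : ℝ), (1 - Real.exp (-u * y)) ∂T.μ := by
    refine integral_mono_ae ((integrable_mul_exp_real T.convergesAt_zero hu).const_mul u)
      (integrable_one_sub_exp_real le_rfl T.convergesAt_zero hu.le) (T.ae_Ioi fun y hy => ?_)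
    simp only
    have h1 : Real.exp (u * y) * Real.exp (-u * y) = 1 := by rw [← Real.exp_add]; simp
    have h2 := mul_le_mul_of_nonneg_right (Real.add_one_le_exp (u * y)) (Real.exp_pos (-u * y)).le
    nlinarith
  nlinarith

/-- `φ(k u) ≤ k φ(u)`, by concavity. -/
lemma phiReal_natCast_mul_le (T : BernsteinTriplet) (k : ℕ) (hk : 1 ≤ k) {u : ℝ} (hu : 0 ≤ u) :
    T.phiReal (k * u) ≤ k * T.phiReal u := by
  have hk' : (1 : ℝ) ≤ k := by exact_mod_cast hk
  rw [phiReal, phiReal, mul_add, ← integral_const_mul]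
  have := T.m_nonneg
  have h : ∫ y in Ioi (0 : ℝ), (1 - Real.exp (-(k * u) * y)) ∂T.μ ≤
      ∫ y in Ioi (0 : ℝ), k * (1 - Real.exp (-u * y)) ∂T.μ := by
    refine integral_mono_ae
      (integrable_one_sub_exp_real le_rfl T.convergesAt_zero (by positivity))
      ((integrable_one_sub_exp_real le_rfl T.convergesAt_zero hu).const_mul _)
      (T.ae_Ioi fun y hy => ?_)
    simp only
    have h1 := one_add_mul_le_pow (a := Real.exp (-u * y) - 1)
      (by linarith [Real.exp_pos (-u * y)]) k
    rw [add_sub_cancel, ← Real.exp_nat_mul] at h1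
    have e : (k : ℝ) * (-u * y) = -(k * u) * y := by ring
    rw [e] at h1
    linarith
  nlinarith

/-- Second order Taylor bound for `φ` at a positive real point. -/
lemma norm_phi_sub_le {a u : ℝ} (ha : 0 < a) (hau : a ≤ u) {z : ℂ} (hz : a ≤ u + z.re) :
    ‖T.phi (u + z) - T.phi u - z * T.dphi u‖ ≤ ‖z‖ ^ 2 * (2 / a ^ 2 * T.phiReal a) := by
  have h0 := T.convergesAt_zero
  have hu : 0 < u := ha.trans_le hau
  have i1 := integrable_one_sub_exp le_rfl h0 (z := (u : ℂ) + z) (by simp; linarith)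
  have i2 := integrable_one_sub_exp le_rfl h0 (z := (u : ℂ)) (by simpa using hu.le)
  have i3 := (integrable_mul_exp h0 (z := (u : ℂ)) (by simpa using hu)).const_mul z
  have i4 := integrable_one_sub_exp_real le_rfl h0 ha.le
  have e : T.phi (u + z) - T.phi u - z * T.dphi u = ∫ y in Ioi (0 : ℝ),
      (1 - Complex.exp (-(u + z) * y) - (1 - Complex.exp (-u * y)) -
        z * (y * Complex.exp (-u * y))) ∂T.μ := by
    have e3 := integral_sub (i1.sub i2) i3
    simp only [Pi.sub_apply] at e3
    rw [e3, integral_sub i1 i2, integral_const_mul, phi, phi, dphi]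
    ring
  rw [e]
  have hle : ‖z‖ ^ 2 * (2 / a ^ 2 * ∫ y in Ioi (0 : ℝ), (1 - Real.exp (-a * y)) ∂T.μ) ≤
      ‖z‖ ^ 2 * (2 / a ^ 2 * T.phiReal a) := by
    rw [phiReal]
    have := T.m_nonneg
    have := mul_nonneg T.s_nonneg ha.le
    gcongr
    linarith
  refine le_trans ?_ hle
  rw [← integral_const_mul, ← integral_const_mul]
  refine norm_integral_le_of_norm_le ((i4.const_mul _).const_mul _) (T.ae_Ioi fun y hy => ?_)
  have e2 : 1 - Complex.exp (-(u + z) * y) - (1 - Complex.exp (-u * y)) -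
      z * (y * Complex.exp (-u * y)) =
      -(Complex.exp (-u * y) * (Complex.exp (-z * y) - 1 - (-z * y))) := by
    rw [show -((u : ℂ) + z) * y = -u * y + -z * y by ring, Complex.exp_add]
    ring
  rw [e2, norm_neg, norm_mul]
  have h1 := norm_exp_sub_one_sub_le_max (-z * y)
  have h2 : ‖Complex.exp (-(u : ℂ) * y)‖ = Real.exp (-u * y) := by
    rw [Complex.norm_exp]; simp
  rw [h2]
  rw [norm_mul, norm_neg, Complex.norm_real, Real.norm_eq_abs, abs_of_pos hy] at h1
  have h3 : Real.exp (-u * y) * max 1 (Real.exp (-z * (y : ℂ)).re) ≤ Real.exp (-a * y) := by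
    rw [mul_max_of_nonneg _ _ (Real.exp_pos _).le, mul_one, ← Real.exp_add]
    refine max_le (Real.exp_le_exp.2 (by nlinarith)) (Real.exp_le_exp.2 ?_)
    simp only [neg_mul, Complex.neg_re, Complex.re_mul_ofReal]
    nlinarith
  calc Real.exp (-u * y) * ‖Complex.exp (-z * y) - 1 - (-z * y)‖
      ≤ Real.exp (-u * y) * ((‖z‖ * y) ^ 2 * max 1 (Real.exp (-z * (y : ℂ)).re)) := by gcongr
    _ = ‖z‖ ^ 2 * (y ^ 2 * (Real.exp (-u * y) * max 1 (Real.exp (-z * (y : ℂ)).re))) := by ring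
    _ ≤ ‖z‖ ^ 2 * (y ^ 2 * Real.exp (-a * y)) := by gcongr
    _ ≤ ‖z‖ ^ 2 * (2 / a ^ 2 * (1 - Real.exp (-a * y))) := by
        exact mul_le_mul_of_nonneg_left (sq_mul_exp_le ha hy) (by positivity)

end BernsteinTriplet

namespace BernsteinTriplet

/-! ### Half-planes free of zeros of `φ` -/

variable {T : BernsteinTriplet} {φ : ℝ → ℝ}

lemma Represents.eq (hT : T.Represents φ) {u : ℝ} (hu : 0 < u) : φ u = T.phiReal u := by
  have := hT u hu
  rw [phi_ofReal] at this
  exact_mod_cast this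

lemma Represents.deriv_eq (hT : T.Represents φ) {u : ℝ} (hu : 0 < u) :
    deriv φ u = T.dphiReal u := by
  refine ((hasDerivAt_phiReal le_rfl T.convergesAt_zero hu).congr_of_eventuallyEq ?_).deriv
  filter_upwards [Ioi_mem_nhds hu] with v hv using hT.eq hv

/-- A Bernstein function has no zero on `(0, ∞)`. -/
lemma Represents.pos (hT : T.Represents φ) (hφ : IsBernstein φ) {u : ℝ} (hu : 0 < u) :
    0 < T.phiReal u := by
  obtain ⟨v, hv, hne⟩ := hφ.2.1
  have hpos : 0 < T.phiReal v := by
    rw [← hT.eq hv]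
    exact lt_of_le_of_ne (hφ.2.2.1 v hv) (Ne.symm hne)
  obtain ⟨n, hn⟩ := exists_nat_ge (v / u)
  have h1 : v ≤ ((n + 1 : ℕ) : ℝ) * u := by
    rw [div_le_iff₀ hu] at hn
    push_cast
    nlinarith
  have h2 := T.phiReal_natCast_mul_le (n + 1) (by omega) hu.le
  have h3 := phiReal_mono le_rfl T.convergesAt_zero hv.le h1
  have h4 : (0 : ℝ) < ((n + 1 : ℕ) : ℝ) := by positivity
  exact pos_of_mul_pos_right (hpos.trans_le (h3.trans h2)) h4.le

/-- `c ≤ 0` bounds from the left a half-line on which `φ` is finite and positive. -/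
def IsGood (T : BernsteinTriplet) (c : ℝ) : Prop :=
  c ≤ 0 ∧ ∀ u, c < u → T.ConvergesAt u ∧ 0 < T.phiReal u

lemma isGood_zero (hpos : ∀ u, 0 < u → 0 < T.phiReal u) : T.IsGood 0 :=
  ⟨le_rfl, fun u hu => ⟨T.convergesAt_zero.mono hu.le, hpos u hu⟩⟩

/-- Below a point of the half-plane there is a base point at which the integral converges. -/
lemma IsGood.exists_base {c t : ℝ} (hc : T.IsGood c) (ht : c < t) :
    ∃ a ≤ 0, T.ConvergesAt a ∧ a < t := by
  rcases hc.1.lt_or_eq with h | h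
  · obtain ⟨a, h1, h2⟩ := exists_between (lt_min h ht)
    exact ⟨a, h2.le.trans (min_le_left _ _), (hc.2 a h1).1, h2.trans_le (min_le_right _ _)⟩
  · exact ⟨0, le_rfl, T.convergesAt_zero, h ▸ ht⟩

lemma IsGood.re_phi_pos {c : ℝ} (hc : T.IsGood c) {z : ℂ} (hz : c < z.re) : 0 < (T.phi z).re := by
  obtain ⟨a, ha, hTa, haz⟩ := hc.exists_base hz
  exact (hc.2 _ hz).2.trans_le (phiReal_le_re_phi ha hTa haz.le)

lemma IsGood.phi_ne_zero {c : ℝ} (hc : T.IsGood c) {z : ℂ} (hz : c < z.re) : T.phi z ≠ 0 := by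
  intro h
  have := hc.re_phi_pos hz
  simp [h] at this

/-- Every point of `Re z > d_φ` lies to the right of some good `c`: by definition of `d_φ`, `φ` is
finite and without zeros on `(c, 0]` for `d_φ < c`, hence positive by the intermediate value
theorem. -/
lemma exists_isGood (hpos : ∀ u, 0 < u → 0 < T.phiReal u) {z : ℂ} (hz : z ∈ T.openDomain) :
    ∃ c, T.IsGood c ∧ c < z.re := by
  rcases lt_or_ge 0 z.re with h | h
  · exact ⟨0, isGood_zero hpos, h⟩
  obtain ⟨c, h1, h2⟩ := EReal.lt_iff_exists_real_btwn.1 (show T.dPhi < (z.re : EReal) from hz)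
  have h2 : c < z.re := by exact_mod_cast h2
  have hc0 : c ≤ 0 := by linarith
  have key : ∀ u, c < u → u ≤ 0 → ¬ T.IsNegInfinite u ∧ T.phiReal u ≠ 0 := by
    intro u hu hu0
    by_contra hcon
    have hmem : (u : EReal) ≤ T.dPhi := by
      refine le_sSup ⟨u, hu0, ?_, rfl⟩
      by_cases hn : T.IsNegInfinite u
      · exact Or.inl hn
      · refine Or.inr ?_
        rw [phi_ofReal]
        have : T.phiReal u = 0 := by tauto
        rw [this, Complex.ofReal_zero]
    have : (u : EReal) < (c : EReal) := hmem.trans_lt h1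
    have : u < c := by exact_mod_cast this
    linarith
  have hconv : ∀ u, c < u → T.ConvergesAt u := by
    intro u hu
    rcases lt_or_ge 0 u with h0 | h0
    · exact T.convergesAt_zero.mono h0.le
    · exact convergesAt_of_not_isNegInfinite h0 (key u hu h0).1
  refine ⟨c, ⟨hc0, fun u hu => ⟨hconv u hu, ?_⟩⟩, h2⟩
  rcases lt_or_ge 0 u with h0 | h0
  · exact hpos u h0
  by_contra hneg
  push Not at hneg
  have hcont : ContinuousOn T.phiReal (Icc u 1) := by
    intro v hv
    obtain ⟨a, ha1, ha2⟩ := exists_between hu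
    exact (hasDerivAt_phiReal (by linarith) (hconv a ha1)
      (ha2.trans_le hv.1)).continuousAt.continuousWithinAt
  obtain ⟨v, hv, hv0⟩ := intermediate_value_Icc (by linarith) hcont
    ⟨hneg, (hpos 1 one_pos).le⟩
  rcases lt_or_ge 0 v with h0' | h0'
  · exact (hpos v h0').ne' hv0
  · exact (key v (hu.trans_le hv.1) h0').2 hv0

lemma isOpen_openDomain (T : BernsteinTriplet) : IsOpen T.openDomain :=
  isOpen_lt continuous_const (continuous_coe_real_ereal.comp Complex.continuous_re)

lemma dPhi_le_zero (T : BernsteinTriplet) : T.dPhi ≤ 0 := by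
  refine sSup_le ?_
  rintro _ ⟨u, hu, -, rfl⟩
  exact_mod_cast hu

lemma mem_openDomain_of_pos (T : BernsteinTriplet) {z : ℂ} (hz : 0 < z.re) : z ∈ T.openDomain :=
  T.dPhi_le_zero.trans_lt (by exact_mod_cast hz)

/-- If `φ(0) > 0`, then `φ` has no zero on the closed half-plane, since `Re φ(z) ≥ φ(Re z)`. -/
lemma re_phi_pos_of_m_pos (hm : 0 < T.m) {z : ℂ} (hz : 0 ≤ z.re) : 0 < (T.phi z).re := by
  refine lt_of_lt_of_le ?_ (phiReal_le_re_phi le_rfl T.convergesAt_zero hz)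
  exact (T.phiReal_zero ▸ hm).trans_le (phiReal_mono le_rfl T.convergesAt_zero le_rfl hz)

lemma IsDomain.phi_ne_zero {S : Set ℂ} (hS : T.IsDomain S)
    (hpos : ∀ u, 0 < u → 0 < T.phiReal u) {z : ℂ} (hz : z ∈ S) : T.phi z ≠ 0 := by
  rcases hS with rfl | ⟨hm, -, rfl⟩
  · obtain ⟨c, hc, hcz⟩ := exists_isGood hpos hz
    exact hc.phi_ne_zero hcz
  · intro h
    have := re_phi_pos_of_m_pos hm hz
    simp [h] at this

lemma IsDomain.add_mem {S : Set ℂ} (hS : T.IsDomain S) {z : ℂ} (hz : z ∈ S) {x : ℝ}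
    (hx : 0 ≤ x) : z + x ∈ S := by
  rcases hS with rfl | ⟨-, -, rfl⟩
  · refine lt_of_lt_of_le (show T.dPhi < (z.re : EReal) from hz) ?_
    have h : z.re ≤ (z + x).re := by simpa using hx
    exact_mod_cast h
  · have : 0 ≤ z.re := hz
    change 0 ≤ (z + x).re
    simp
    linarith

lemma IsDomain.mem_of_pos {S : Set ℂ} (hS : T.IsDomain S) {z : ℂ} (hz : 0 < z.re) : z ∈ S := by
  rcases hS with rfl | ⟨-, -, rfl⟩
  · exact T.mem_openDomain_of_pos hz
  · exact hz.le

/-! ### The generalized Euler constant -/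

lemma dphiReal_le_sub {u : ℝ} (hu : 0 < u) : T.dphiReal (u + 1) ≤ T.phiReal (u + 1) - T.phiReal u ∧
    T.phiReal (u + 1) - T.phiReal u ≤ T.dphiReal u := by
  obtain ⟨v, hv, h⟩ := exists_hasDerivAt_eq_slope T.phiReal T.dphiReal (lt_add_one u)
    (fun x hx => (hasDerivAt_phiReal le_rfl T.convergesAt_zero
      (hu.trans_le hx.1)).continuousAt.continuousWithinAt)
    (fun x hx => hasDerivAt_phiReal le_rfl T.convergesAt_zero (hu.trans hx.1))
  rw [add_sub_cancel_left, div_one] at h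
  rw [← h]
  exact ⟨dphiReal_antitone (hu.trans hv.1) hv.2.le, dphiReal_antitone hu hv.1.le⟩

/-- The increments of `log φ` lie between the values of `φ'/φ` at the two ends. -/
lemma log_phiReal_sub (hpos : ∀ u, 0 < u → 0 < T.phiReal u) {u : ℝ} (hu : 0 < u) :
    T.dphiReal (u + 1) / T.phiReal (u + 1) ≤
      Real.log (T.phiReal (u + 1)) - Real.log (T.phiReal u) ∧
    Real.log (T.phiReal (u + 1)) - Real.log (T.phiReal u) ≤ T.dphiReal u / T.phiReal u := by
  have h1 := hpos u hu
  have h2 := hpos (u + 1) (by linarith)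
  obtain ⟨h3, h4⟩ := dphiReal_le_sub (T := T) hu
  rw [← Real.log_div h2.ne' h1.ne']
  constructor
  · refine le_trans ?_ (Real.one_sub_inv_le_log_of_pos (div_pos h2 h1))
    rw [inv_div, one_sub_div h2.ne']
    gcongr
  · refine (Real.log_le_sub_one_of_pos (div_pos h2 h1)).trans ?_
    rw [div_sub_one h1.ne']
    gcongr

lemma Represents.eulerSeq_succ (hT : T.Represents φ) (n : ℕ) :
    eulerSeq φ (n + 1) = (∑ k ∈ Finset.range (n + 1), T.dphiReal (k + 1) / T.phiReal (k + 1)) -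
      Real.log (T.phiReal (n + 1)) := by
  rw [eulerSeq, ← Finset.Ico_add_one_right_eq_Icc, Finset.sum_Ico_eq_sum_range]
  have h : ∀ k : ℕ, (0 : ℝ) < (k : ℝ) + 1 := fun k => by positivity
  congr 1
  · refine Finset.sum_congr (by simp) fun k _ => ?_
    push_cast
    rw [add_comm, hT.eq (h k), hT.deriv_eq (h k)]
  · push_cast
    rw [hT.eq (h n)]

/-- The generalized Euler constant exists: `eulerSeq φ` is non-increasing from the index `1` on and
bounded below by `-log φ(1)`. The bounds of the limit are this bound and the first term. -/
theorem Represents.tendsto_eulerSeq (hT : T.Represents φ) (hφ : IsBernstein φ) :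
    Tendsto (eulerSeq φ) atTop (𝓝 (eulerGamma φ)) ∧ 0 ≤ eulerGamma φ + Real.log (φ 1) ∧
      eulerGamma φ + Real.log (φ 1) ≤ deriv φ 1 / φ 1 := by
  have hpos := fun u hu => hT.pos hφ (u := u) hu
  have h0 : ∀ k : ℕ, (0 : ℝ) < (k : ℝ) + 1 := fun k => by positivity
  have hanti : Antitone fun n => eulerSeq φ (n + 1) := by
    refine antitone_nat_of_succ_le fun n => ?_
    rw [hT.eulerSeq_succ, hT.eulerSeq_succ, Finset.sum_range_succ]
    have := (log_phiReal_sub hpos (h0 n)).1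
    push_cast
    linarith
  have hlow : ∀ n : ℕ, T.dphiReal (n + 1) / T.phiReal (n + 1) - Real.log (T.phiReal 1) ≤
      eulerSeq φ (n + 1) := by
    intro n
    induction n with
    | zero => rw [hT.eulerSeq_succ]; simp
    | succ n ih =>
      rw [hT.eulerSeq_succ] at ih ⊢
      rw [Finset.sum_range_succ]
      have := (log_phiReal_sub hpos (h0 n)).2
      push_cast
      linarith
  have hlow' : ∀ n, -Real.log (T.phiReal 1) ≤ eulerSeq φ (n + 1) := fun n => by
    have := div_nonneg (T.dphiReal_nonneg (n + 1)) (hpos _ (h0 n)).le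
    linarith [hlow n]
  have hlim := tendsto_atTop_ciInf hanti ⟨_, by rintro _ ⟨n, rfl⟩; exact hlow' n⟩
  rw [tendsto_add_atTop_iff_nat (f := eulerSeq φ) 1] at hlim
  have hγ : Tendsto (eulerSeq φ) atTop (𝓝 (eulerGamma φ)) := by
    rw [eulerGamma, hlim.limUnder_eq]
    exact hlim
  have hγ1 := (tendsto_add_atTop_iff_nat (f := eulerSeq φ) 1).2 hγ
  refine ⟨hγ, ?_, ?_⟩
  · have := ge_of_tendsto' hγ1 hlow'
    rw [hT.eq one_pos]
    linarith
  · have := le_of_tendsto' hγ1 fun n => hanti (Nat.zero_le n)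
    have h1 := hT.eulerSeq_succ 0
    simp only [zero_add, Finset.range_one, Finset.sum_singleton, Nat.cast_zero] at h1 this
    rw [hT.eq one_pos, hT.deriv_eq one_pos]
    linarith

/-! ### Convergence of the Weierstrass product -/

/-- `φ(k + z)/φ(k) = 1 + z φ'(k)/φ(k) + O(k⁻²)`. -/
lemma norm_phi_div_sub_le (hpos : ∀ u, 0 < u → 0 < T.phiReal u) {k : ℝ} {z : ℂ} (hk : 0 < k)
    (hz : 2 * ‖z‖ ≤ k) :
    ‖T.phi (k + z) / T.phiReal k - 1 - z * (T.dphiReal k / T.phiReal k : ℝ)‖ ≤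
      8 * ‖z‖ ^ 2 / k ^ 2 := by
  have hp := hpos k hk
  have hre : -‖z‖ ≤ z.re := by
    have := Complex.abs_re_le_norm z
    exact (abs_le.1 this).1
  have h := norm_phi_sub_le (T := T) (a := k / 2) (u := k) (by linarith) (by linarith) (z := z)
    (by linarith)
  have hmono := phiReal_mono (T := T) le_rfl T.convergesAt_zero (u := k / 2) (v := k)
    (by linarith) (by linarith)
  have hp' : (T.phiReal k : ℂ) ≠ 0 := by exact_mod_cast hp.ne'
  have e : T.phi (k + z) / T.phiReal k - 1 - z * (T.dphiReal k / T.phiReal k : ℝ) =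
      (T.phi (k + z) - T.phi k - z * T.dphi k) / T.phiReal k := by
    rw [phi_ofReal, dphi_ofReal]
    push_cast
    field_simp
  rw [e, norm_div, Complex.norm_real, Real.norm_eq_abs, abs_of_pos hp, div_le_iff₀ hp]
  refine h.trans ?_
  have e2 : 8 * ‖z‖ ^ 2 / k ^ 2 * T.phiReal k = ‖z‖ ^ 2 * (2 / (k / 2) ^ 2 * T.phiReal k) := by
    field_simp
    ring
  rw [e2]
  exact mul_le_mul_of_nonneg_left (mul_le_mul_of_nonneg_left hmono (by positivity)) (by positivity)

lemma dphiReal_div_le (hpos : ∀ u, 0 < u → 0 < T.phiReal u) {k : ℝ} (hk : 0 < k) :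
    T.dphiReal k / T.phiReal k ≤ 1 / k := by
  rw [div_le_div_iff₀ (hpos k hk) hk]
  linarith [mul_dphiReal_le (T := T) hk]

lemma norm_mul_dphiReal_div_le (hpos : ∀ u, 0 < u → 0 < T.phiReal u) {k : ℝ} (hk : 0 < k)
    (z : ℂ) : ‖z * (T.dphiReal k / T.phiReal k : ℝ)‖ ≤ ‖z‖ / k := by
  rw [norm_mul, Complex.norm_real, Real.norm_eq_abs,
    abs_of_nonneg (div_nonneg (T.dphiReal_nonneg k) (hpos k hk).le), div_eq_mul_one_div ‖z‖]
  exact mul_le_mul_of_nonneg_left (dphiReal_div_le hpos hk) (norm_nonneg z)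

lemma norm_phi_div_sub_one_le (hpos : ∀ u, 0 < u → 0 < T.phiReal u) {k : ℝ} {z : ℂ} (hk : 0 < k)
    (hz : 2 * ‖z‖ ≤ k) :
    ‖T.phi (k + z) / T.phiReal k - 1‖ ≤ ‖z‖ / k + 8 * ‖z‖ ^ 2 / k ^ 2 := by
  have h1 := norm_phi_div_sub_le hpos hk hz
  have h2 := norm_mul_dphiReal_div_le hpos hk z
  calc ‖T.phi (k + z) / T.phiReal k - 1‖ =
      ‖z * (T.dphiReal k / T.phiReal k : ℝ) + (T.phi (k + z) / T.phiReal k - 1 -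
        z * (T.dphiReal k / T.phiReal k : ℝ))‖ := by congr 1; ring
    _ ≤ _ := (norm_add_le _ _).trans (add_le_add h2 h1)

/-- The factors of the Weierstrass product are `1 + O(k⁻²)`. -/
lemma norm_weierstrassFactor_sub_one_le (hT : T.Represents φ)
    (hpos : ∀ u, 0 < u → 0 < T.phiReal u) {k : ℕ} {z : ℂ} (hk : 1 ≤ k) (hz : 16 * ‖z‖ ≤ k) :
    ‖weierstrassFactor φ T.phi z k - 1‖ ≤ 18 * ‖z‖ ^ 2 * (1 / (k : ℝ) ^ 2) := by
  have hk0 : (0 : ℝ) < k := by exact_mod_cast hk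
  have hz0 := norm_nonneg z
  have h1 := norm_phi_div_sub_le hpos hk0 (z := z) (by linarith)
  have h2 := norm_mul_dphiReal_div_le hpos hk0 z
  have h3 := norm_phi_div_sub_one_le hpos hk0 (z := z) (by linarith)
  have hp := hpos k hk0
  rw [weierstrassFactor, hT.eq hk0, hT.deriv_eq hk0]
  simp only [Complex.ofReal_natCast] at h1 h3
  set η : ℝ := T.dphiReal k / T.phiReal k
  set A : ℂ := T.phi (k + z) / T.phiReal k with hA
  have hzk : ‖z‖ / k ≤ 1 / 16 := by rw [div_le_iff₀ hk0]; linarith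
  have h4 := Complex.norm_exp_sub_one_sub_id_le (x := z * η) (h2.trans (by linarith))
  have hA1 : ‖A - 1‖ ≤ 1 / 2 := by
    refine h3.trans ?_
    have : 8 * ‖z‖ ^ 2 / (k : ℝ) ^ 2 = 8 * (‖z‖ / k) ^ 2 := by field_simp
    rw [this]
    have : 0 ≤ ‖z‖ / k := by positivity
    nlinarith
  have hA2 : 1 / 2 ≤ ‖A‖ := by
    have := norm_sub_norm_le (1 : ℂ) (1 - A)
    rw [sub_sub_cancel, norm_one, norm_sub_rev] at this
    linarith
  have hA0 : A ≠ 0 := by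
    intro h
    rw [h, norm_zero] at hA2
    linarith
  have e : (T.phiReal k : ℂ) / T.phi (k + z) * Complex.exp (η * z) - 1 =
      (Complex.exp (z * η) - A) / A := by
    rw [sub_div, div_self hA0, mul_comm (η : ℂ) z, hA, div_div_eq_mul_div]
    ring
  rw [e, norm_div, div_le_iff₀ (by linarith)]
  have h5 : ‖Complex.exp (z * η) - A‖ ≤ 9 * ‖z‖ ^ 2 * (1 / (k : ℝ) ^ 2) := by
    calc ‖Complex.exp (z * η) - A‖ = ‖(Complex.exp (z * η) - 1 - z * η) - (A - 1 - z * η)‖ := by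
          congr 1; ring
      _ ≤ ‖z * η‖ ^ 2 + 8 * ‖z‖ ^ 2 / (k : ℝ) ^ 2 := (norm_sub_le _ _).trans (add_le_add h4 h1)
      _ ≤ (‖z‖ / k) ^ 2 + 8 * ‖z‖ ^ 2 / (k : ℝ) ^ 2 := by gcongr
      _ = _ := by field_simp; ring
  refine h5.trans ?_
  have : 0 ≤ 9 * ‖z‖ ^ 2 * (1 / (k : ℝ) ^ 2) := by positivity
  nlinarith

/-- The Weierstrass product converges absolutely wherever no denominator vanishes. -/
theorem weierstrassConverges_of_ne_zero (hT : T.Represents φ)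
    (hpos : ∀ u, 0 < u → 0 < T.phiReal u) {z : ℂ} (hz : ∀ k : ℕ, T.phi (k + z) ≠ 0) :
    WeierstrassConverges φ T.phi z := by
  refine ⟨by simpa using hz 0, fun k hk => ⟨?_, hz k⟩, ?_⟩
  · have hk0 : (0 : ℝ) < k := by exact_mod_cast hk
    rw [hT.eq hk0]
    exact (hpos k hk0).ne'
  · have hs : Summable fun k : ℕ => 18 * ‖z‖ ^ 2 * (1 / (((k + 1 : ℕ) : ℝ)) ^ 2) :=
      ((summable_nat_add_iff 1).2 (Real.summable_one_div_nat_pow.2 one_lt_two)).mul_left _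
    refine Summable.of_norm_bounded_eventually hs ?_
    rw [Nat.cofinite_eq_atTop]
    filter_upwards [eventually_ge_atTop ⌈16 * ‖z‖⌉₊] with k hk
    rw [norm_norm]
    refine norm_weierstrassFactor_sub_one_le hT hpos (by omega) ?_
    refine (Nat.le_ceil _).trans ?_
    exact_mod_cast hk.trans (Nat.le_succ k)

lemma tendsto_phi_div (hpos : ∀ u, 0 < u → 0 < T.phiReal u) (z : ℂ) :
    Tendsto (fun n : ℕ => T.phi (n + z) / T.phiReal n) atTop (𝓝 1) := by
  rw [tendsto_iff_norm_sub_tendsto_zero]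
  have h1 : Tendsto (fun n : ℕ => ‖z‖ / (n : ℝ) + 8 * ‖z‖ ^ 2 / (n : ℝ) ^ 2) atTop (𝓝 0) := by
    have a1 := tendsto_const_div_atTop_nhds_zero_nat ‖z‖
    have a2 := tendsto_const_div_pow (8 * ‖z‖ ^ 2) 2 two_ne_zero
    simpa using a1.add (a2.comp tendsto_natCast_atTop_atTop)
  refine squeeze_zero' (Eventually.of_forall fun n => norm_nonneg _) ?_ h1
  filter_upwards [eventually_ge_atTop (⌈2 * ‖z‖⌉₊ + 1)] with n hn
  have hn0 : (0 : ℝ) < n := by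
    have : 0 < n := by omega
    exact_mod_cast this
  have := norm_phi_div_sub_one_le hpos hn0 (z := z)
    ((Nat.le_ceil _).trans (by exact_mod_cast (Nat.le_succ _).trans hn))
  simpa using this

/-- The partial products `φ(n)^z / φ(z) ∏_{k=1}^n φ(k)/φ(k+z)`, in which the exponential factors
have been collected. -/
noncomputable def partialW (T : BernsteinTriplet) (n : ℕ) (z : ℂ) : ℂ :=
  Complex.exp (Real.log (T.phiReal n) * z) / T.phi z *
    ∏ k ∈ Finset.range n, (T.phiReal (k + 1) : ℂ) / T.phi (k + 1 + z)

/-- The partial products converge to `W_φ`. -/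
theorem tendsto_partialW (hT : T.Represents φ) (hφ : IsBernstein φ) {z : ℂ}
    (hz : ∀ k : ℕ, T.phi (k + z) ≠ 0) :
    Tendsto (fun n => T.partialW n z) atTop (𝓝 (weierstrassProduct φ T.phi z)) := by
  have hpos := fun u hu => hT.pos hφ (u := u) hu
  have hW := weierstrassConverges_of_ne_zero hT hpos hz
  have hm : Multipliable fun k : ℕ => weierstrassFactor φ T.phi z (k + 1) := by
    have := multipliable_one_add_of_summable hW.2.2
    simpa using this
  have hγ := (hT.tendsto_eulerSeq hφ).1
  have hexp : Tendsto (fun n => Complex.exp (-(eulerSeq φ n : ℂ) * z)) atTop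
      (𝓝 (Complex.exp (-(eulerGamma φ : ℂ) * z))) := by
    have : Continuous fun x : ℝ => Complex.exp (-(x : ℂ) * z) := by fun_prop
    exact (this.tendsto _).comp hγ
  refine ((hexp.div_const (T.phi z)).mul hm.hasProd.tendsto_prod_nat).congr' ?_
  filter_upwards [eventually_ge_atTop 1] with n hn
  obtain ⟨n, rfl⟩ : ∃ m, n = m + 1 := ⟨n - 1, by omega⟩
  have h0 : ∀ k : ℕ, (0 : ℝ) < (k : ℝ) + 1 := fun k => by positivity
  have e1 : ∀ k : ℕ, weierstrassFactor φ T.phi z (k + 1) =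
      (T.phiReal (k + 1) : ℂ) / T.phi (k + 1 + z) *
        Complex.exp ((T.dphiReal (k + 1) / T.phiReal (k + 1) : ℝ) * z) := by
    intro k
    rw [weierstrassFactor]
    push_cast
    rw [hT.eq (h0 k), hT.deriv_eq (h0 k)]
  simp_rw [e1]
  rw [Finset.prod_mul_distrib, ← Complex.exp_sum, ← Finset.sum_mul, ← Complex.ofReal_sum,
    partialW, hT.eulerSeq_succ]
  push_cast
  rw [div_mul_eq_mul_div, div_mul_eq_mul_div, mul_comm (∏ k ∈ Finset.range (n + 1), _), ← mul_assoc,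
    ← Complex.exp_add]
  congr 3
  ring

/-- The numbers `φ(n)^w ∏_{k=1}^n φ(k)/φ(k+w)`, moments of order `w` of approximations of `V_φ`. -/
noncomputable def partialMoment (T : BernsteinTriplet) (n : ℕ) (w : ℂ) : ℂ :=
  Complex.exp (Real.log (T.phiReal n) * w) *
    ∏ k ∈ Finset.range n, (T.phiReal (k + 1) : ℂ) / T.phi (k + 1 + w)

/-- The approximate moments and the partial products differ by a factor that tends to `1`. -/
lemma partialMoment_eq (hpos : ∀ u, 0 < u → 0 < T.phiReal u) {w : ℂ}
    (hw : ∀ k : ℕ, T.phi (k + (w + 1)) ≠ 0) {n : ℕ} (hn : 1 ≤ n) :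
    T.partialMoment n w = T.partialW n (w + 1) * (T.phi (n + (w + 1)) / T.phiReal n) := by
  have hn0 : (0 : ℝ) < n := by exact_mod_cast hn
  have hp : (T.phiReal n : ℂ) ≠ 0 := by exact_mod_cast (hpos n hn0).ne'
  have hexp : Complex.exp (Real.log (T.phiReal n) * (w + 1)) =
      Complex.exp (Real.log (T.phiReal n) * w) * T.phiReal n := by
    rw [mul_add, mul_one, Complex.exp_add, ← Complex.ofReal_exp, Real.exp_log (hpos n hn0)]
  have hprod : (∏ k ∈ Finset.range n, T.phi (k + 1 + (w + 1))) * T.phi (w + 1) =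
      (∏ k ∈ Finset.range n, T.phi (k + 1 + w)) * T.phi (n + (w + 1)) := by
    have h1 := Finset.prod_range_succ' (fun k : ℕ => T.phi (k + 1 + w)) n
    rw [Finset.prod_range_succ] at h1
    push_cast at h1
    have e : ∀ k : ℂ, k + 1 + (w + 1) = k + 1 + 1 + w := fun k => by ring
    simp_rw [e]
    rw [show (n : ℂ) + (w + 1) = n + 1 + w by ring, show w + 1 = 0 + 1 + w by ring]
    exact h1.symm
  have hP : ∏ k ∈ Finset.range n, T.phi (k + 1 + w) ≠ 0 :=
    Finset.prod_ne_zero_iff.2 fun k _ => by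
      rw [show (k : ℂ) + 1 + w = k + (w + 1) by ring]
      exact hw k
  have hP' : ∏ k ∈ Finset.range n, T.phi (k + 1 + (w + 1)) ≠ 0 :=
    Finset.prod_ne_zero_iff.2 fun k _ => by exact_mod_cast hw (k + 1)
  have hw1 : T.phi (w + 1) ≠ 0 := by simpa using hw 0
  rw [partialW, partialMoment, hexp, Finset.prod_div_distrib, Finset.prod_div_distrib]
  field_simp
  linear_combination (∏ k ∈ Finset.range n, (T.phiReal (k + 1) : ℂ)) * hprod

/-- The approximate moments converge to `W_φ`. -/
lemma tendsto_partialMoment (hT : T.Represents φ) (hφ : IsBernstein φ) {w : ℂ}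
    (hw : ∀ k : ℕ, T.phi (k + (w + 1)) ≠ 0) :
    Tendsto (fun n => T.partialMoment n w) atTop (𝓝 (weierstrassProduct φ T.phi (w + 1))) := by
  have hpos := fun u hu => hT.pos hφ (u := u) hu
  have h := (tendsto_partialW hT hφ hw).mul (tendsto_phi_div hpos (w + 1))
  rw [mul_one] at h
  refine h.congr' ?_
  filter_upwards [eventually_ge_atTop 1] with n hn
  exact (partialMoment_eq hpos hw hn).symm

/-- The functional equation `W_φ(z + 1) = φ(z) W_φ(z)`. -/
theorem weierstrassProduct_add_one (hT : T.Represents φ) (hφ : IsBernstein φ) {z : ℂ}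
    (hz : ∀ k : ℕ, T.phi (k + z) ≠ 0) :
    weierstrassProduct φ T.phi (z + 1) = T.phi z * weierstrassProduct φ T.phi z := by
  have hz1 : ∀ k : ℕ, T.phi (k + (z + 1)) ≠ 0 := fun k => by
    have := hz (k + 1)
    push_cast at this
    rwa [show (k : ℂ) + (z + 1) = k + 1 + z by ring]
  have h2 := (tendsto_partialW hT hφ hz).const_mul (T.phi z)
  refine tendsto_nhds_unique (tendsto_partialMoment hT hφ hz1) (h2.congr fun n => ?_)
  have hz0 : T.phi z ≠ 0 := by simpa using hz 0
  rw [partialW, partialMoment]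
  field_simp

/-- The normalization `W_φ(1) = 1`. -/
theorem weierstrassProduct_one (hT : T.Represents φ) (hφ : IsBernstein φ) :
    weierstrassProduct φ T.phi 1 = 1 := by
  have hpos := fun u hu => hT.pos hφ (u := u) hu
  have hne : ∀ k : ℕ, T.phi (k + 1) ≠ 0 := fun k =>
    (isGood_zero hpos).phi_ne_zero (by simp; positivity)
  have h := tendsto_partialMoment hT hφ (w := 0) (by simpa using hne)
  rw [zero_add] at h
  refine tendsto_nhds_unique h (tendsto_const_nhds.congr fun n => ?_)
  have e : ∀ k : ℕ, (T.phiReal (k + 1) : ℂ) = T.phi (k + 1) := fun k => by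
    have := T.phi_ofReal (k + 1)
    push_cast at this
    exact this.symm
  simp only [partialMoment, mul_zero, Complex.exp_zero, one_mul, add_zero, e]
  exact (Finset.prod_eq_one fun k _ => div_self (hne k)).symm

end BernsteinTriplet

/-! ### The reciprocal of a Bernstein function is completely monotone -/

/-- Complete monotonicity up to order `n`, in a recursive form that is suited to products. -/
def CMUpTo (c : ℝ) : ℕ → (ℝ → ℝ) → Prop
  | 0, f => ∀ u, c < u → 0 ≤ f u
  | n + 1, f => (∀ u, c < u → 0 ≤ f u) ∧ (∀ u, c < u → DifferentiableAt ℝ f u) ∧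
      CMUpTo c n fun u => -deriv f u

namespace CMUpTo

variable {c : ℝ} {n : ℕ} {f g : ℝ → ℝ}

lemma of_succ (hf : CMUpTo c (n + 1) f) : CMUpTo c n f := by
  induction n generalizing f with
  | zero => exact hf.1
  | succ n ih => exact ⟨hf.1, hf.2.1, ih hf.2.2⟩

lemma congr (hf : CMUpTo c n f) (h : ∀ u, c < u → f u = g u) : CMUpTo c n g := by
  induction n generalizing f g with
  | zero => exact fun u hu => h u hu ▸ hf u hu
  | succ n ih =>
    have hev : ∀ u, c < u → f =ᶠ[𝓝 u] g := fun u hu => by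
      filter_upwards [Ioi_mem_nhds hu] with v hv using h v hv
    refine ⟨fun u hu => h u hu ▸ hf.1 u hu, fun u hu => ?_, ih hf.2.2 fun u hu => ?_⟩
    · exact (hev u hu).differentiableAt_iff.1 (hf.2.1 u hu)
    · rw [(hev u hu).deriv_eq]

lemma add (hf : CMUpTo c n f) (hg : CMUpTo c n g) : CMUpTo c n fun u => f u + g u := by
  induction n generalizing f g with
  | zero => exact fun u hu => add_nonneg (hf u hu) (hg u hu)
  | succ n ih =>
    refine ⟨fun u hu => add_nonneg (hf.1 u hu) (hg.1 u hu),
      fun u hu => (hf.2.1 u hu).add (hg.2.1 u hu), (ih hf.2.2 hg.2.2).congr fun u hu => ?_⟩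
    rw [deriv_fun_add (hf.2.1 u hu) (hg.2.1 u hu), neg_add]

lemma mul (hf : CMUpTo c n f) (hg : CMUpTo c n g) : CMUpTo c n fun u => f u * g u := by
  induction n generalizing f g with
  | zero => exact fun u hu => mul_nonneg (hf u hu) (hg u hu)
  | succ n ih =>
    refine ⟨fun u hu => mul_nonneg (hf.1 u hu) (hg.1 u hu),
      fun u hu => (hf.2.1 u hu).mul (hg.2.1 u hu),
      ((ih hf.2.2 hg.of_succ).add (ih hf.of_succ hg.2.2)).congr fun u hu => ?_⟩
    rw [deriv_fun_mul (hf.2.1 u hu) (hg.2.1 u hu)]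
    ring

lemma const {k : ℝ} (hk : 0 ≤ k) : CMUpTo c n fun _ => k := by
  induction n generalizing k with
  | zero => exact fun _ _ => hk
  | succ n ih =>
    refine ⟨fun _ _ => hk, fun _ _ => differentiableAt_const _, ?_⟩
    simpa using ih le_rfl

/-- If `g > 0` has a completely monotone derivative, then `1/g` is completely monotone, because
`-(1/g)' = g' (1/g)²` has one order of complete monotonicity more than `1/g`. -/
lemma inv {g' : ℝ → ℝ} (hpos : ∀ u, c < u → 0 < g u) (hd : ∀ u, c < u → HasDerivAt g (g' u) u)
    (hg' : ∀ n, CMUpTo c n g') (n : ℕ) : CMUpTo c n fun u => (g u)⁻¹ := by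
  induction n with
  | zero => exact fun u hu => (inv_pos.2 (hpos u hu)).le
  | succ n ih =>
    refine ⟨fun u hu => (inv_pos.2 (hpos u hu)).le,
      fun u hu => ((hd u hu).inv (hpos u hu).ne').differentiableAt,
      ((hg' n).mul (ih.mul ih)).congr fun u hu => ?_⟩
    rw [((hd u hu).fun_inv (hpos u hu).ne').deriv]
    have := (hpos u hu).ne'
    field_simp

lemma iteratedDeriv_nonneg (hf : CMUpTo c n f) {u : ℝ} (hu : c < u) :
    0 ≤ (-1 : ℝ) ^ n * iteratedDeriv n f u := by
  induction n generalizing f with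
  | zero => simpa using hf u hu
  | succ n ih =>
    have h := ih hf.2.2
    have e : (fun u => -deriv f u) = -deriv f := rfl
    rw [e, iteratedDeriv_neg] at h
    rw [iteratedDeriv_succ', pow_succ]
    simpa using h

lemma cmOn (hc : ContDiffOn ℝ ∞ f (Ioi c)) (hf : ∀ n, CMUpTo c n f) : CMOn c f :=
  ⟨hc, fun n _ hu => (hf n).iteratedDeriv_nonneg hu⟩

end CMUpTo

/-- Two holomorphic functions on a half-plane that agree on the real line are equal. -/
lemma eqOn_halfPlane_of_eq_ofReal {c : ℝ} {f g : ℂ → ℂ}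
    (hf : DifferentiableOn ℂ f {z | c < z.re}) (hg : DifferentiableOn ℂ g {z | c < z.re})
    (h : ∀ u : ℝ, c < u → f u = g u) : EqOn f g {z | c < z.re} := by
  have ho : IsOpen {z : ℂ | c < z.re} := isOpen_lt continuous_const Complex.continuous_re
  refine (hf.analyticOnNhd ho).eqOn_of_preconnected_of_frequently_eq (hg.analyticOnNhd ho)
    (convex_halfSpace_re_gt c).isPreconnected (z₀ := ((c + 1 : ℝ) : ℂ)) (by simp) ?_
  have h1 : ∃ᶠ x : ℝ in 𝓝[≠] (c + 1), f x = g x := by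
    refine Eventually.frequently ?_
    filter_upwards [nhdsWithin_le_nhds (Ioi_mem_nhds (lt_add_one c))] with x hx using h x hx
  refine Tendsto.frequently (tendsto_nhdsWithin_iff.2 ⟨?_, ?_⟩) h1
  · exact (Complex.continuous_ofReal.tendsto _).mono_left nhdsWithin_le_nhds
  · filter_upwards [self_mem_nhdsWithin] with x hx
    exact fun h => hx (Complex.ofReal_injective h)

namespace BernsteinTriplet

variable {T : BernsteinTriplet} {φ : ℝ → ℝ} {c : ℝ}

/-- The derivative of `φ` is a constant plus the moment generating function of `y μ(dy)`,
reflected. -/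
lemma dphiReal_eq_mgf (T : BernsteinTriplet) (u : ℝ) : T.dphiReal u = T.s +
    mgf (fun y => -y) ((T.μ.restrict (Ioi 0)).withDensity fun y => ENNReal.ofReal y) u := by
  rw [dphiReal, mgf, integral_withDensity_eq_integral_toReal_smul (by fun_prop)
    (ae_of_all _ fun y => ENNReal.ofReal_lt_top)]
  congr 1
  refine integral_congr_ae (T.ae_Ioi fun y hy => ?_)
  simp only [ENNReal.toReal_ofReal hy.le, smul_eq_mul]
  ring_nf

lemma mem_interior_integrableExpSet (hc : T.IsGood c) {u : ℝ} (hu : c < u) :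
    u ∈ interior (integrableExpSet (fun y => -y)
      ((T.μ.restrict (Ioi 0)).withDensity fun y => ENNReal.ofReal y)) := by
  refine mem_interior.2 ⟨Ioi c, fun v hv => ?_, isOpen_Ioi, hu⟩
  obtain ⟨a, ha, hTa, hav⟩ := hc.exists_base hv
  rw [integrableExpSet, mem_ofPred_eq, integrable_withDensity_iff_integrable_smul' (by fun_prop)
    (ae_of_all _ fun y => ENNReal.ofReal_lt_top)]
  refine (integrable_mul_exp_real hTa hav).congr (T.ae_Ioi fun y hy => ?_)
  simp only [ENNReal.toReal_ofReal hy.le, smul_eq_mul]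
  ring_nf

lemma hasDerivAt_phiReal_of_isGood (hc : T.IsGood c) {u : ℝ} (hu : c < u) :
    HasDerivAt T.phiReal (T.dphiReal u) u := by
  obtain ⟨a, ha, hTa, hau⟩ := hc.exists_base hu
  exact hasDerivAt_phiReal ha hTa hau

/-- The derivatives of `φ'` are, up to alternating signs, integrals of `y^k e^{-uy}`. -/
lemma cmUpTo_dphiReal (hc : T.IsGood c) (n : ℕ) : CMUpTo c n T.dphiReal := by
  set ρ := (T.μ.restrict (Ioi 0)).withDensity fun y => ENNReal.ofReal y with hρ
  have key : ∀ n k : ℕ, CMUpTo c n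
      fun u => (-1) ^ k * ∫ y : ℝ, (-y) ^ k * Real.exp (u * -y) ∂ρ := by
    intro n
    have hnn : ∀ (k : ℕ) (u : ℝ), 0 ≤ (-1) ^ k * ∫ y : ℝ, (-y) ^ k * Real.exp (u * -y) ∂ρ := by
      intro k u
      rw [← integral_const_mul]
      refine integral_nonneg_of_ae ?_
      refine (withDensity_absolutelyContinuous _ _).ae_le (T.ae_Ioi fun y hy => ?_)
      simp only [Pi.zero_apply]
      rw [← mul_assoc, ← mul_pow, neg_mul_neg, one_mul]
      positivity
    induction n with
    | zero => exact fun k u _ => hnn k u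
    | succ n ih =>
      intro k
      have hder := fun u (hu : c < u) =>
        (hasDerivAt_integral_pow_mul_exp_real (mem_interior_integrableExpSet hc hu) k).const_mul
          ((-1 : ℝ) ^ k)
      refine ⟨fun u _ => hnn k u, fun u hu => (hder u hu).differentiableAt,
        (ih (k + 1)).congr fun u hu => ?_⟩
      rw [(hder u hu).deriv, pow_succ]
      ring
  refine ((CMUpTo.const T.s_nonneg).add (key n 0)).congr fun u _ => ?_
  simp [dphiReal_eq_mgf, mgf, hρ]

lemma contDiffOn_phiReal (hc : T.IsGood c) : ContDiffOn ℝ ∞ T.phiReal (Ioi c) := by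
  rw [contDiffOn_infty_iff_deriv_of_isOpen isOpen_Ioi]
  refine ⟨fun u hu => (hasDerivAt_phiReal_of_isGood hc
    hu).differentiableAt.differentiableWithinAt, ?_⟩
  have h : ContDiffOn ℝ ∞ T.dphiReal (Ioi c) := by
    have e : T.dphiReal = fun u => T.s + mgf (fun y => -y)
        ((T.μ.restrict (Ioi 0)).withDensity fun y => ENNReal.ofReal y) u :=
      funext T.dphiReal_eq_mgf
    rw [e]
    refine contDiffOn_const.add fun u hu => ?_
    exact (analyticAt_mgf (mem_interior_integrableExpSet hc hu)).contDiffAt.contDiffWithinAt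
  exact h.congr fun u hu => (hasDerivAt_phiReal_of_isGood hc hu).deriv

lemma differentiableOn_phi (hc : T.IsGood c) : DifferentiableOn ℂ T.phi {z | c < z.re} := by
  intro z hz
  obtain ⟨a, ha, hTa, haz⟩ := hc.exists_base hz
  exact (hasDerivAt_phi ha hTa haz).differentiableAt.differentiableWithinAt

/-- The reciprocal `1/φ` is the Laplace transform of a measure, the potential measure, here reflected
so that its Laplace transform becomes a moment generating function. -/
theorem exists_potential (hc : T.IsGood c) : ∃ U : Measure ℝ, SFinite U ∧
    ∀ z : ℂ, c < z.re → Integrable (fun x => Real.exp (z.re * x)) U ∧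
      complexMGF id U z = (T.phi z)⁻¹ := by
  have hcm : CMOn c fun u => (T.phiReal u)⁻¹ :=
    CMUpTo.cmOn ((contDiffOn_phiReal hc).inv fun u hu => (hc.2 u hu).2.ne')
      (CMUpTo.inv (fun u hu => (hc.2 u hu).2) (fun u hu => hasDerivAt_phiReal_of_isGood hc hu)
        (cmUpTo_dphiReal hc))
  obtain ⟨U, hU, -, h⟩ := hcm.exists_measure
  refine ⟨U, hU, fun z hz => ⟨(h _ hz).1, ?_⟩⟩
  have hsub : ∀ u, c < u → u ∈ interior (integrableExpSet id U) := fun u hu =>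
    mem_interior.2 ⟨Ioi c, fun v hv => (h v hv).1, isOpen_Ioi, hu⟩
  refine eqOn_halfPlane_of_eq_ofReal (f := complexMGF id U) (g := fun z => (T.phi z)⁻¹)
    (fun w hw => ?_) ((differentiableOn_phi hc).inv fun w hw => hc.phi_ne_zero hw)
    (fun u hu => ?_) hz
  · exact (differentiableOn_complexMGF.mono (fun v (hv : c < v.re) => hsub _ hv)) w hw
  · rw [complexMGF_ofReal, (h u hu).2, phi_ofReal]
    push_cast
    rfl

end BernsteinTriplet

/-! ### Construction of `V_φ` -/

lemma complexMGF_conv {μ ν : Measure ℝ} [SFinite μ] [SFinite ν] {z : ℂ}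
    (hμ : Integrable (fun x => Real.exp (z.re * x)) μ)
    (hν : Integrable (fun x => Real.exp (z.re * x)) ν) :
    Integrable (fun x => Real.exp (z.re * x)) (μ.conv ν) ∧
      complexMGF id (μ.conv ν) z = complexMGF id μ z * complexMGF id ν z := by
  have hprod := (integrable_cexp_iff.2 hμ).mul_prod (integrable_cexp_iff.2 hν)
  have e : (fun p : ℝ × ℝ => Complex.exp (z * p.1) * Complex.exp (z * p.2)) =
      (fun x : ℝ => Complex.exp (z * x)) ∘ fun p : ℝ × ℝ => p.1 + p.2 := by
    funext p
    simp [← Complex.exp_add, mul_add]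
  constructor
  · rw [← integrable_cexp_iff, Measure.conv, integrable_map_measure (by fun_prop) (by fun_prop),
      ← e]
    exact hprod
  · simp only [complexMGF, id]
    rw [Measure.conv, integral_map (by fun_prop) (by fun_prop), ← integral_prod_mul]
    exact integral_congr_ae (ae_of_all _ fun p => (congrFun e p).symm)

lemma complexMGF_dirac (x : ℝ) (z : ℂ) :
    complexMGF id (Measure.dirac x) z = Complex.exp (x * z) := by
  simp [complexMGF, mul_comm]

/-- Integrability at exponent `0` says that `μ` is finite; the value there is its total mass. -/
lemma isProbabilityMeasure_of_complexMGF {μ : Measure ℝ}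
    (h0 : Integrable (fun x => Real.exp ((0 : ℂ).re * x)) μ) (h : complexMGF id μ 0 = 1) :
    IsProbabilityMeasure μ := by
  have hf : IsFiniteMeasure μ := by
    simp only [Complex.zero_re, zero_mul, Real.exp_zero] at h0
    exact (integrable_const_iff_isFiniteMeasure one_ne_zero).1 h0
  constructor
  simp only [complexMGF, zero_mul, Complex.exp_zero, integral_const, Complex.real_smul,
    mul_one] at h
  have : μ.real univ = 1 := by exact_mod_cast h
  rwa [measureReal_def, ENNReal.toReal_eq_one_iff] at this

namespace BernsteinTriplet

variable {T : BernsteinTriplet} {φ : ℝ → ℝ} {c : ℝ}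

/-- For `k > 0` there is a law with moment generating function `z ↦ φ(k)/φ(k+z)`: the exponential
tilt of the potential measure, normalized. -/
lemma exists_law_phi_div (hc : T.IsGood c) {k : ℝ} (hk : 0 < k) :
    ∃ ν : Measure ℝ, IsProbabilityMeasure ν ∧ ∀ z : ℂ, c < k + z.re →
      Integrable (fun x => Real.exp (z.re * x)) ν ∧
        complexMGF id ν z = T.phiReal k / T.phi (k + z) := by
  obtain ⟨U, hU, h⟩ := exists_potential hc
  have hck : c < k := hc.1.trans_lt hk
  have hpos := (hc.2 k hck).2
  let ν : Measure ℝ := U.withDensity fun x => ENNReal.ofReal (T.phiReal k * Real.exp (k * x))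
  have key : ∀ z : ℂ, c < k + z.re → Integrable (fun x => Real.exp (z.re * x)) ν ∧
      complexMGF id ν z = T.phiReal k / T.phi (k + z) := by
    intro z hz
    obtain ⟨h1, h2⟩ := h (k + z) (by simpa using hz)
    have e : ∀ x : ℝ, (ENNReal.ofReal (T.phiReal k * Real.exp (k * x))).toReal •
        Complex.exp (z * x) = T.phiReal k * Complex.exp ((k + z) * x) := by
      intro x
      rw [ENNReal.toReal_ofReal (by positivity), Complex.real_smul, add_mul, Complex.exp_add]
      push_cast
      ring
    constructor
    · rw [← integrable_cexp_iff, integrable_withDensity_iff_integrable_smul' (by fun_prop)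
        (ae_of_all _ fun y => ENNReal.ofReal_lt_top)]
      simp_rw [e]
      exact (integrable_cexp_iff.2 h1).const_mul _
    · simp only [complexMGF, id] at h2 ⊢
      rw [integral_withDensity_eq_integral_toReal_smul (by fun_prop)
        (ae_of_all _ fun y => ENNReal.ofReal_lt_top)]
      simp_rw [e]
      rw [integral_const_mul, h2, div_eq_mul_inv]
  refine ⟨ν, ?_, key⟩
  obtain ⟨h1, h2⟩ := key 0 (by simpa using hck)
  refine isProbabilityMeasure_of_complexMGF h1 ?_
  rw [h2, add_zero, phi_ofReal, div_self]
  exact_mod_cast hpos.ne'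

/-- There is a law with moment generating function `partialMoment T n`: a translated convolution
of the laws with moment generating functions `φ(k)/φ(k+z)`, `k ≤ n`. -/
lemma exists_law_partialMoment (hc : T.IsGood c) (n : ℕ) :
    ∃ ν : Measure ℝ, IsProbabilityMeasure ν ∧ ∀ z : ℂ, c < z.re + 1 →
      Integrable (fun x => Real.exp (z.re * x)) ν ∧ complexMGF id ν z = T.partialMoment n z := by
  have hconv : ∃ ν : Measure ℝ, IsProbabilityMeasure ν ∧ ∀ z : ℂ, c < z.re + 1 →
      Integrable (fun x => Real.exp (z.re * x)) ν ∧ complexMGF id ν z =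
        ∏ k ∈ Finset.range n, (T.phiReal (k + 1) : ℂ) / T.phi (k + 1 + z) := by
    induction n with
    | zero =>
      refine ⟨Measure.dirac 0, inferInstance, fun z _ => ⟨integrable_dirac (by simp), ?_⟩⟩
      rw [complexMGF_dirac]
      simp
    | succ n ih =>
      obtain ⟨ν₁, hν₁, h₁⟩ := ih
      obtain ⟨ν₂, hν₂, h₂⟩ := exists_law_phi_div hc (k := (n : ℝ) + 1) (by positivity)
      refine ⟨ν₁.conv ν₂, inferInstance, fun z hz => ?_⟩
      have h3 := h₁ z hz
      have h4 := h₂ z (by have : (0 : ℝ) ≤ n := by positivity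
                          linarith)
      have h5 := complexMGF_conv h3.1 h4.1
      refine ⟨h5.1, ?_⟩
      rw [h5.2, h3.2, h4.2, Finset.prod_range_succ]
      push_cast
      rfl
  obtain ⟨ν₁, hν₁, h₁⟩ := hconv
  refine ⟨(Measure.dirac (Real.log (T.phiReal n))).conv ν₁, inferInstance, fun z hz => ?_⟩
  have h5 := complexMGF_conv (μ := Measure.dirac (Real.log (T.phiReal n))) (z := z)
    (integrable_dirac (by simp)) (h₁ z hz).1
  refine ⟨h5.1, ?_⟩
  rw [h5.2, (h₁ z hz).2, complexMGF_dirac, partialMoment]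

/-- For every `c` as in `IsGood` there is a law, that of `log V_φ`, whose moment generating
function is `W_φ(z + 1)` for `Re z > c - 1`. -/
theorem exists_law_weierstrassProduct (hT : T.Represents φ) (hφ : IsBernstein φ)
    (hc : T.IsGood c) : ∃ ν : Measure ℝ, IsProbabilityMeasure ν ∧ ∀ z : ℂ, c < z.re →
      Integrable (fun x => Real.exp ((z - 1).re * x)) ν ∧
        complexMGF id ν (z - 1) = weierstrassProduct φ T.phi z := by
  choose μ hμ h using exists_law_partialMoment hc
  have hlim : ∀ w : ℂ, c < w.re + 1 → Tendsto (fun n => complexMGF id (μ n) w) atTop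
      (𝓝 (weierstrassProduct φ T.phi (w + 1))) := by
    intro w hw
    refine (tendsto_partialMoment hT hφ fun k => hc.phi_ne_zero ?_).congr fun n =>
      ((h n w hw).2).symm
    simp only [Complex.add_re, Complex.natCast_re, Complex.one_re]
    have : (0 : ℝ) ≤ k := by positivity
    linarith
  have hI : ∀ {t : ℝ}, t ∈ Ioi (c - 1) ↔ c < t + 1 := by
    intro t
    simp only [mem_Ioi]
    constructor <;> intro <;> linarith
  obtain ⟨ν, hν, h1, h2⟩ := exists_law_of_tendsto_mgf (μ := μ) (I := Ioi (c - 1)) isOpen_Ioi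
    (F := fun t => (weierstrassProduct φ T.phi (t + 1)).re)
    (hI.2 (by linarith [hc.1]))
    (fun t ht => Eventually.of_forall fun n => by
      simpa using (h n t (by simpa using hI.1 ht)).1)
    (fun t ht => by
      have h3 := hlim t (by simpa using hI.1 ht)
      simp_rw [complexMGF_ofReal] at h3
      exact (Complex.continuous_re.tendsto _).comp h3)
  refine ⟨ν, hν, fun z hz => ?_⟩
  have hz' : (z - 1).re ∈ Ioi (c - 1) := hI.2 (by simpa using hz)
  refine ⟨h1 _ hz', ?_⟩
  have h3 := hlim (z - 1) (by simpa using hz)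
  rw [sub_add_cancel] at h3
  exact h2 _ hz' _ h3

end BernsteinTriplet

/-! ### Moment determinacy -/

/-- A law whose moments are at most `C^n n!` has exponential moments of small order. The even moments
suffice, through the power series of `cosh`. -/
lemma integrable_exp_of_moments_le {ν : Measure ℝ} {m : ℕ → ℝ} {C t : ℝ} (hC : 0 ≤ C)
    (h : ∀ n : ℕ, Integrable (fun x => x ^ n) ν ∧ ∫ x, x ^ n ∂ν = m n)
    (hm : ∀ n, m n ≤ C ^ n * n.factorial) (ht : |t| * C ≤ 1 / 2) :
    Integrable (fun x => Real.exp (t * x)) ν := by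
  have hterm : ∀ n : ℕ, ∫⁻ x, ENNReal.ofReal ((t * x) ^ (2 * n) / (2 * n).factorial) ∂ν ≤
      ENNReal.ofReal ((1 / 4) ^ n) := by
    intro n
    have e : ∀ x : ℝ, (t * x) ^ (2 * n) / (2 * n).factorial =
        t ^ (2 * n) / (2 * n).factorial * x ^ (2 * n) := fun x => by rw [mul_pow]; ring
    simp_rw [e]
    rw [← ofReal_integral_eq_lintegral_ofReal ((h (2 * n)).1.const_mul _)
      (ae_of_all _ fun x => by
        simp only [pow_mul, Pi.zero_apply]
        positivity), integral_const_mul, (h (2 * n)).2]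
    refine ENNReal.ofReal_le_ofReal ?_
    have h0 : 0 ≤ t ^ (2 * n) / (2 * n).factorial := by rw [pow_mul]; positivity
    calc t ^ (2 * n) / (2 * n).factorial * m (2 * n)
        ≤ t ^ (2 * n) / (2 * n).factorial * (C ^ (2 * n) * (2 * n).factorial) := by
          gcongr
          exact hm _
      _ = (|t| * C) ^ (2 * n) := by
          rw [mul_pow, pow_mul |t|, sq_abs, ← pow_mul]
          field_simp
      _ ≤ (1 / 2) ^ (2 * n) := by gcongr
      _ = (1 / 4) ^ n := by rw [pow_mul]; norm_num
  have hcosh : ∫⁻ x, ENNReal.ofReal (Real.cosh (t * x)) ∂ν < ⊤ := by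
    have e : ∀ x : ℝ, ENNReal.ofReal (Real.cosh (t * x)) =
        ∑' n : ℕ, ENNReal.ofReal ((t * x) ^ (2 * n) / (2 * n).factorial) := by
      intro x
      rw [← (Real.hasSum_cosh (t * x)).tsum_eq, ENNReal.ofReal_tsum_of_nonneg _
        (Real.hasSum_cosh (t * x)).summable]
      intro n
      rw [pow_mul]
      positivity
    simp_rw [e]
    rw [lintegral_tsum fun n => by fun_prop]
    refine (ENNReal.tsum_le_tsum hterm).trans_lt ?_
    rw [← ENNReal.ofReal_tsum_of_nonneg (fun n => by positivity)
      (summable_geometric_of_lt_one (by norm_num) (by norm_num))]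
    exact ENNReal.ofReal_lt_top
  have hci : Integrable (fun x => Real.cosh (t * x)) ν := by
    refine ⟨(Real.continuous_cosh.comp (by fun_prop)).aestronglyMeasurable, ?_⟩
    rw [hasFiniteIntegral_iff_ofReal (ae_of_all _ fun x => (Real.cosh_pos _).le)]
    exact hcosh
  refine Integrable.mono' (hci.const_mul 2) (by fun_prop) (ae_of_all _ fun x => ?_)
  rw [Real.norm_eq_abs, abs_of_pos (Real.exp_pos _), Real.cosh_eq]
  linarith [Real.exp_pos (-(t * x))]

/-- Two laws with the same moments, bounded by `C^n n!`, coincide: their complex moment generating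
functions are holomorphic in a strip around the imaginary axis and have the same derivatives
at `0`. -/
theorem measure_eq_of_moments_eq {ν₁ ν₂ : Measure ℝ} [IsProbabilityMeasure ν₁]
    [IsProbabilityMeasure ν₂] {m : ℕ → ℝ} {C : ℝ} (hC : 0 < C)
    (h₁ : ∀ n : ℕ, Integrable (fun x => x ^ n) ν₁ ∧ ∫ x, x ^ n ∂ν₁ = m n)
    (h₂ : ∀ n : ℕ, Integrable (fun x => x ^ n) ν₂ ∧ ∫ x, x ^ n ∂ν₂ = m n)
    (hm : ∀ n, m n ≤ C ^ n * n.factorial) : ν₁ = ν₂ := by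
  set θ : ℝ := 1 / (2 * C) with hθ
  have hθ0 : 0 < θ := by positivity
  have hint : ∀ {ν : Measure ℝ}, (∀ n : ℕ, Integrable (fun x => x ^ n) ν ∧ ∫ x, x ^ n ∂ν = m n) →
      ∀ t ∈ Ioo (-θ) θ, t ∈ interior (integrableExpSet id ν) := by
    intro ν h t ht
    refine mem_interior.2 ⟨Ioo (-θ) θ, fun s hs => ?_, isOpen_Ioo, ht⟩
    refine integrable_exp_of_moments_le hC.le h hm ?_
    have : |s| ≤ θ := abs_le.2 ⟨hs.1.le, hs.2.le⟩
    calc |s| * C ≤ θ * C := by gcongr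
      _ = 1 / 2 := by rw [hθ]; field_simp
  set strip : Set ℂ := {z | z.re ∈ Ioo (-θ) θ} with hstrip
  have han : ∀ {ν : Measure ℝ}, (∀ n : ℕ, Integrable (fun x => x ^ n) ν ∧ ∫ x, x ^ n ∂ν = m n) →
      AnalyticOnNhd ℂ (complexMGF id ν) strip := fun h z hz =>
    analyticAt_complexMGF (hint h _ hz)
  have hder : ∀ {ν : Measure ℝ}, (∀ n : ℕ, Integrable (fun x => x ^ n) ν ∧ ∫ x, x ^ n ∂ν = m n) →
      ∀ n, iteratedDeriv n (complexMGF id ν) 0 = m n := by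
    intro ν h n
    rw [iteratedDeriv_complexMGF (hint h _ (by simp [hθ0]))]
    simp only [zero_mul, Complex.exp_zero, mul_one, id, ← Complex.ofReal_pow]
    rw [integral_complex_ofReal, (h n).2]
  have h0 : (0 : ℂ) ∈ strip := by simp [hstrip, hθ0]
  have hord : analyticOrderAt (complexMGF id ν₁ - complexMGF id ν₂) 0 = ⊤ := by
    refine ENat.eq_top_iff_forall_ge.2 fun n => ?_
    rw [natCast_le_analyticOrderAt_iff_iteratedDeriv_eq_zero ((han h₁ 0 h0).sub (han h₂ 0 h0))]
    intro i _
    rw [iteratedDeriv_sub (han h₁ 0 h0).contDiffAt (han h₂ 0 h0).contDiffAt, hder h₁, hder h₂,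
      sub_self]
  rw [analyticOrderAt_eq_top] at hord
  have heq : EqOn (complexMGF id ν₁) (complexMGF id ν₂) strip := by
    refine (han h₁).eqOn_of_preconnected_of_eventuallyEq (han h₂) ?_ h0 ?_
    · exact ((convex_Ioo (-θ) θ).linear_preimage Complex.reLm).isPreconnected
    · filter_upwards [hord] with z hz
      exact sub_eq_zero.1 hz
  refine Measure.ext_of_charFun (funext fun t => ?_)
  rw [← complexMGF_id_mul_I, ← complexMGF_id_mul_I]
  exact heq (by simp [hstrip, hθ0])

lemma continuousOn_complexMGF {ν : Measure ℝ} {a : ℝ}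
    (h : ∀ t, a ≤ t → Integrable (fun x => Real.exp (t * x)) ν) :
    ContinuousOn (complexMGF id ν) {z | a ≤ z.re} := by
  intro z hz
  have hz : a ≤ z.re := hz
  refine continuousWithinAt_of_dominated
    (bound := fun x => Real.exp (a * x) + Real.exp ((z.re + 1) * x))
    (Eventually.of_forall fun w => by simp only [id]; fun_prop) ?_
    ((h a le_rfl).add (h _ (by linarith)))
    (ae_of_all _ fun y => by fun_prop)
  have hnhds : ∀ᶠ w in 𝓝[{z : ℂ | a ≤ z.re}] z, w.re < z.re + 1 :=
    nhdsWithin_le_nhds ((isOpen_lt Complex.continuous_re continuous_const).mem_nhds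
      (lt_add_one z.re))
  filter_upwards [hnhds, self_mem_nhdsWithin] with w hw hwa
  refine ae_of_all _ fun x => ?_
  have hwa : a ≤ w.re := hwa
  rw [id, norm_cexp_mul_ofReal]
  rcases le_total 0 x with hx | hx
  · exact (Real.exp_le_exp.2 (by nlinarith)).trans (le_add_of_nonneg_left (Real.exp_pos _).le)
  · exact (Real.exp_le_exp.2 (by nlinarith)).trans (le_add_of_nonneg_right (Real.exp_pos _).le)

namespace BernsteinTriplet

variable {T : BernsteinTriplet} {φ : ℝ → ℝ} {c : ℝ}

/-! ### The law of `V_φ` and its Mellin transform -/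

lemma weierstrassProduct_natCast (hT : T.Represents φ) (hφ : IsBernstein φ) (n : ℕ) :
    weierstrassProduct φ T.phi (n + 1) = ∏ k ∈ Finset.Icc 1 n, φ k := by
  have hpos := fun u hu => hT.pos hφ (u := u) hu
  induction n with
  | zero => simp [weierstrassProduct_one hT hφ]
  | succ n ih =>
    rw [← Finset.insert_Icc_right_eq_Icc_add_one (by omega), Finset.prod_insert (by simp),
      Complex.ofReal_mul, ← ih]
    have hn : (0 : ℝ) < ((n + 1 : ℕ) : ℝ) := by positivity
    have h := weierstrassProduct_add_one hT hφ (z := ((n : ℂ) + 1)) fun k =>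
      (isGood_zero hpos).phi_ne_zero (by simp; positivity)
    push_cast
    rw [h]
    congr 1
    have := hT _ hn
    push_cast at this
    exact this.symm

/-- `φ(k) ≤ k φ(1)` bounds the moments of `V_φ`. -/
lemma prod_le (hT : T.Represents φ) (hφ : IsBernstein φ) (n : ℕ) :
    ∏ k ∈ Finset.Icc 1 n, φ k ≤ T.phiReal 1 ^ n * n.factorial := by
  have hpos := fun u hu => hT.pos hφ (u := u) hu
  induction n with
  | zero => simp
  | succ n ih =>
    rw [← Finset.insert_Icc_right_eq_Icc_add_one (by omega), Finset.prod_insert (by simp),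
      Nat.factorial_succ]
    have hn : (0 : ℝ) < ((n + 1 : ℕ) : ℝ) := by positivity
    have h1 := T.phiReal_natCast_mul_le (n + 1) (by omega) zero_le_one
    rw [mul_one] at h1
    rw [hT.eq hn]
    have h2 := hpos 1 one_pos
    calc T.phiReal ((n + 1 : ℕ) : ℝ) * ∏ k ∈ Finset.Icc 1 n, φ k
        ≤ (((n + 1 : ℕ) : ℝ) * T.phiReal 1) * (T.phiReal 1 ^ n * n.factorial) := by
          refine mul_le_mul h1 ih (Finset.prod_nonneg fun k hk => ?_) (by positivity)
          have hk : (0 : ℝ) < k := by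
            have := (Finset.mem_Icc.1 hk).1
            exact_mod_cast this
          rw [hT.eq hk]
          exact (hpos k hk).le
      _ = _ := by push_cast; ring

/-- The moments of `V_φ` are the values of `W_φ` at the positive integers. -/
lemma moments_map_exp {ν : Measure ℝ} (hT : T.Represents φ) (hφ : IsBernstein φ)
    (h : ∀ z : ℂ, 0 < z.re → Integrable (fun x => Real.exp ((z - 1).re * x)) ν ∧
      complexMGF id ν (z - 1) = weierstrassProduct φ T.phi z) (n : ℕ) :
    Integrable (fun x => x ^ n) (ν.map Real.exp) ∧
      ∫ x, x ^ n ∂(ν.map Real.exp) = ∏ k ∈ Finset.Icc 1 n, φ k := by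
  obtain ⟨h1, h2⟩ := h (n + 1) (by simp; positivity)
  rw [weierstrassProduct_natCast hT hφ, add_sub_cancel_right] at h2
  have e : ∀ x : ℝ, Real.exp (n * x) = Real.exp x ^ n := fun x => Real.exp_nat_mul x n
  simp only [add_sub_cancel_right, Complex.natCast_re, e] at h1
  constructor
  · rw [integrable_map_measure (by fun_prop) (by fun_prop)]
    exact h1
  · rw [integral_map (by fun_prop) (by fun_prop)]
    have h3 := complexMGF_ofReal (X := id) (μ := ν) (n : ℝ)
    rw [Complex.ofReal_natCast, h2] at h3
    have h4 : ∏ k ∈ Finset.Icc 1 n, φ k = mgf id ν n := by exact_mod_cast h3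
    rw [h4]
    simp [mgf, e]

lemma measure_eq_of_map_exp_eq {ν₁ ν₂ : Measure ℝ} (h : ν₁.map Real.exp = ν₂.map Real.exp) :
    ν₁ = ν₂ := by
  have := congrArg (Measure.map Real.log) h
  rw [Measure.map_map Real.measurable_log Real.measurable_exp,
    Measure.map_map Real.measurable_log Real.measurable_exp] at this
  have e : Real.log ∘ Real.exp = id := funext Real.log_exp
  simpa [e] using this

/-- There is a law, that of `log V_φ`, whose moment generating function is `W_φ(z + 1)`, wherever
`z + 1` lies in one of the half-planes in question. The laws obtained on smaller half-planes agree
because they have the same moments; the boundary of a closed half-plane is reached by Fatou's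
lemma and continuity. -/
theorem exists_law (hT : T.Represents φ) (hφ : IsBernstein φ) :
    ∃ ν : Measure ℝ, IsProbabilityMeasure ν ∧ ∀ S, T.IsDomain S → ∀ z ∈ S,
      Integrable (fun x => Real.exp ((z - 1).re * x)) ν ∧
        complexMGF id ν (z - 1) = weierstrassProduct φ T.phi z := by
  have hpos := fun u hu => hT.pos hφ (u := u) hu
  obtain ⟨ν, hν, h⟩ := exists_law_weierstrassProduct hT hφ (isGood_zero hpos)
  have hopen : ∀ z ∈ T.openDomain, Integrable (fun x => Real.exp ((z - 1).re * x)) ν ∧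
        complexMGF id ν (z - 1) = weierstrassProduct φ T.phi z := by
    intro z hz
    obtain ⟨c, hc, hcz⟩ := exists_isGood hpos hz
    obtain ⟨ν', hν', h'⟩ := exists_law_weierstrassProduct hT hφ hc
    have : ν = ν' := by
      have p1 : IsProbabilityMeasure (ν.map Real.exp) :=
        Measure.isProbabilityMeasure_map (by fun_prop)
      have p2 : IsProbabilityMeasure (ν'.map Real.exp) :=
        Measure.isProbabilityMeasure_map (by fun_prop)
      exact measure_eq_of_map_exp_eq (measure_eq_of_moments_eq (hpos 1 one_pos)
        (moments_map_exp hT hφ h) (moments_map_exp hT hφ fun z hz => h' z (hc.1.trans_lt hz))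
        (prod_le hT hφ))
    rw [this]
    exact h' z hcz
  refine ⟨ν, hν, fun S hS => ?_⟩
  rcases hS with rfl | ⟨hm, hd, rfl⟩
  · exact hopen
  have hmgf : ∀ t : ℝ, -1 < t → Integrable (fun x => Real.exp (t * x)) ν ∧
      (mgf id ν t : ℂ) = weierstrassProduct φ T.phi (t + 1) := by
    intro t ht
    have h1 := h (t + 1) (by simp; linarith)
    rw [add_sub_cancel_right, complexMGF_ofReal] at h1
    simpa using h1
  have hfun : ∀ z : ℂ, 0 < z.re → complexMGF id ν z = T.phi z * complexMGF id ν (z - 1) := by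
    intro z hz
    have h1 := (h (z + 1) (by simp; linarith)).2
    rw [add_sub_cancel_right] at h1
    rw [h1, (h z hz).2]
    refine weierstrassProduct_add_one hT hφ fun k => (isGood_zero hpos).phi_ne_zero ?_
    simp only [Complex.add_re, Complex.natCast_re]
    positivity
  -- Fatou's lemma at the exponents `-1 + 1/(n+1)`, where `E V^{s-1} = E V^s / φ(s) ≤ E V^s / m`
  have hneg : Integrable (fun x => Real.exp (-1 * x)) ν := by
    set s : ℕ → ℝ := fun n => 1 / ((n : ℝ) + 1) with hs
    have hs0 : ∀ n, 0 < s n := fun n => by positivity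
    have hs1 : ∀ n, s n ≤ 1 := fun n => by
      rw [hs]
      simp only
      rw [div_le_one (by positivity)]
      linarith [(Nat.cast_nonneg n : (0 : ℝ) ≤ n)]
    have hbound : ∀ n, ∫⁻ x, ENNReal.ofReal (Real.exp ((s n - 1) * x)) ∂ν ≤
        ENNReal.ofReal ((1 + mgf id ν 1) / T.m) := by
      intro n
      rw [lintegral_exp_of_integrable (hmgf _ (by linarith [hs0 n])).1]
      refine ENNReal.ofReal_le_ofReal ?_
      have h1 := hfun (s n) (by simpa using hs0 n)
      rw [phi_ofReal, show (s n : ℂ) - 1 = ((s n - 1 : ℝ) : ℂ) by push_cast; rfl,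
        complexMGF_ofReal, complexMGF_ofReal] at h1
      have h2 : mgf id ν (s n) = T.phiReal (s n) * mgf id ν (s n - 1) := by exact_mod_cast h1
      have h3 : mgf id ν (s n) ≤ 1 + mgf id ν 1 := by
        have i1 := (hmgf 1 (by norm_num)).1
        have i2 := (hmgf (s n) (by linarith [hs0 n])).1
        calc mgf id ν (s n) ≤ ∫ x, (1 + Real.exp (1 * x)) ∂ν := by
              refine integral_mono i2 ((integrable_const 1).add i1) fun x => ?_
              simp only [id]
              rcases le_total 0 x with hx | hx
              · have := Real.exp_le_exp.2 (mul_le_mul_of_nonneg_right (hs1 n) hx)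
                linarith
              · have := Real.exp_le_one_iff.2 (mul_nonpos_of_nonneg_of_nonpos (hs0 n).le hx)
                linarith [Real.exp_pos (1 * x)]
          _ = 1 + mgf id ν 1 := by
              rw [integral_add (integrable_const 1) i1]
              simp [mgf]
      have h4 : T.m ≤ T.phiReal (s n) := by
        rw [← T.phiReal_zero]
        exact phiReal_mono le_rfl T.convergesAt_zero le_rfl (hs0 n).le
      rw [le_div_iff₀ hm]
      have h5 : 0 ≤ mgf id ν (s n - 1) := mgf_nonneg
      nlinarith
    have hle : ∫⁻ x, ENNReal.ofReal (Real.exp (-1 * x)) ∂ν ≤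
        ENNReal.ofReal ((1 + mgf id ν 1) / T.m) := by
      calc ∫⁻ x, ENNReal.ofReal (Real.exp (-1 * x)) ∂ν
          ≤ ∫⁻ x, liminf (fun n => ENNReal.ofReal (Real.exp ((s n - 1) * x))) atTop ∂ν := by
            refine lintegral_mono fun x => le_of_eq (Tendsto.liminf_eq ?_).symm
            have h1 : Tendsto s atTop (𝓝 0) := tendsto_one_div_add_atTop_nhds_zero_nat
            have h2 : Continuous fun r : ℝ => ENNReal.ofReal (Real.exp ((r - 1) * x)) :=
              ENNReal.continuous_ofReal.comp (by fun_prop)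
            have h3 := (h2.tendsto 0).comp h1
            rw [zero_sub] at h3
            exact h3
        _ ≤ liminf (fun n => ∫⁻ x, ENNReal.ofReal (Real.exp ((s n - 1) * x)) ∂ν) atTop :=
            lintegral_liminf_le fun n => by fun_prop
        _ ≤ _ := (liminf_le_liminf (Eventually.of_forall hbound)).trans (by simp)
    refine ⟨by fun_prop, ?_⟩
    rw [hasFiniteIntegral_iff_ofReal (ae_of_all _ fun x => (Real.exp_pos _).le)]
    exact hle.trans_lt ENNReal.ofReal_lt_top
  have hint : ∀ t : ℝ, -1 ≤ t → Integrable (fun x => Real.exp (t * x)) ν := fun t ht => by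
    rcases ht.eq_or_lt with rfl | ht
    · exact hneg
    · exact (hmgf t ht).1
  have hcont := continuousOn_complexMGF hint
  have heq : EqOn (complexMGF id ν) (fun z => T.phi z * complexMGF id ν (z - 1))
      closedHalfPlane := by
    refine EqOn.of_subset_closure (s := {z : ℂ | 0 < z.re}) (fun z hz => hfun z hz)
      (hcont.mono fun z hz => ?_) (T.continuousOn_phi.mul (hcont.comp (by fun_prop) fun z hz => ?_))
      (fun z hz => show 0 ≤ z.re from le_of_lt hz) ?_
    · have : 0 ≤ z.re := hz
      change -1 ≤ z.re
      linarith
    · have : 0 ≤ z.re := hz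
      change -1 ≤ (z - 1).re
      simpa using this
    · rw [Complex.closure_setOfPred_lt_re]
      exact fun z hz => hz
  intro z hz
  have hz0 : 0 ≤ z.re := hz
  refine ⟨hint _ (by simpa using hz0), ?_⟩
  have hne : ∀ k : ℕ, T.phi (k + z) ≠ 0 := fun k h0 => by
    have := re_phi_pos_of_m_pos hm (z := k + z) (by simp; positivity)
    simp [h0] at this
  have h1 := weierstrassProduct_add_one hT hφ hne
  have h2 := (h (z + 1) (by simp; linarith)).2
  rw [add_sub_cancel_right] at h2
  rw [← h2, heq hz] at h1
  have hz1 : T.phi z ≠ 0 := by simpa using hne 0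
  exact mul_left_cancel₀ hz1 h1

/-- `W_φ` is analytic, as the Mellin transform of a law. -/
theorem analyticOnNhd_weierstrassProduct {ν : Measure ℝ}
    (h : ∀ z ∈ T.openDomain, Integrable (fun x => Real.exp ((z - 1).re * x)) ν ∧
        complexMGF id ν (z - 1) = weierstrassProduct φ T.phi z) :
    AnalyticOnNhd ℂ (weierstrassProduct φ T.phi) T.openDomain := by
  intro z hz
  have hmem : (z - 1).re ∈ interior (integrableExpSet id ν) := by
    refine mem_interior.2 ⟨{t : ℝ | T.dPhi < ((t + 1 : ℝ) : EReal)}, fun t ht => ?_,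
      isOpen_lt continuous_const (continuous_coe_real_ereal.comp (by fun_prop)), ?_⟩
    · have := (h ((t + 1 : ℝ) : ℂ) ht).1
      change Integrable (fun x => Real.exp (t * x)) ν
      simpa using this
    · change T.dPhi < (((z - 1).re + 1 : ℝ) : EReal)
      rw [show (z - 1).re + 1 = z.re by simp]
      exact hz
  have h1 : AnalyticAt ℂ (fun z => complexMGF id ν (z - 1)) z :=
    AnalyticAt.fun_comp (analyticAt_complexMGF hmem) (by fun_prop)
  refine h1.congr ?_
  filter_upwards [T.isOpen_openDomain.mem_nhds hz] with w hw using (h w hw).2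

end BernsteinTriplet

/-! ### The identity `ψ(z) = z φ(z)` -/

namespace LaguerreTriplet

variable {N : LaguerreTriplet}

lemma ae_Ioi {p : ℝ → Prop} (h : ∀ y, 0 < y → p y) : ∀ᵐ y ∂(N.Pi.restrict (Ioi 0)), p y :=
  (ae_restrict_iff' measurableSet_Ioi).2 (ae_of_all _ h)

lemma min_sq_nonneg {y : ℝ} (hy : 0 < y) : 0 ≤ min (y ^ 2) y := le_min (by positivity) hy.le

lemma integrable_min (N : LaguerreTriplet) :
    Integrable (fun y : ℝ => min (y ^ 2) y) (N.Pi.restrict (Ioi 0)) := by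
  refine ⟨by fun_prop, ?_⟩
  rw [hasFiniteIntegral_iff_ofReal (ae_Ioi fun y hy => min_sq_nonneg hy)]
  exact (setLIntegral_le_lintegral _ _).trans_lt N.Pi_fin

/-- A function dominated by a multiple of `y² ∧ y` is `Π`-integrable. -/
lemma integrable_of_norm_le {E : Type*} [NormedAddCommGroup E] {f : ℝ → E} {C : ℝ}
    (hf : AEStronglyMeasurable f (N.Pi.restrict (Ioi 0)))
    (h : ∀ y, 0 < y → ‖f y‖ ≤ C * min (y ^ 2) y) : Integrable f (N.Pi.restrict (Ioi 0)) :=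
  (N.integrable_min.const_mul C).mono' hf (ae_Ioi h)

/-- The integrand of `ψ`. -/
noncomputable def psiKernel (z : ℂ) (y : ℝ) : ℂ := Complex.exp (-z * (y : ℂ)) - 1 + z * (y : ℂ)

lemma continuous_psiKernel (y : ℝ) : Continuous fun z => psiKernel z y := by
  unfold psiKernel
  fun_prop

lemma aestronglyMeasurable_psiKernel (z : ℂ) :
    AEStronglyMeasurable (psiKernel z) (N.Pi.restrict (Ioi 0)) := by
  have : Continuous (psiKernel z) := by unfold psiKernel; fun_prop
  exact this.aestronglyMeasurable

lemma norm_exp_neg_mul_le_one {z : ℂ} (hz : 0 ≤ z.re) {y : ℝ} (hy : 0 < y) :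
    ‖Complex.exp (-z * (y : ℂ))‖ ≤ 1 := by
  rw [norm_cexp_mul_ofReal, Complex.neg_re]
  exact Real.exp_le_one_iff.2 (by nlinarith)

lemma norm_psiKernel_le {z : ℂ} (hz : 0 ≤ z.re) {y : ℝ} (hy : 0 < y) :
    ‖psiKernel z y‖ ≤ (‖z‖ ^ 2 + ‖z‖ + 2) * min (y ^ 2) y := by
  have hz0 := norm_nonneg z
  rcases le_total y 1 with h | h
  · rw [min_eq_left (by nlinarith)]
    have h1 := norm_exp_sub_one_sub_le_max (-z * (y : ℂ))
    have h2 : Real.exp (-z * (y : ℂ)).re ≤ 1 := by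
      rw [← Complex.norm_exp]
      exact norm_exp_neg_mul_le_one hz hy
    have h3 : psiKernel z y = Complex.exp (-z * (y : ℂ)) - 1 - -z * (y : ℂ) := by
      unfold psiKernel
      ring
    rw [max_eq_left h2, norm_mul, norm_neg, Complex.norm_real, Real.norm_of_nonneg hy.le] at h1
    rw [h3]
    nlinarith [sq_nonneg y, mul_nonneg hz0 (sq_nonneg y)]
  · rw [min_eq_right (by nlinarith)]
    have h1 : ‖psiKernel z y‖ ≤ ‖Complex.exp (-z * (y : ℂ))‖ + 1 + ‖z‖ * y := by
      refine (norm_add_le _ _).trans (add_le_add ((norm_sub_le _ _).trans (by simp)) ?_)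
      simp [abs_of_pos hy]
    have h2 := norm_exp_neg_mul_le_one hz hy
    nlinarith [sq_nonneg ‖z‖, mul_nonneg (sq_nonneg ‖z‖) hy.le]

lemma integrable_psiKernel {z : ℂ} (hz : 0 ≤ z.re) :
    Integrable (psiKernel z) (N.Pi.restrict (Ioi 0)) :=
  integrable_of_norm_le (aestronglyMeasurable_psiKernel z) fun _ => norm_psiKernel_le hz

lemma psi_eq (N : LaguerreTriplet) (z : ℂ) :
    N.psi z = ((N.σ ^ 2 : ℝ) : ℂ) * z ^ 2 + (N.m : ℂ) * z +
      ∫ y in Ioi (0 : ℝ), psiKernel z y ∂N.Pi := rfl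

lemma differentiableOn_psi (N : LaguerreTriplet) :
    DifferentiableOn ℂ N.psi {z : ℂ | 0 < z.re} := by
  intro z hz
  have hs : Metric.ball z 1 ∩ {w : ℂ | 0 < w.re} ∈ 𝓝 z :=
    inter_mem (Metric.ball_mem_nhds z one_pos)
      ((isOpen_lt continuous_const Complex.continuous_re).mem_nhds hz)
  have key := hasDerivAt_integral_of_dominated_loc_of_deriv_le (F := psiKernel)
    (F' := fun w y => Complex.exp (-w * (y : ℂ)) * (-(y : ℂ)) + y)
    (bound := fun y => (‖z‖ + 1 + 2) * min (y ^ 2) y) (μ := N.Pi.restrict (Ioi 0)) hs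
    (Eventually.of_forall fun w => aestronglyMeasurable_psiKernel w)
    (integrable_psiKernel (le_of_lt hz)) (by fun_prop) ?_ (N.integrable_min.const_mul _) ?_
  · have h1 := key.2.differentiableAt
    have h2 : DifferentiableAt ℂ (fun z : ℂ => ((N.σ ^ 2 : ℝ) : ℂ) * z ^ 2 + (N.m : ℂ) * z) z := by
      fun_prop
    exact (h2.add h1).differentiableWithinAt
  · refine ae_Ioi fun y hy w hw => ?_
    have hw0 : 0 ≤ w.re := le_of_lt hw.2
    have hwn : ‖w‖ ≤ ‖z‖ + 1 := by
      have := hw.1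
      rw [Metric.mem_ball, dist_eq_norm] at this
      have := norm_le_norm_add_norm_sub' w z
      linarith
    have h0 : Complex.exp (-w * (y : ℂ)) * (-(y : ℂ)) + y =
        -((Complex.exp (-w * (y : ℂ)) - 1) * (y : ℂ)) := by ring
    rw [h0, norm_neg, norm_mul, Complex.norm_real, Real.norm_of_nonneg hy.le]
    have h2 := norm_exp_neg_mul_le_one hw0 hy
    have hz0 := norm_nonneg z
    rcases le_total y 1 with h | h
    · rw [min_eq_left (by nlinarith)]
      have h1 := norm_exp_sub_one_le_max (-w * (y : ℂ))
      rw [Complex.norm_exp] at h2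
      rw [max_eq_left h2, norm_mul, norm_neg, Complex.norm_real, Real.norm_of_nonneg hy.le] at h1
      have : ‖w‖ * y ≤ (‖z‖ + 1) * y := by gcongr
      nlinarith [sq_nonneg y]
    · rw [min_eq_right (by nlinarith)]
      have h1 : ‖Complex.exp (-w * (y : ℂ)) - 1‖ ≤ 2 := by
        refine (norm_sub_le _ _).trans ?_
        rw [norm_one]
        linarith
      nlinarith
  · refine ae_Ioi fun y hy w hw => ?_
    have h1 : HasDerivAt (fun w : ℂ => -w * (y : ℂ)) (-(y : ℂ)) w := by
      simpa using (hasDerivAt_id w).neg.mul_const (y : ℂ)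
    have h2 : HasDerivAt (fun w : ℂ => w * (y : ℂ)) (y : ℂ) w := by
      simpa using (hasDerivAt_id w).mul_const (y : ℂ)
    exact (h1.cexp.sub_const 1).add h2

lemma continuousOn_psi (N : LaguerreTriplet) :
    ContinuousOn N.psi BernsteinTriplet.closedHalfPlane := by
  intro z hz
  have h : ContinuousWithinAt (fun w => ∫ y in Ioi (0 : ℝ), psiKernel w y ∂N.Pi)
      BernsteinTriplet.closedHalfPlane z := by
    refine continuousWithinAt_of_dominated
      (bound := fun y => ((‖z‖ + 1) ^ 2 + (‖z‖ + 1) + 2) * min (y ^ 2) y)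
      (Eventually.of_forall fun w => aestronglyMeasurable_psiKernel w) ?_
      (N.integrable_min.const_mul _)
      (ae_of_all _ fun y => (continuous_psiKernel y).continuousWithinAt)
    filter_upwards [self_mem_nhdsWithin,
      mem_nhdsWithin_of_mem_nhds (Metric.ball_mem_nhds z one_pos)] with w hw hwb
    refine ae_Ioi fun y hy => (norm_psiKernel_le hw hy).trans ?_
    have hwn : ‖w‖ ≤ ‖z‖ + 1 := by
      rw [Metric.mem_ball, dist_eq_norm] at hwb
      have := norm_le_norm_add_norm_sub' w z
      linarith
    have := min_sq_nonneg hy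
    gcongr
  have h2 : ContinuousWithinAt (fun z : ℂ => ((N.σ ^ 2 : ℝ) : ℂ) * z ^ 2 + (N.m : ℂ) * z)
      BernsteinTriplet.closedHalfPlane z := by
    fun_prop
  exact h2.add h

lemma Pi_Ioi_lt_top (N : LaguerreTriplet) {t : ℝ} (ht : 0 < t) : N.Pi (Ioi t) < ⊤ := by
  have hc : 0 < min (t ^ 2) t := lt_min (by positivity) ht
  have h1 : ENNReal.ofReal (min (t ^ 2) t) * N.Pi (Ioi t) ≤
      ∫⁻ y, ENNReal.ofReal (min (y ^ 2) y) ∂N.Pi := by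
    refine le_trans ?_ (mul_meas_ge_le_lintegral₀ (by fun_prop)
      (ENNReal.ofReal (min (t ^ 2) t)))
    gcongr
    intro y hy
    have hy' : t < y := hy
    refine ENNReal.ofReal_le_ofReal (min_le_min ?_ hy'.le)
    gcongr
  by_contra h
  rw [not_lt, top_le_iff] at h
  rw [h, ENNReal.mul_top (ENNReal.ofReal_pos.2 hc).ne'] at h1
  exact absurd N.Pi_fin (not_lt.2 h1)

/-- Integration by parts, in the form of the layer cake formula, in the integral defining
`ladder`. -/
lemma integral_tail (N : LaguerreTriplet) {u : ℝ} (hu : 0 < u) :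
    u * ∫ y in Ioi (0 : ℝ), (1 - Real.exp (-u * y)) * (N.Pi (Ioi y)).toReal =
      ∫ y in Ioi (0 : ℝ), (Real.exp (-u * y) - 1 + u * y) ∂N.Pi := by
  have hnn : ∀ t : ℝ, 0 < t → 0 ≤ 1 - Real.exp (-u * t) := fun t ht => by
    have := Real.exp_le_one_iff.2 (show -u * t ≤ 0 by nlinarith)
    linarith
  have hint : ∀ r : ℝ, ∫ t in (0 : ℝ)..r, (1 - Real.exp (-u * t)) =
      u⁻¹ * (Real.exp (-u * r) - 1 + u * r) := fun r => by
    have h : ∀ t : ℝ, HasDerivAt (fun r => u⁻¹ * (Real.exp (-u * r) - 1 + u * r))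
        (1 - Real.exp (-u * t)) t := fun t => by
      have h1 : HasDerivAt (fun r : ℝ => -u * r) (-u) t := by
        simpa using (hasDerivAt_id t).const_mul (-u)
      have h2 : HasDerivAt (fun r : ℝ => u * r) u t := by
        simpa using (hasDerivAt_id t).const_mul u
      refine (((h1.exp.sub_const 1).add h2).const_mul u⁻¹).congr_deriv ?_
      field_simp
      ring
    rw [intervalIntegral.integral_eq_sub_of_hasDerivAt (fun t _ => h t)
      (Continuous.intervalIntegrable (by fun_prop) _ _)]
    simp
  have hcake := lintegral_comp_eq_lintegral_meas_lt_mul (N.Pi.restrict (Ioi 0)) (f := fun y => y)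
    (g := fun t => 1 - Real.exp (-u * t)) (ae_Ioi fun y hy => hy.le) aemeasurable_id'
    (fun t _ => Continuous.intervalIntegrable (by fun_prop) _ _)
    ((ae_restrict_iff' measurableSet_Ioi).2 (ae_of_all _ hnn))
  simp only [hint] at hcake
  have hmeas : Measurable fun y : ℝ => N.Pi (Ioi y) :=
    Antitone.measurable fun a b hab => measure_mono (Ioi_subset_Ioi hab)
  have hnn2 : ∀ y : ℝ, 0 < y → 0 ≤ u⁻¹ * (Real.exp (-u * y) - 1 + u * y) := fun y _ => by
    have := Real.add_one_le_exp (-u * y)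
    exact mul_nonneg (by positivity) (by linarith)
  rw [integral_eq_lintegral_of_nonneg_ae ((ae_restrict_iff' measurableSet_Ioi).2
    (ae_of_all _ fun y hy => mul_nonneg (hnn y hy) ENNReal.toReal_nonneg))
    ((by fun_prop : Measurable _).mul hmeas.ennreal_toReal).aestronglyMeasurable]
  have hL : ∫⁻ y in Ioi (0 : ℝ), ENNReal.ofReal ((1 - Real.exp (-u * y)) * (N.Pi (Ioi y)).toReal) =
      ∫⁻ y in Ioi (0 : ℝ), (N.Pi.restrict (Ioi 0)) {a | y < a} *
        ENNReal.ofReal (1 - Real.exp (-u * y)) := by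
    refine setLIntegral_congr_fun measurableSet_Ioi fun y hy => ?_
    have hy' : 0 < y := hy
    have h1 : (N.Pi.restrict (Ioi 0)) {a | y < a} = N.Pi (Ioi y) := by
      change (N.Pi.restrict (Ioi 0)) (Ioi y) = _
      rw [Measure.restrict_apply measurableSet_Ioi]
      congr 1
      ext a
      simp only [mem_inter_iff, mem_Ioi]
      exact ⟨fun h => h.1, fun h => ⟨h, hy'.trans h⟩⟩
    rw [h1, ENNReal.ofReal_mul (hnn y hy'), ENNReal.ofReal_toReal (N.Pi_Ioi_lt_top hy').ne, mul_comm]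
  rw [hL, ← hcake, ← integral_eq_lintegral_of_nonneg_ae (ae_Ioi hnn2) (by fun_prop),
    integral_const_mul]
  field_simp

lemma psi_ofReal (N : LaguerreTriplet) (u : ℝ) :
    N.psi u = ((N.σ ^ 2 * u ^ 2 + N.m * u +
      ∫ y in Ioi (0 : ℝ), (Real.exp (-u * y) - 1 + u * y) ∂N.Pi : ℝ) : ℂ) := by
  rw [psi_eq]
  push_cast
  rw [← integral_complex_ofReal]
  congr 2
  ext y
  simp [psiKernel]

lemma Represents.psi_ofReal {φ : ℝ → ℝ} (hN : N.Represents φ) {u : ℝ} (hu : 0 < u) :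
    N.psi u = ((u * φ u : ℝ) : ℂ) := by
  rw [N.psi_ofReal, hN u hu, ladder, ← N.integral_tail hu]
  congr 1
  ring

/-- `ψ(z) = z φ(z)`: both sides are holomorphic on `Re z > 0`, continuous up to the boundary, and
agree on the positive half-line. -/
theorem Represents.psi_eq_mul_phi {φ : ℝ → ℝ} (hN : N.Represents φ) {T : BernsteinTriplet}
    (hT : T.Represents φ) (hφ : IsBernstein φ) {z : ℂ} (hz : 0 ≤ z.re) : N.psi z = z * T.phi z := by
  have h1 : EqOn N.psi (fun z => z * T.phi z) {z : ℂ | 0 < z.re} := by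
    refine eqOn_halfPlane_of_eq_ofReal (c := 0) N.differentiableOn_psi
      (differentiableOn_id.mul (BernsteinTriplet.differentiableOn_phi
        (BernsteinTriplet.isGood_zero fun v hv => hT.pos hφ hv))) fun u hu => ?_
    rw [hN.psi_ofReal hu, Complex.ofReal_mul, hT u hu]
  refine EqOn.of_subset_closure (t := BernsteinTriplet.closedHalfPlane) h1 N.continuousOn_psi
    (continuousOn_id.mul T.continuousOn_phi) (fun z hz => show 0 ≤ z.re from le_of_lt hz) ?_ hz
  rw [Complex.closure_setOfPred_lt_re]
  exact fun z hz => hz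

end LaguerreTriplet

/-! ### Bounded approximations of the powers, as test functions for the generator -/

/-- The bounded approximation `x / (1 + ε x)` of the identity on `[0, ∞)`. -/
noncomputable def sat (ε x : ℝ) : ℝ := x / (1 + ε * x)

/-- The weight `1 / (1 + ε x)`; it is `1 - ε w` for `w = sat ε x`. -/
noncomputable def satWeight (ε x : ℝ) : ℝ := 1 / (1 + ε * x)

section sat

variable {ε x y : ℝ}

lemma one_add_mul_pos (hε : 0 ≤ ε) (hx : 0 ≤ x) : 0 < 1 + ε * x := by positivity

lemma sat_eq : sat ε x = x * satWeight ε x := by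
  unfold sat satWeight
  ring

lemma satWeight_pos (hε : 0 ≤ ε) (hx : 0 ≤ x) : 0 < satWeight ε x :=
  one_div_pos.2 (one_add_mul_pos hε hx)

lemma satWeight_le_one (hε : 0 ≤ ε) (hx : 0 ≤ x) : satWeight ε x ≤ 1 :=
  (div_le_one (one_add_mul_pos hε hx)).2 (by nlinarith [mul_nonneg hε hx])

lemma sat_nonneg (hε : 0 ≤ ε) (hx : 0 ≤ x) : 0 ≤ sat ε x :=
  div_nonneg hx (one_add_mul_pos hε hx).le

lemma satWeight_eq (hε : 0 ≤ ε) (hx : 0 ≤ x) : satWeight ε x = 1 - ε * sat ε x := by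
  have := one_add_mul_pos hε hx
  unfold sat satWeight
  field_simp
  ring

lemma sat_le_self (hε : 0 ≤ ε) (hx : 0 ≤ x) : sat ε x ≤ x := by
  rw [sat_eq]
  exact mul_le_of_le_one_right hx (satWeight_le_one hε hx)

lemma mul_sat_nonneg (hε : 0 ≤ ε) (hx : 0 ≤ x) : 0 ≤ ε * sat ε x :=
  mul_nonneg hε (sat_nonneg hε hx)

lemma mul_sat_le_one (hε : 0 ≤ ε) (hx : 0 ≤ x) : ε * sat ε x ≤ 1 := by
  have h1 := satWeight_pos hε hx
  rw [satWeight_eq hε hx] at h1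
  linarith

lemma hasDerivAt_satWeight (hε : 0 ≤ ε) (hx : 0 ≤ x) :
    HasDerivAt (satWeight ε) (-ε * satWeight ε x ^ 2) x := by
  have h0 := (one_add_mul_pos hε hx).ne'
  have h1 : HasDerivAt (fun x => 1 + ε * x) ε x := by
    simpa using ((hasDerivAt_id x).const_mul ε).const_add 1
  refine ((hasDerivAt_const x (1 : ℝ)).div h1 h0).congr_deriv ?_
  unfold satWeight
  field_simp
  ring

lemma hasDerivAt_sat (hε : 0 ≤ ε) (hx : 0 ≤ x) : HasDerivAt (sat ε) (satWeight ε x ^ 2) x := by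
  have h0 := (one_add_mul_pos hε hx).ne'
  have h1 : HasDerivAt (fun x => 1 + ε * x) ε x := by
    simpa using ((hasDerivAt_id x).const_mul ε).const_add 1
  refine ((hasDerivAt_id x).div h1 h0).congr_deriv ?_
  unfold satWeight
  simp only [id_eq]
  field_simp
  ring

lemma continuousOn_sat (hε : 0 ≤ ε) : ContinuousOn (sat ε) (Ici 0) := fun _ hx =>
  (hasDerivAt_sat hε hx).continuousAt.continuousWithinAt

lemma continuousOn_satWeight (hε : 0 ≤ ε) : ContinuousOn (satWeight ε) (Ici 0) := fun _ hx =>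
  (hasDerivAt_satWeight hε hx).continuousAt.continuousWithinAt

lemma hasDerivAt_sat_exp (hε : 0 ≤ ε) (hx : 0 ≤ x) (y : ℝ) :
    HasDerivAt (fun y => sat ε (Real.exp (-y) * x))
      (-(sat ε (Real.exp (-y) * x) * satWeight ε (Real.exp (-y) * x))) y := by
  have h1 : HasDerivAt (fun y => Real.exp (-y) * x) (-Real.exp (-y) * x) y := by
    simpa using ((hasDerivAt_id y).neg.exp).mul_const x
  refine ((hasDerivAt_sat hε (by positivity)).comp y h1).congr_deriv ?_
  rw [sat_eq]
  ring

lemma hasDerivAt_satWeight_exp (hε : 0 ≤ ε) (hx : 0 ≤ x) (y : ℝ) :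
    HasDerivAt (fun y => satWeight ε (Real.exp (-y) * x))
      (ε * sat ε (Real.exp (-y) * x) * satWeight ε (Real.exp (-y) * x)) y := by
  have h1 : HasDerivAt (fun y => Real.exp (-y) * x) (-Real.exp (-y) * x) y := by
    simpa using ((hasDerivAt_id y).neg.exp).mul_const x
  refine ((hasDerivAt_satWeight hε (by positivity)).comp y h1).congr_deriv ?_
  rw [sat_eq]
  ring

/-- The bounded approximation `w^j / (1 + ε x)` of `x^j`, where `w = sat ε x`. -/
noncomputable def satPow (ε : ℝ) (j : ℕ) (x : ℝ) : ℝ := sat ε x ^ j * satWeight ε x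

lemma sat_pow_succ (j : ℕ) : sat ε x ^ (j + 1) = x * satPow ε j x := by
  rw [pow_succ, satPow]
  nth_rw 2 [sat_eq]
  ring

lemma satPow_nonneg (hε : 0 ≤ ε) (hx : 0 ≤ x) (j : ℕ) : 0 ≤ satPow ε j x :=
  mul_nonneg (pow_nonneg (sat_nonneg hε hx) j) (satWeight_pos hε hx).le

lemma satPow_le_pow (hε : 0 ≤ ε) (hx : 0 ≤ x) (j : ℕ) : satPow ε j x ≤ x ^ j :=
  (mul_le_of_le_one_right (pow_nonneg (sat_nonneg hε hx) j) (satWeight_le_one hε hx)).trans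
    (pow_le_pow_left₀ (sat_nonneg hε hx) (sat_le_self hε hx) j)

lemma satPow_le (hε : 0 < ε) (hx : 0 ≤ x) (j : ℕ) :
    satPow ε j x ≤ (1 / ε) ^ j * satWeight ε x := by
  have h1 : sat ε x ≤ 1 / ε := by
    rw [le_div_iff₀ hε, mul_comm]
    exact mul_sat_le_one hε.le hx
  have := satWeight_pos hε.le hx
  have := sat_nonneg hε.le hx
  unfold satPow
  gcongr

/-- The dilated function `y ↦ e^{-y} satPow ε j (e^{-y} x)`. By `sat_pow_succ`, for `x > 0` it is
`sat ε (e^{-y} x) ^ (j + 1) / x`; the present form makes sense at `x = 0` as well. -/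
noncomputable def satFlow (ε : ℝ) (j : ℕ) (x y : ℝ) : ℝ :=
  Real.exp (-y) * satPow ε j (Real.exp (-y) * x)

lemma satFlow_zero (j : ℕ) : satFlow ε j x 0 = satPow ε j x := by simp [satFlow]

lemma hasDerivAt_satFlow (hε : 0 ≤ ε) (hx : 0 ≤ x) (j : ℕ) (y : ℝ) :
    HasDerivAt (satFlow ε j x)
      (-(j + 1) * (satFlow ε j x y * satWeight ε (Real.exp (-y) * x))) y := by
  have h0 : HasDerivAt (fun y => Real.exp (-y)) (-Real.exp (-y)) y := by
    simpa using (hasDerivAt_id y).neg.exp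
  have h1 := h0.mul (((hasDerivAt_sat_exp hε hx y).pow j).mul (hasDerivAt_satWeight_exp hε hx y))
  refine h1.congr_deriv ?_
  have h2 := satWeight_eq hε (show 0 ≤ Real.exp (-y) * x by positivity)
  simp only [satFlow, satPow, Pi.mul_apply, Pi.pow_apply]
  have h3 : ε * sat ε (Real.exp (-y) * x) = 1 - satWeight ε (Real.exp (-y) * x) := by linarith
  rw [h3]
  generalize sat ε (Real.exp (-y) * x) = a
  generalize satWeight ε (Real.exp (-y) * x) = b
  cases j with
  | zero => simp; ring
  | succ j => rw [Nat.add_sub_cancel]; push_cast; ring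

lemma satFlow_nonneg (hε : 0 ≤ ε) (hx : 0 ≤ x) (j : ℕ) : 0 ≤ satFlow ε j x y :=
  mul_nonneg (Real.exp_pos _).le (satPow_nonneg hε (by positivity) j)

/-- The dilation decreases `satPow`: bounds at `x` hold along the whole flow. -/
lemma satFlow_le (hε : 0 ≤ ε) (hx : 0 ≤ x) (j : ℕ) (hy : 0 ≤ y) :
    satFlow ε j x y ≤ satPow ε j x := by
  have h : Antitone (satFlow ε j x) :=
    antitone_of_hasDerivAt_nonpos (fun y => hasDerivAt_satFlow hε hx j y) fun y => by
      have := satFlow_nonneg (y := y) hε hx j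
      have := satWeight_pos hε (show 0 ≤ Real.exp (-y) * x by positivity)
      have : 0 ≤ ((j : ℝ) + 1) * (satFlow ε j x y * satWeight ε (Real.exp (-y) * x)) := by
        positivity
      simp only [Pi.zero_apply]
      linarith
  simpa [satFlow_zero] using h hy

/-- The compensated increment of `satFlow`, integrated against the Lévy measure in the generator. -/
noncomputable def satKernel (ε : ℝ) (j : ℕ) (x y : ℝ) : ℝ :=
  satFlow ε j x y - satPow ε j x + y * ((j + 1) * (satPow ε j x * satWeight ε x))

/-- Second order Taylor bound in `y`, by applying the mean value inequality twice. -/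
lemma norm_satKernel_le_sq (hε : 0 ≤ ε) (hx : 0 ≤ x) (j : ℕ) (hy : 0 ≤ y) :
    ‖satKernel ε j x y‖ ≤ (j + 1) * (j + 2) * satPow ε j x * y ^ 2 := by
  set M : ℝ := (j + 1) * (j + 2) * satPow ε j x with hM
  -- `D` is the derivative of the flow, and `|D'| ≤ M`
  set D : ℝ → ℝ := fun s => -(j + 1) * (satFlow ε j x s * satWeight ε (Real.exp (-s) * x)) with hD
  have hD' : ∀ s, HasDerivAt D (-(j + 1) * (satFlow ε j x s * satWeight ε (Real.exp (-s) * x)) *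
      (-(j + 1) * satWeight ε (Real.exp (-s) * x) + ε * sat ε (Real.exp (-s) * x))) s := fun s => by
    refine (((hasDerivAt_satFlow hε hx j s).mul
      (hasDerivAt_satWeight_exp hε hx s)).const_mul (-((j : ℝ) + 1))).congr_deriv ?_
    ring
  have hM0 : 0 ≤ M := by
    have := satPow_nonneg hε hx j
    positivity
  have hDM : ∀ s, 0 ≤ s → ‖D s - D 0‖ ≤ M * ‖s - 0‖ := fun s hs => by
    refine (convex_Ici (0 : ℝ)).norm_image_sub_le_of_norm_hasDerivWithin_le
      (fun t _ => (hD' t).hasDerivWithinAt) (fun t ht => ?_) self_mem_Ici hs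
    have ht' : 0 ≤ Real.exp (-t) * x := by positivity
    have h1 := satFlow_nonneg (y := t) hε hx j
    have h2 := satFlow_le hε hx j ht
    have h3 := satWeight_pos hε ht'
    have h4 := satWeight_le_one hε ht'
    have h5 := mul_sat_nonneg hε ht'
    have h6 := mul_sat_le_one hε ht'
    have h7 : satFlow ε j x t * satWeight ε (Real.exp (-t) * x) ≤ satPow ε j x := by nlinarith
    have h8 : |-((j : ℝ) + 1) * satWeight ε (Real.exp (-t) * x) +
        ε * sat ε (Real.exp (-t) * x)| ≤ j + 2 := by
      have hj : (0 : ℝ) ≤ j := j.cast_nonneg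
      rw [abs_le]
      constructor <;> nlinarith
    rw [norm_mul, norm_mul, norm_neg, Real.norm_eq_abs, Real.norm_eq_abs, Real.norm_eq_abs,
      abs_of_nonneg (mul_nonneg h1 h3.le), abs_of_nonneg (by positivity : (0 : ℝ) ≤ (j : ℝ) + 1), hM]
    calc ((j : ℝ) + 1) * (satFlow ε j x t * satWeight ε (Real.exp (-t) * x)) * _
        ≤ (j + 1) * satPow ε j x * (j + 2) := by
          have := satPow_nonneg hε hx j
          gcongr
      _ = _ := by ring
  have hD0 : D 0 = -((j + 1) * (satPow ε j x * satWeight ε x)) := by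
    simp only [hD, satFlow_zero, neg_zero, Real.exp_zero, one_mul]
    ring
  have hR := (convex_Icc (0 : ℝ) y).norm_image_sub_le_of_norm_hasDerivWithin_le
    (f := fun s => satFlow ε j x s - s * D 0) (f' := fun s => D s - D 0) (C := M * y)
    (fun s _ => ?_) (fun s hs => ?_) (left_mem_Icc.2 hy) (right_mem_Icc.2 hy)
  · rw [sub_zero, Real.norm_of_nonneg hy, satFlow_zero, hD0] at hR
    have h1 : satKernel ε j x y = satFlow ε j x y - y * -((j + 1) * (satPow ε j x * satWeight ε x))
        - (satPow ε j x - 0 * -((j + 1) * (satPow ε j x * satWeight ε x))) := by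
      unfold satKernel
      ring
    rw [h1]
    linarith
  · have h1 : HasDerivAt (fun s => s * D 0) (D 0) s := by
      simpa using (hasDerivAt_id s).mul_const (D 0)
    exact ((hasDerivAt_satFlow hε hx j s).sub h1).hasDerivWithinAt
  · refine (hDM s hs.1).trans ?_
    rw [sub_zero, Real.norm_of_nonneg hs.1]
    exact mul_le_mul_of_nonneg_left hs.2 hM0

/-- The increment is dominated by `y² ∧ y`, with a factor that decays in `x` as fast as `satPow`, and
uniformly in `ε`. -/
lemma norm_satKernel_le (hε : 0 ≤ ε) (hx : 0 ≤ x) (j : ℕ) (hy : 0 < y) :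
    ‖satKernel ε j x y‖ ≤ (j + 1) * (j + 2) * satPow ε j x * min (y ^ 2) y := by
  rcases le_total y 1 with h | h
  · rw [min_eq_left (by nlinarith)]
    exact norm_satKernel_le_sq hε hx j hy.le
  · rw [min_eq_right (by nlinarith)]
    have h1 := satFlow_nonneg (y := y) hε hx j
    have h2 := satFlow_le hε hx j hy.le
    have h3 := satWeight_pos hε hx
    have h4 := satWeight_le_one hε hx
    have h5 := satPow_nonneg hε hx j
    have hj : (0 : ℝ) ≤ j := j.cast_nonneg
    have h6 : 0 ≤ y * ((j + 1) * (satPow ε j x * satWeight ε x)) := by positivity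
    have h7 : y * ((j + 1) * (satPow ε j x * satWeight ε x)) ≤ y * ((j + 1) * (satPow ε j x * 1)) := by
      gcongr
    have h8 : satPow ε j x ≤ satPow ε j x * y := le_mul_of_one_le_right h5 h
    have h9 : ((j : ℝ) + 2) * satPow ε j x * y ≤ (j + 1) * (j + 2) * satPow ε j x * y := by
      have h10 : ((j : ℝ) + 2) ≤ (j + 1) * (j + 2) := by nlinarith
      gcongr
    refine le_trans ?_ h9
    rw [Real.norm_eq_abs, satKernel, abs_le]
    constructor <;> nlinarith

lemma continuous_satKernel_right (hε : 0 ≤ ε) (hx : 0 ≤ x) (j : ℕ) :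
    Continuous (satKernel ε j x) := by
  have h : Continuous (satFlow ε j x) := continuous_iff_continuousAt.2 fun y =>
    (hasDerivAt_satFlow hε hx j y).continuousAt
  unfold satKernel
  fun_prop

lemma continuousOn_satPow (hε : 0 ≤ ε) (j : ℕ) : ContinuousOn (satPow ε j) (Ici 0) :=
  ((continuousOn_sat hε).pow j).mul (continuousOn_satWeight hε)

lemma continuousOn_satKernel_left (hε : 0 ≤ ε) (j : ℕ) (y : ℝ) :
    ContinuousOn (fun x => satKernel ε j x y) (Ici 0) := by
  have h1 := continuousOn_satPow hε j
  have h2 := continuousOn_satWeight hε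
  have h3 : ContinuousOn (fun x => satFlow ε j x y) (Ici 0) :=
    continuousOn_const.mul (h1.comp (by fun_prop) fun x hx => by
      have : 0 ≤ x := hx
      exact mem_Ici.2 (by positivity))
  unfold satKernel
  fun_prop

end sat

namespace LaguerreTriplet

variable {N : LaguerreTriplet} {ε x : ℝ}

/-- The generator without its drift term `-x f'(x)`, applied to `sat ε ^ (j + 1)`. -/
noncomputable def satGen (N : LaguerreTriplet) (ε : ℝ) (j : ℕ) (x : ℝ) : ℝ :=
  N.σ ^ 2 * ((j + 1) * (satPow ε j x * satWeight ε x * ((j + 1) - (j + 2) * (ε * sat ε x)))) +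
    N.m * ((j + 1) * (satPow ε j x * satWeight ε x)) +
    ∫ y in Ioi (0 : ℝ), satKernel ε j x y ∂N.Pi

/-- The bound is uniform in `ε`: this is what makes the moments of an invariant law finite. -/
lemma exists_abs_satGen_le (N : LaguerreTriplet) (j : ℕ) :
    ∃ D : ℝ, 0 ≤ D ∧ ∀ ε x : ℝ, 0 ≤ ε → 0 ≤ x → |N.satGen ε j x| ≤ D * satPow ε j x := by
  set I : ℝ := ∫ y in Ioi (0 : ℝ), min (y ^ 2) y ∂N.Pi with hI
  have hI0 : 0 ≤ I := integral_nonneg_of_ae (ae_Ioi fun y hy => min_sq_nonneg hy)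
  have hm := N.m_nonneg
  refine ⟨N.σ ^ 2 * ((j + 1) * (j + 2)) + N.m * (j + 1) + (j + 1) * (j + 2) * I, by positivity,
    fun ε x hε hx => ?_⟩
  have h1 := satPow_nonneg hε hx j
  have h2 := satWeight_pos hε hx
  have h3 := satWeight_le_one hε hx
  have h4 := mul_sat_nonneg hε hx
  have h5 := mul_sat_le_one hε hx
  have hj : (0 : ℝ) ≤ j := j.cast_nonneg
  have h6 : |(j + 1) - (j + 2) * (ε * sat ε x)| ≤ (j + 2 : ℝ) := by
    rw [abs_le]
    constructor <;> nlinarith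
  have h7 : |satPow ε j x * satWeight ε x| ≤ satPow ε j x := by
    rw [abs_of_nonneg (mul_nonneg h1 h2.le)]
    exact mul_le_of_le_one_right h1 h3
  have h8 : |∫ y in Ioi (0 : ℝ), satKernel ε j x y ∂N.Pi| ≤ (j + 1) * (j + 2) * satPow ε j x * I := by
    rw [hI, ← integral_const_mul]
    exact norm_integral_le_of_norm_le (N.integrable_min.const_mul _)
      (ae_Ioi fun y hy => norm_satKernel_le hε hx j hy)
  have hj1 : |((j : ℝ) + 1)| = j + 1 := abs_of_nonneg (by positivity)
  unfold satGen
  refine (abs_add_three _ _ _).trans ?_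
  rw [abs_mul, abs_mul ((j : ℝ) + 1), abs_mul (satPow ε j x * satWeight ε x), abs_mul N.m,
    abs_mul ((j : ℝ) + 1), abs_of_nonneg (sq_nonneg N.σ), abs_of_nonneg hm, hj1]
  calc _ ≤ N.σ ^ 2 * ((j + 1) * (satPow ε j x * (j + 2))) + N.m * ((j + 1) * satPow ε j x) +
        (j + 1) * (j + 2) * satPow ε j x * I := by gcongr
    _ = _ := by ring

lemma continuousOn_satGen (N : LaguerreTriplet) (hε : 0 < ε) (j : ℕ) :
    ContinuousOn (N.satGen ε j) (Ici 0) := by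
  have h1 := continuousOn_satPow hε.le j
  have h2 := continuousOn_satWeight hε.le
  have h3 := continuousOn_sat hε.le
  have h4 : ContinuousOn (fun x => ∫ y in Ioi (0 : ℝ), satKernel ε j x y ∂N.Pi) (Ici 0) := by
    refine continuousOn_of_dominated
      (bound := fun y => (j + 1) * (j + 2) * ((1 / ε) ^ j * 1) * min (y ^ 2) y)
      (fun x hx => (continuous_satKernel_right hε.le hx j).aestronglyMeasurable)
      (fun x hx => ae_Ioi fun y hy => (norm_satKernel_le hε.le hx j hy).trans ?_)
      (N.integrable_min.const_mul _)
      (ae_of_all _ fun y => continuousOn_satKernel_left hε.le j y)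
    have h5 := min_sq_nonneg hy
    have h6 : satPow ε j x ≤ (1 / ε) ^ j * 1 :=
      (satPow_le hε hx j).trans (by gcongr; exact satWeight_le_one hε.le hx)
    gcongr
  unfold satGen
  fun_prop

/-! ### The action of the generator on the test functions -/

lemma tendsto_satWeight_atTop (hε : 0 < ε) : Tendsto (satWeight ε) atTop (𝓝 0) := by
  have h : Tendsto (fun x => 1 + ε * x) atTop atTop :=
    tendsto_atTop_add_const_left _ _ (tendsto_id.const_mul_atTop hε)
  refine h.inv_tendsto_atTop.congr fun x => ?_
  rw [satWeight, one_div, Pi.inv_apply]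

lemma tendsto_sat_atTop (hε : 0 < ε) : Tendsto (sat ε) atTop (𝓝 (1 / ε)) := by
  have h : Tendsto (fun x => (1 - satWeight ε x) / ε) atTop (𝓝 ((1 - 0) / ε)) :=
    (tendsto_const_nhds.sub (tendsto_satWeight_atTop hε)).div_const ε
  rw [sub_zero] at h
  refine h.congr' ?_
  filter_upwards [eventually_ge_atTop 0] with x hx
  rw [satWeight_eq hε.le hx]
  field_simp
  ring

/-- The test function `ε^{-(j+1)} - sat ε ^ (j+1)`; the constant makes it vanish at infinity. -/
noncomputable def testFun (hε : 0 < ε) (j : ℕ) : C₀(ℝ≥0, ℝ) where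
  toFun x := (1 / ε) ^ (j + 1) - sat ε x ^ (j + 1)
  continuous_toFun := by
    have h : Continuous fun x : ℝ≥0 => sat ε x :=
      (continuousOn_sat hε.le).comp_continuous NNReal.continuous_coe fun x => x.2
    fun_prop
  zero_at_infty' := by
    rw [cocompact_eq_atTop]
    have h := (((tendsto_sat_atTop hε).comp (NNReal.tendsto_coe_atTop.2 tendsto_id)).pow
      (j + 1)).const_sub ((1 / ε) ^ (j + 1))
    simpa using h

/-- The image of `testFun` under the generator. -/
noncomputable def testImage (N : LaguerreTriplet) (hε : 0 < ε) (j : ℕ) : C₀(ℝ≥0, ℝ) where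
  toFun x := (j + 1) * (sat ε x ^ (j + 1) * satWeight ε x) - N.satGen ε j x
  continuous_toFun := by
    have h1 : Continuous fun x : ℝ≥0 => sat ε x :=
      (continuousOn_sat hε.le).comp_continuous NNReal.continuous_coe fun x => x.2
    have h2 : Continuous fun x : ℝ≥0 => satWeight ε x :=
      (continuousOn_satWeight hε.le).comp_continuous NNReal.continuous_coe fun x => x.2
    have h3 : Continuous fun x : ℝ≥0 => N.satGen ε j x :=
      (N.continuousOn_satGen hε j).comp_continuous NNReal.continuous_coe fun x => x.2
    fun_prop
  zero_at_infty' := by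
    rw [cocompact_eq_atTop]
    have hcoe : Tendsto (fun x : ℝ≥0 => (x : ℝ)) atTop atTop := NNReal.tendsto_coe_atTop.2 tendsto_id
    have h1 := (tendsto_sat_atTop hε).comp hcoe
    have h2 := (tendsto_satWeight_atTop hε).comp hcoe
    have h3 : Tendsto (fun x : ℝ≥0 => N.satGen ε j x) atTop (𝓝 0) := by
      obtain ⟨D, hD, h⟩ := N.exists_abs_satGen_le j
      refine squeeze_zero_norm (fun x => (h ε x hε.le x.2).trans
        (mul_le_mul_of_nonneg_left (satPow_le hε x.2 j) hD)) ?_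
      simpa using (h2.const_mul ((1 / ε) ^ j)).const_mul D
    simpa using (((h1.pow (j + 1)).mul h2).const_mul ((j : ℝ) + 1)).sub h3

lemma hasDerivAt_sat_exp_id (hε : 0 ≤ ε) (u : ℝ) :
    HasDerivAt (fun u => sat ε (Real.exp u))
      (sat ε (Real.exp u) * (1 - ε * sat ε (Real.exp u))) u := by
  refine ((hasDerivAt_sat hε (Real.exp_pos u).le).comp u (Real.hasDerivAt_exp u)).congr_deriv ?_
  rw [← satWeight_eq hε (Real.exp_pos u).le, sat_eq]
  ring

/-- In the variable `u = log x` the function `W = sat ε` solves the logistic equation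
`W' = W (1 - ε W)`, so that all derivatives are polynomials in `W`, which has limits at `±∞`. -/
lemma isC2Extended_testFun (hε : 0 < ε) (j : ℕ) :
    IsC2Extended (fun u : ℝ => testFun hε j (Real.toNNReal (Real.exp u))) := by
  set W : ℝ → ℝ := fun u => sat ε (Real.exp u) with hW
  have hfun : (fun u : ℝ => testFun hε j (Real.toNNReal (Real.exp u))) =
      fun u => (1 / ε) ^ (j + 1) - W u ^ (j + 1) := by
    ext u
    change (1 / ε) ^ (j + 1) - sat ε (Real.toNNReal (Real.exp u)) ^ (j + 1) = _
    rw [Real.coe_toNNReal _ (Real.exp_pos u).le]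
  rw [hfun]
  have hWd : ∀ u, HasDerivAt W (W u * (1 - ε * W u)) u := fun u => hasDerivAt_sat_exp_id hε.le u
  have hd1 : deriv (fun u => (1 / ε) ^ (j + 1) - W u ^ (j + 1)) =
      fun u => -((j + 1) * (W u ^ (j + 1) * (1 - ε * W u))) := by
    ext u
    refine (((hWd u).pow (j + 1)).const_sub _).deriv.trans ?_
    rw [Nat.add_sub_cancel]
    push_cast
    ring
  have hd2 : deriv (fun u => -((j + 1) * (W u ^ (j + 1) * (1 - ε * W u)))) =
      fun u => -((j + 1) * (W u ^ (j + 1) * (1 - ε * W u) * ((j + 1) - (j + 2) * (ε * W u)))) := by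
    ext u
    refine ((((hWd u).pow (j + 1)).mul (((hWd u).const_mul ε).const_sub 1)).const_mul
      ((j : ℝ) + 1)).neg.deriv.trans ?_
    rw [Nat.add_sub_cancel]
    push_cast
    simp only [Pi.pow_apply]
    ring
  have htop : Tendsto W atTop (𝓝 (1 / ε)) := (tendsto_sat_atTop hε).comp Real.tendsto_exp_atTop
  have hbot : Tendsto W atBot (𝓝 0) := by
    have h := (hasDerivAt_sat hε.le le_rfl).continuousAt.tendsto.comp Real.tendsto_exp_atBot
    rwa [sat_eq, zero_mul] at h
  have hlim : ∀ p : ℝ → ℝ, Continuous p →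
      (∃ l : ℝ, Tendsto (fun u => p (W u)) atTop (𝓝 l)) ∧
      (∃ l : ℝ, Tendsto (fun u => p (W u)) atBot (𝓝 l)) := fun p hp =>
    ⟨⟨_, (hp.tendsto _).comp htop⟩, ⟨_, (hp.tendsto _).comp hbot⟩⟩
  constructor
  · have h : ContDiff ℝ 2 W := by
      have h1 : ContDiff ℝ 2 fun u => Real.exp u / (1 + ε * Real.exp u) :=
        ContDiff.div (by fun_prop) (by fun_prop) fun u =>
          (one_add_mul_pos hε.le (Real.exp_pos u).le).ne'
      exact h1
    fun_prop
  · intro i hi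
    interval_cases i
    · rw [iteratedDeriv_zero]
      exact hlim (fun w => (1 / ε) ^ (j + 1) - w ^ (j + 1)) (by fun_prop)
    · rw [iteratedDeriv_one, hd1]
      exact hlim (fun w => -((j + 1) * (w ^ (j + 1) * (1 - ε * w)))) (by fun_prop)
    · rw [iteratedDeriv_succ, iteratedDeriv_one, hd1, hd2]
      exact hlim (fun w => -((j + 1) * (w ^ (j + 1) * (1 - ε * w) * ((j + 1) - (j + 2) * (ε * w)))))
        (by fun_prop)

lemma gen_testFun (hε : 0 < ε) (j : ℕ) {x : ℝ} (hx : 0 < x) :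
    N.gen (fun y : ℝ => testFun hε j (Real.toNNReal y)) x =
      (j + 1) * (sat ε x ^ (j + 1) * satWeight ε x) - N.satGen ε j x := by
  set f : ℝ → ℝ := fun y => testFun hε j (Real.toNNReal y) with hf
  have hfx : ∀ y, 0 ≤ y → f y = (1 / ε) ^ (j + 1) - sat ε y ^ (j + 1) := fun y hy => by
    change (1 / ε) ^ (j + 1) - sat ε (Real.toNNReal y) ^ (j + 1) = _
    rw [Real.coe_toNNReal _ hy]
  have hd1 : ∀ y, 0 < y → HasDerivAt f (-((j + 1) * (satPow ε j y * satWeight ε y))) y :=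
      fun y hy => by
    have h1 := (((hasDerivAt_sat hε.le hy.le).pow (j + 1)).const_sub ((1 / ε) ^ (j + 1)))
    refine (h1.congr_deriv ?_).congr_of_eventuallyEq ?_
    · rw [Nat.add_sub_cancel, satPow]
      push_cast
      ring
    · filter_upwards [lt_mem_nhds hy] with z hz
      exact hfx z (le_of_lt hz)
  have hd2 : iteratedDeriv 2 f x = deriv (fun y => -((j + 1) * (satPow ε j y * satWeight ε y))) x := by
    rw [iteratedDeriv_succ, iteratedDeriv_one]
    refine EventuallyEq.deriv_eq ?_
    filter_upwards [lt_mem_nhds hx] with y hy using (hd1 y hy).deriv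
  have hsw := satWeight_eq hε.le hx.le
  -- `x f'' + f'`, which in the variable `log x` is the second derivative divided by `x`
  have hxd2 : x * iteratedDeriv 2 f x + deriv f x =
      -((j + 1) * (satPow ε j x * satWeight ε x * ((j + 1) - (j + 2) * (ε * sat ε x)))) := by
    have h1 := hasDerivAt_satWeight hε.le hx.le
    have h2 := ((((hasDerivAt_sat hε.le hx.le).pow j).mul h1).mul h1).const_mul ((j : ℝ) + 1)
    have h3 : deriv (fun y => -((j + 1) * (satPow ε j y * satWeight ε y))) x = _ := h2.neg.deriv
    rw [hd2, h3, (hd1 x hx).deriv]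
    have h4 : ε * sat ε x = 1 - satWeight ε x := by linarith
    have h5 : ε * (x * satWeight ε x) = 1 - satWeight ε x := by rw [← sat_eq, h4]
    simp only [satPow, Pi.mul_apply, Pi.pow_apply]
    rw [h4]
    have h6 : x * satWeight ε x = sat ε x := sat_eq.symm
    cases j with
    | zero =>
      simp only [pow_zero, Nat.cast_zero]
      linear_combination (2 * satWeight ε x ^ 2) * h5
    | succ j =>
      rw [Nat.add_sub_cancel]
      push_cast
      linear_combination
        (-((j : ℝ) + 2) * (j + 1) * sat ε x ^ j * satWeight ε x ^ 3) * h6 +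
          (2 * ((j : ℝ) + 2) * sat ε x ^ (j + 1) * satWeight ε x ^ 2) * h5
  have hI : (∫ y in Ioi (0 : ℝ), (f (Real.exp (-y) * x) - f x + y * x * deriv f x) ∂N.Pi) =
      -x * ∫ y in Ioi (0 : ℝ), satKernel ε j x y ∂N.Pi := by
    rw [← integral_const_mul]
    refine integral_congr_ae (ae_of_all _ fun y => ?_)
    simp only
    rw [hfx _ (by positivity), hfx _ hx.le, (hd1 x hx).deriv, sat_pow_succ, sat_pow_succ]
    unfold satKernel satFlow
    ring
  rw [gen, hI]
  have h7 : -x * (∫ y in Ioi (0 : ℝ), satKernel ε j x y ∂N.Pi) / x =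
      -∫ y in Ioi (0 : ℝ), satKernel ε j x y ∂N.Pi := by
    field_simp
  have h8 : x * deriv f x = -((j + 1) * (sat ε x ^ (j + 1) * satWeight ε x)) := by
    rw [(hd1 x hx).deriv, sat_pow_succ]
    ring
  have h9 : deriv f x = -((j + 1) * (satPow ε j x * satWeight ε x)) := (hd1 x hx).deriv
  rw [h7, satGen]
  linear_combination N.σ ^ 2 * hxd2 + N.m * h9 - h8

end LaguerreTriplet

/-! ### Moments of an invariant law -/

lemma IsPositiveLaw.ae_pos {ν : Measure ℝ} (h : IsPositiveLaw ν) : ∀ᵐ x ∂ν, 0 < x := by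
  have h1 : ∀ᵐ x ∂ν, x ∉ Iic (0 : ℝ) := measure_eq_zero_iff_ae_notMem.1 h.2
  filter_upwards [h1] with x hx using not_le.1 hx

lemma integrable_zeroAtInfty {ν : Measure ℝ} [IsFiniteMeasure ν] (f : C₀(ℝ≥0, ℝ)) :
    Integrable (fun x : ℝ => f (Real.toNNReal x)) ν :=
  Integrable.of_bound (C := ‖f‖) (f.continuous.comp continuous_real_toNNReal).aestronglyMeasurable
    (ae_of_all _ fun _ => f.toBCF.norm_coe_le_norm _)

/-- An invariant law annihilates the range of the generator. -/
theorem IsInvariantLaw.integral_eq_zero {P : ℝ≥0 → C₀(ℝ≥0, ℝ) → C₀(ℝ≥0, ℝ)} {ν : Measure ℝ}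
    (hν : IsInvariantLaw P ν) {f h : C₀(ℝ≥0, ℝ)}
    (hf : Tendsto (fun t : ℝ≥0 => ‖(t : ℝ)⁻¹ • (P t f - f) - h‖) (𝓝[>] 0) (𝓝 0)) :
    ∫ x, h (Real.toNNReal x) ∂ν = 0 := by
  have := hν.1.1
  have hle : ∀ t : ℝ≥0, ‖∫ x, h (Real.toNNReal x) ∂ν‖ ≤ ‖(t : ℝ)⁻¹ • (P t f - f) - h‖ := fun t => by
    have h1 : ∫ x, ((t : ℝ)⁻¹ • (P t f - f) - h) (Real.toNNReal x) ∂ν =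
        -∫ x, h (Real.toNNReal x) ∂ν := by
      have h2 : ∀ x : ℝ, ((t : ℝ)⁻¹ • (P t f - f) - h) (Real.toNNReal x) =
          (t : ℝ)⁻¹ * (P t f (Real.toNNReal x) - f (Real.toNNReal x)) - h (Real.toNNReal x) :=
        fun x => rfl
      have h3 : Integrable (fun x : ℝ => (t : ℝ)⁻¹ *
          (P t f (Real.toNNReal x) - f (Real.toNNReal x))) ν :=
        ((integrable_zeroAtInfty _).sub (integrable_zeroAtInfty _)).const_mul _
      simp only [h2]
      rw [integral_sub h3 (integrable_zeroAtInfty _), integral_const_mul,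
        integral_sub (integrable_zeroAtInfty _) (integrable_zeroAtInfty _), hν.2 t f]
      simp
    rw [← norm_neg, ← h1]
    refine (norm_integral_le_of_norm_le_const (C := ‖(t : ℝ)⁻¹ • (P t f - f) - h‖)
      (ae_of_all _ fun x => ((t : ℝ)⁻¹ • (P t f - f) - h).toBCF.norm_coe_le_norm _)).trans ?_
    simp
  exact norm_le_zero_iff.1 (ge_of_tendsto' hf hle)

namespace LaguerreTriplet

variable {N : LaguerreTriplet} {P : ℝ≥0 → C₀(ℝ≥0, ℝ) → C₀(ℝ≥0, ℝ)} {ν : Measure ℝ}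

/-- As `ε ↓ 0` the generator acts as on the power `x^{j+1}`. -/
lemma continuousWithinAt_satGen (N : LaguerreTriplet) (j : ℕ) {x : ℝ} (hx : 0 ≤ x) :
    ContinuousWithinAt (fun ε => N.satGen ε j x) (Ici 0) 0 := by
  have h1 : ContinuousOn (fun ε => satWeight ε x) (Ici 0) := fun ε hε =>
    ContinuousAt.continuousWithinAt
      (ContinuousAt.div (by fun_prop) (by fun_prop) (one_add_mul_pos hε hx).ne')
  have h2 : ContinuousOn (fun ε => sat ε x) (Ici 0) := by
    simp only [sat_eq]
    fun_prop
  have h3 : ContinuousOn (fun ε => satPow ε j x) (Ici 0) := by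
    unfold satPow
    fun_prop
  have h4 : ∀ y, ContinuousOn (fun ε => satKernel ε j x y) (Ici 0) := fun y => by
    have hx' : 0 ≤ Real.exp (-y) * x := by positivity
    have h5 : ContinuousOn (fun ε => satWeight ε (Real.exp (-y) * x)) (Ici 0) := fun ε hε =>
      ContinuousAt.continuousWithinAt
        (ContinuousAt.div (by fun_prop) (by fun_prop) (one_add_mul_pos hε hx').ne')
    have h6 : ContinuousOn (fun ε => satFlow ε j x y) (Ici 0) := by
      unfold satFlow satPow
      simp only [sat_eq]
      fun_prop
    unfold satKernel
    fun_prop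
  have h7 : ContinuousOn (fun ε => ∫ y in Ioi (0 : ℝ), satKernel ε j x y ∂N.Pi) (Ici 0) := by
    refine continuousOn_of_dominated (bound := fun y => (j + 1) * (j + 2) * x ^ j * min (y ^ 2) y)
      (fun ε hε => (continuous_satKernel_right hε hx j).aestronglyMeasurable)
      (fun ε hε => ae_Ioi fun y hy => (norm_satKernel_le hε hx j hy).trans ?_)
      (N.integrable_min.const_mul _) (ae_of_all _ h4)
    have h8 := min_sq_nonneg hy
    have h9 := satPow_le_pow hε hx j
    gcongr
  have h10 : ContinuousOn (fun ε => N.satGen ε j x) (Ici 0) := by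
    unfold satGen
    fun_prop
  exact h10 0 self_mem_Ici

/-- On powers the generator without drift acts through the Laplace exponent `ψ`. -/
lemma satGen_zero (N : LaguerreTriplet) (j : ℕ) (x : ℝ) :
    N.satGen 0 j x = (N.psi ((j + 1 : ℝ) : ℂ)).re * x ^ j := by
  have h1 : ∀ y, satKernel 0 j x y =
      (Real.exp (-((j : ℝ) + 1) * y) - 1 + ((j : ℝ) + 1) * y) * x ^ j := fun y => by
    have h2 : Real.exp (-((j : ℝ) + 1) * y) = Real.exp (-y) * Real.exp (-y) ^ j := by
      rw [← Real.exp_nat_mul, ← Real.exp_add]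
      ring_nf
    simp only [satKernel, satFlow, satPow, sat, satWeight, h2]
    simp only [zero_mul, add_zero, div_one, mul_one, mul_pow]
    ring
  rw [N.psi_ofReal, Complex.ofReal_re, satGen]
  simp only [h1]
  rw [integral_mul_const]
  simp only [satPow, sat, satWeight]
  simp only [zero_mul, add_zero, div_one, mul_one, mul_zero, sub_zero]
  ring

/-- The test functions `sat ε ^ (j+1)` and the invariance of `ν` give the regularized form of
`(j+1) E X^{j+1} = ψ(j+1) E X^j`. -/
lemma integral_sat_eq (hN : HasGenerator P N) (hν : IsInvariantLaw P ν) {ε : ℝ} (hε : 0 < ε)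
    (j : ℕ) (hj : Integrable (fun x => x ^ j) ν) :
    Integrable (fun x : ℝ => (j + 1) * (sat ε x ^ (j + 1) * satWeight ε x)) ν ∧
      Integrable (fun x => N.satGen ε j x) ν ∧
      ∫ x : ℝ, (j + 1) * (sat ε x ^ (j + 1) * satWeight ε x) ∂ν = ∫ x, N.satGen ε j x ∂ν := by
  have hpos := hν.1.ae_pos
  have hae : ν.restrict (Ici 0) = ν :=
    Measure.restrict_eq_self_of_ae_mem (hpos.mono fun x hx => le_of_lt hx)
  have h1 := continuousOn_sat hε.le
  have h2 := continuousOn_satWeight hε.le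
  obtain ⟨D, hD, hDle⟩ := N.exists_abs_satGen_le j
  have i1 : Integrable (fun x : ℝ => (j + 1) * (sat ε x ^ (j + 1) * satWeight ε x)) ν := by
    refine (hj.const_mul ((j + 1) * (1 / ε))).mono' ?_ ?_
    · rw [← hae]
      exact ContinuousOn.aestronglyMeasurable (by fun_prop) measurableSet_Ici
    · filter_upwards [hpos] with x hx
      have h3 := sat_nonneg hε.le hx.le
      have h4 := satWeight_pos hε.le hx.le
      have h5 : sat ε x ≤ 1 / ε := by
        rw [le_div_iff₀ hε, mul_comm]
        exact mul_sat_le_one hε.le hx.le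
      have h6 := satPow_le_pow hε.le hx.le j
      have h7 := satPow_nonneg hε.le hx.le j
      rw [Real.norm_of_nonneg (by positivity)]
      calc ((j : ℝ) + 1) * (sat ε x ^ (j + 1) * satWeight ε x)
          = (j + 1) * sat ε x * satPow ε j x := by
            unfold satPow
            ring
        _ ≤ _ := by gcongr
  have i2 : Integrable (fun x => N.satGen ε j x) ν := by
    refine (hj.const_mul D).mono' ?_ ?_
    · rw [← hae]
      exact (N.continuousOn_satGen hε j).aestronglyMeasurable measurableSet_Ici
    · filter_upwards [hpos] with x hx
      exact (hDle ε x hε.le hx.le).trans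
        (mul_le_mul_of_nonneg_left (satPow_le_pow hε.le hx.le j) hD)
  refine ⟨i1, i2, ?_⟩
  have h0 := hν.integral_eq_zero (hN (testFun hε j) (N.testImage hε j) (isC2Extended_testFun hε j)
    fun x hx => (N.gen_testFun hε j hx).symm)
  rw [← sub_eq_zero, ← integral_sub i1 i2, ← h0]
  refine integral_congr_ae ?_
  filter_upwards [hpos] with x hx
  change _ = (j + 1) * (sat ε (Real.toNNReal x) ^ (j + 1) * satWeight ε (Real.toNNReal x)) -
    N.satGen ε j (Real.toNNReal x)
  rw [Real.coe_toNNReal _ hx.le]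

/-- The moment recursion `(j+1) E X^{j+1} = ψ(j+1) E X^j` of an invariant law. -/
lemma integral_pow_succ (hN : HasGenerator P N) (hν : IsInvariantLaw P ν) (j : ℕ)
    (hj : Integrable (fun x => x ^ j) ν) :
    Integrable (fun x => x ^ (j + 1)) ν ∧
      (j + 1) * ∫ x, x ^ (j + 1) ∂ν = (N.psi ((j + 1 : ℝ) : ℂ)).re * ∫ x, x ^ j ∂ν := by
  have hpos := hν.1.ae_pos
  obtain ⟨D, hD, hDle⟩ := N.exists_abs_satGen_le j
  set e : ℕ → ℝ := fun k => 1 / ((k : ℝ) + 1) with he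
  have he0 : ∀ k, 0 < e k := fun k => by positivity
  have hek : Tendsto e atTop (𝓝[Ici 0] 0) :=
    tendsto_nhdsWithin_iff.2 ⟨tendsto_one_div_add_atTop_nhds_zero_nat,
      Eventually.of_forall fun k => (he0 k).le⟩
  set A : ℕ → ℝ → ℝ := fun k x => (j + 1) * (sat (e k) x ^ (j + 1) * satWeight (e k) x) with hA
  have hAint : ∀ k, Integrable (A k) ν := fun k => (integral_sat_eq hN hν (he0 k) j hj).1
  have hAlim : ∀ x, 0 < x → Tendsto (fun k => A k x) atTop (𝓝 ((j + 1) * x ^ (j + 1))) :=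
      fun x hx => by
    have h1 : Tendsto (fun k => satWeight (e k) x) atTop (𝓝 1) := by
      have h2 : ContinuousAt (fun ε => satWeight ε x) 0 :=
        ContinuousAt.div (by fun_prop) (by fun_prop) (by simp)
      have h3 := h2.tendsto.comp (tendsto_nhds_of_tendsto_nhdsWithin hek)
      have h4 : satWeight 0 x = 1 := by simp [satWeight]
      rwa [h4] at h3
    have h2 : Tendsto (fun k => sat (e k) x) atTop (𝓝 x) := by
      simp only [sat_eq]
      simpa using h1.const_mul x
    simpa using ((h2.pow (j + 1)).mul h1).const_mul ((j : ℝ) + 1)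
  have hA0 : ∀ k x, 0 < x → 0 ≤ A k x := fun k x hx => by
    have h1 := sat_nonneg (he0 k).le hx.le
    have h2 := satWeight_pos (he0 k).le hx.le
    positivity
  have hGle : ∀ k, ∀ᵐ x ∂ν, ‖N.satGen (e k) j x‖ ≤ D * x ^ j := fun k => by
    filter_upwards [hpos] with x hx
    exact (hDle _ x (he0 k).le hx.le).trans
      (mul_le_mul_of_nonneg_left (satPow_le_pow (he0 k).le hx.le j) hD)
  -- Fatou's lemma, with the bound `∫ A k dν = ∫ satGen dν ≤ D E X^j`
  have hlim : Integrable (fun x : ℝ => (j + 1) * x ^ (j + 1)) ν := by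
    refine integrable_of_tendsto (G := A) (hpos.mono hAlim)
      (fun k => (hAint k).aestronglyMeasurable) (ne_top_of_le_ne_top
        (ENNReal.ofReal_ne_top (r := D * ∫ x, x ^ j ∂ν)) ?_)
    refine (liminf_le_liminf (v := fun _ => ENNReal.ofReal (D * ∫ x, x ^ j ∂ν))
      (Eventually.of_forall fun k => ?_)).trans (by simp)
    have h1 : ∫⁻ x, ‖A k x‖ₑ ∂ν = ENNReal.ofReal (∫ x, A k x ∂ν) := by
      rw [ofReal_integral_eq_lintegral_ofReal (hAint k) (hpos.mono (hA0 k))]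
      refine lintegral_congr_ae ?_
      filter_upwards [hpos] with x hx
      exact Real.enorm_of_nonneg (hA0 k x hx)
    rw [h1, (integral_sat_eq hN hν (he0 k) j hj).2.2, ← integral_const_mul]
    exact ENNReal.ofReal_le_ofReal ((le_abs_self _).trans
      (norm_integral_le_of_norm_le (hj.const_mul D) (hGle k)))
  have hj1 : (j : ℝ) + 1 ≠ 0 := by positivity
  refine ⟨by simpa [hj1] using hlim.const_mul ((j : ℝ) + 1)⁻¹, ?_⟩
  have hL : Tendsto (fun k => ∫ x, A k x ∂ν) atTop (𝓝 (∫ x, (j + 1) * x ^ (j + 1) ∂ν)) := by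
    refine tendsto_integral_of_dominated_convergence _ (fun k => (hAint k).aestronglyMeasurable)
      hlim (fun k => ?_) (hpos.mono hAlim)
    filter_upwards [hpos] with x hx
    have h1 := sat_nonneg (he0 k).le hx.le
    have h2 := satWeight_pos (he0 k).le hx.le
    have h3 := satWeight_le_one (he0 k).le hx.le
    have h4 := sat_le_self (he0 k).le hx.le
    rw [Real.norm_of_nonneg (hA0 k x hx)]
    calc A k x ≤ (j + 1) * (x ^ (j + 1) * 1) := by
          simp only [hA]
          gcongr
      _ = _ := by rw [mul_one]
  have hR : Tendsto (fun k => ∫ x, N.satGen (e k) j x ∂ν) atTop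
      (𝓝 (∫ x, N.satGen 0 j x ∂ν)) := by
    refine tendsto_integral_of_dominated_convergence (fun x => D * x ^ j)
      (fun k => (integral_sat_eq hN hν (he0 k) j hj).2.1.aestronglyMeasurable)
      (hj.const_mul D) hGle ?_
    filter_upwards [hpos] with x hx
    exact (N.continuousWithinAt_satGen j hx.le).tendsto.comp hek
  have h := tendsto_nhds_unique hL
    (hR.congr fun k => (integral_sat_eq hN hν (he0 k) j hj).2.2.symm)
  simp only [satGen_zero] at h
  rwa [integral_const_mul, integral_const_mul] at h

/-- The moments of an invariant law are `∏ φ(k)`. -/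
theorem moments_of_isInvariantLaw {φ : ℝ → ℝ} (hφ : N.Represents φ) (hN : HasGenerator P N)
    (hν : IsInvariantLaw P ν) (n : ℕ) :
    Integrable (fun x => x ^ n) ν ∧ ∫ x, x ^ n ∂ν = ∏ k ∈ Finset.Icc 1 n, φ k := by
  have := hν.1.1
  induction n with
  | zero => simp
  | succ j ih =>
    obtain ⟨h1, h2⟩ := integral_pow_succ hN hν j ih.1
    refine ⟨h1, ?_⟩
    have hj1 : (0 : ℝ) < (j : ℝ) + 1 := by positivity
    rw [hφ.psi_ofReal hj1, Complex.ofReal_re, mul_assoc] at h2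
    rw [mul_left_cancel₀ hj1.ne' h2, ih.2, Finset.prod_Icc_succ_top (by lia)]
    push_cast
    ring

end LaguerreTriplet

/-! ### Mellin transforms -/

/-- The moments of a law whose Mellin transform solves the functional equation. -/
lemma moments_of_solvesFunctionalEq {φ : ℝ → ℝ} {T : BernsteinTriplet} (hT : T.Represents φ)
    {S : Set ℂ} (hS : T.IsDomain S) {ν : Measure ℝ} (hdef : MellinDefinedOn ν S)
    (hν : SolvesFunctionalEq T.phi (mellinLaw ν) S) (n : ℕ) :
    Integrable (fun x => x ^ n) ν ∧ ∫ x, x ^ n ∂ν = ∏ k ∈ Finset.Icc 1 n, φ k := by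
  have hpow : ∀ (n : ℕ) (x : ℝ), (x : ℂ) ^ ((n + 1 : ℂ) - 1) = ((x ^ n : ℝ) : ℂ) := fun n x => by
    rw [add_sub_cancel_right, Complex.cpow_natCast, Complex.ofReal_pow]
  have hmem : ∀ n : ℕ, (n + 1 : ℂ) ∈ S := fun n => hS.mem_of_pos (by simp; positivity)
  have hint : ∀ n : ℕ, Integrable (fun x : ℝ => x ^ n) ν := fun n => by
    have h := hdef _ (hmem n)
    simp only [hpow] at h
    exact h.re
  have hmellin : ∀ n : ℕ, mellinLaw ν (n + 1) = ((∫ x, x ^ n ∂ν : ℝ) : ℂ) := fun n => by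
    rw [mellinLaw, ← integral_complex_ofReal]
    simp only [hpow]
  refine ⟨hint n, ?_⟩
  suffices h : mellinLaw ν (n + 1) = ((∏ k ∈ Finset.Icc 1 n, φ k : ℝ) : ℂ) by
    rw [hmellin] at h
    exact_mod_cast h
  induction n with
  | zero => simpa using hν.1
  | succ n ih =>
    have h1 : ((n + 1 : ℕ) : ℂ) = (n : ℂ) + 1 := by push_cast; rfl
    have h2 := hT ((n : ℝ) + 1) (by positivity)
    rw [h1, hν.2 _ (hmem n), ih, Finset.prod_Icc_succ_top (by lia)]
    push_cast at h2 ⊢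
    rw [← h2]
    ring

lemma cpow_exp (x : ℝ) (z : ℂ) : ((Real.exp x : ℝ) : ℂ) ^ z = Complex.exp (z * x) := by
  rw [Complex.cpow_def_of_ne_zero
    (by exact_mod_cast (Real.exp_pos x).ne'), ← Complex.ofReal_log (Real.exp_pos x).le,
    Real.log_exp, mul_comm]

end GenLaguerre

theorem mainTheorem9 (φ : ℝ → ℝ) (hφ : IsBernstein φ) :
    -- the extension of `φ` to complex arguments is available
    (∃ T : BernsteinTriplet, T.Represents φ) ∧
    ∀ T : BernsteinTriplet, T.Represents φ →
      -- the generalized Euler constant exists, with bounds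
      (Tendsto (eulerSeq φ) atTop (𝓝 (eulerGamma φ)) ∧
        0 ≤ eulerGamma φ + Real.log (φ 1) ∧
        eulerGamma φ + Real.log (φ 1) ≤ deriv φ 1 / φ 1) ∧
      -- the Weierstrass product converges absolutely and is analytic
      (∀ S : Set ℂ, T.IsDomain S → ∀ z ∈ S, WeierstrassConverges φ T.phi z) ∧
      AnalyticOnNhd ℂ (weierstrassProduct φ T.phi) T.openDomain ∧
      (0 < T.m → T.dPhi = 0 →
        ContinuousOn (weierstrassProduct φ T.phi) BernsteinTriplet.closedHalfPlane) ∧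
      -- the random variable `V_φ`
      ∃ (Ω : Type) (_ : MeasurableSpace Ω) (ℙ : Measure Ω) (V : Ω → ℝ),
        IsProbabilityMeasure ℙ ∧ Measurable V ∧ (∀ w, 0 < V w) ∧
        -- its moments, which determine its law
        (∀ n : ℕ, Integrable (fun w => V w ^ n) ℙ ∧
          ∫ w, V w ^ n ∂ℙ = ∏ k ∈ Finset.Icc 1 n, φ k) ∧
        (∀ ν : Measure ℝ, IsProbabilityMeasure ν →
          (∀ n : ℕ, Integrable (fun x => x ^ n) ν ∧
            ∫ x, x ^ n ∂ν = ∏ k ∈ Finset.Icc 1 n, φ k) →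
          ν = ℙ.map V) ∧
        -- identity in law with `V_ψ`
        (∀ N : LaguerreTriplet, N.Represents φ →
          (∀ z : ℂ, 0 ≤ z.re → N.psi z = z * T.phi z) ∧
          ∀ P : ℝ≥0 → C₀(ℝ≥0, ℝ) → C₀(ℝ≥0, ℝ), IsGLSemigroup P → HasGenerator P N →
            ∀ ν : Measure ℝ, IsInvariantLaw P ν ↔ ν = ℙ.map V) ∧
        -- Mellin transform, functional equation and uniqueness
        ∀ S : Set ℂ, T.IsDomain S →
          (∀ z ∈ S, Integrable (fun w => (V w : ℂ) ^ (z - 1)) ℙ ∧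
            ∫ w, (V w : ℂ) ^ (z - 1) ∂ℙ = weierstrassProduct φ T.phi z) ∧
          SolvesFunctionalEq T.phi (weierstrassProduct φ T.phi) S ∧
          ∀ ν : Measure ℝ, IsPositiveLaw ν → MellinDefinedOn ν S →
            SolvesFunctionalEq T.phi (mellinLaw ν) S →
            (∀ z ∈ S, mellinLaw ν z = weierstrassProduct φ T.phi z) := by
  refine ⟨hφ.exists_triplet, fun T hT => ?_⟩
  have hpos := fun u hu => hT.pos hφ (u := u) hu
  have hne : ∀ S, T.IsDomain S → ∀ z ∈ S, ∀ k : ℕ, T.phi (k + z) ≠ 0 := fun S hS z hz k => by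
    have h := hS.add_mem hz (x := k) k.cast_nonneg
    rw [add_comm, Complex.ofReal_natCast] at h
    exact hS.phi_ne_zero hpos h
  obtain ⟨ν, hν, hW⟩ := BernsteinTriplet.exists_law hT hφ
  have hopen : T.IsDomain T.openDomain := Or.inl rfl
  have hprob : IsProbabilityMeasure (ν.map Real.exp) :=
    Measure.isProbabilityMeasure_map (by fun_prop)
  have hmom := BernsteinTriplet.moments_map_exp hT hφ
    fun z hz => hW _ hopen z (T.mem_openDomain_of_pos hz)
  -- a law on the line with the moments of `V_φ` is the law of `V_φ`
  have hdet : ∀ ν' : Measure ℝ, IsProbabilityMeasure ν' →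
      (∀ n : ℕ, Integrable (fun x => x ^ n) ν' ∧ ∫ x, x ^ n ∂ν' = ∏ k ∈ Finset.Icc 1 n, φ k) →
      ν' = ν.map Real.exp := fun ν' hν' h =>
    measure_eq_of_moments_eq (hpos 1 one_pos) h hmom (BernsteinTriplet.prod_le hT hφ)
  have hmellin : ∀ S, T.IsDomain S → ∀ z ∈ S,
      Integrable (fun w => ((Real.exp w : ℝ) : ℂ) ^ (z - 1)) ν ∧
        ∫ w, ((Real.exp w : ℝ) : ℂ) ^ (z - 1) ∂ν = weierstrassProduct φ T.phi z :=
      fun S hS z hz => by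
    obtain ⟨h1, h2⟩ := hW S hS z hz
    simp only [cpow_exp]
    exact ⟨integrable_cexp_iff.2 h1, h2⟩
  refine ⟨hT.tendsto_eulerSeq hφ, fun S hS z hz =>
    BernsteinTriplet.weierstrassConverges_of_ne_zero hT hpos (hne S hS z hz),
    BernsteinTriplet.analyticOnNhd_weierstrassProduct (hW _ hopen), fun hm hd => ?_,
    ℝ, inferInstance, ν, Real.exp, hν, by fun_prop, Real.exp_pos, fun n => ?_, hdet,
    fun N hN => ⟨fun z hz => hN.psi_eq_mul_phi hT hφ hz, fun P hP hgen ν' => ?_⟩,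
    fun S hS => ⟨hmellin S hS, ⟨BernsteinTriplet.weierstrassProduct_one hT hφ, fun z hz =>
      BernsteinTriplet.weierstrassProduct_add_one hT hφ (hne S hS z hz)⟩,
      fun ν' hν' hdef hsol z hz => ?_⟩⟩
  · have hclosed := hW BernsteinTriplet.closedHalfPlane (Or.inr ⟨hm, hd, rfl⟩)
    have hcont : ContinuousOn (ProbabilityTheory.complexMGF id ν) {z : ℂ | -1 ≤ z.re} :=
      continuousOn_complexMGF fun t ht => by
        have h := (hclosed ((t + 1 : ℝ) : ℂ) (show 0 ≤ t + 1 by linarith)).1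
        simpa using h
    refine (hcont.comp (f := fun z : ℂ => z - 1) (by fun_prop) fun z hz => ?_).congr
      fun z hz => (hclosed z hz).2.symm
    have hz0 : 0 ≤ z.re := hz
    change -1 ≤ (z - 1).re
    simpa using hz0
  · obtain ⟨h1, h2⟩ := hmom n
    rw [integrable_map_measure (by fun_prop) (by fun_prop)] at h1
    rw [integral_map (by fun_prop) (by fun_prop)] at h2
    exact ⟨h1, h2⟩
  · have huniq : ∀ ν', IsInvariantLaw P ν' → ν' = ν.map Real.exp := fun ν' h =>
      hdet ν' h.1.1 (LaguerreTriplet.moments_of_isInvariantLaw hN hgen h)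
    refine ⟨huniq ν', ?_⟩
    rintro rfl
    -- the law of `V_φ` is invariant because some law is, and that one can be no other
    obtain ⟨ν₀, hν₀⟩ := hP.invariant
    exact huniq ν₀ hν₀ ▸ hν₀
  · have hlaw := hdet ν' hν'.1 (moments_of_solvesFunctionalEq hT hS hdef hsol)
    rw [← (hmellin S hS z hz).2, mellinLaw, hlaw, integral_map (by fun_prop)]
    exact (by fun_prop : Measurable fun x : ℝ => (x : ℂ) ^ (z - 1)).aestronglyMeasurable
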